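/- There is a deterministic parallel data structure (on a shared-memory machine with words of $O(\log n)$ bits that allows concurrent reads and writes, i.e. a CRCW PRAM, with memory initially zero apart from the input), which, given an unweighted directed graph $G=(V,E)$ with $|V|=n\ge 2$ vertices and $|E|=m\ge 1$ edges, a source $s\in V$ and an integer $L$ with $1\le L\le n$, maintains a shortest-path tree of depth $L$ from $s$ while batches of edges are deleted from $G$. That is, after the initialization and after each batch, it stores a tree of edges of the current graph, rooted at $s$, whose vertices are exactly those at distance at most $L$ from $s$ and in which the path from $s$ to each such vertex $v$ is a shortest path of the current graph; the parent of $v$ in the tree and the distance from $s$ to $v$ are stored explicitly. Work is the total number of operations and depth is the length of the longest chain of sequentially dependent operations. With absolute constants in the $O$-notation: - the initialization takes $O(m\log n)$ work and $O(L\log n+\log^2 n)$ depth in the worst case; - each nonempty batch of edge deletions takes $O(L\log^2 n)$ depth in the worst case, and the deletions take $O(L\log n)$ amortized work per deleted edge, amortized over the deletion of all $m$ edges: for every sequence of nonempty batches of edges of $G$ that deletes each edge at most once, the total work of all batches is $O(m\cdot L\log n)$. The batches are given one after the other: each batch is processed without knowledge of later ones. -/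

import Mathlib

/-! ### A work-depth language over a shared memory

A fixed program is run by many threads which share a memory of words. The memory is split
into arrays; a cell is addressed by the name of its array (fixed in the program text) and an
index (computed at run time). Every thread has private registers. There is no source of
randomness. -/

namespace WorkDepth

/-- A memory cell: the name of an array and an index. -/
abbrev Loc := ℕ × ℕ

/-- The contents of the shared memory. -/
abbrev Mem := Loc → ℕ

/-- The contents of the private registers of a thread. -/
abbrev Regs := ℕ → ℕ

/-- The operations on words. -/
inductive BinOp where
  | add | sub | mul | div | mod | lt | eq

/-- Subtraction is truncated at `0`; comparisons return `1` or `0`. -/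
def BinOp.eval : BinOp → ℕ → ℕ → ℕ
  | .add, x, y => x + y
  | .sub, x, y => x - y
  | .mul, x, y => x * y
  | .div, x, y => x / y
  | .mod, x, y => x % y
  | .lt, x, y => if x < y then 1 else 0
  | .eq, x, y => if x = y then 1 else 0

/-- Expressions: constants, registers, reads `a[i]` of the shared memory, operations. -/
inductive Expr where
  | const (k : ℕ)
  | reg (x : ℕ)
  | read (a : ℕ) (i : Expr)
  | op (o : BinOp) (e f : Expr)

namespace Expr

/-- The value of an expression. -/
def val (σ : Regs) (M : Mem) : Expr → ℕ
  | const k => k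
  | reg x => σ x
  | read a i => M (a, i.val σ M)
  | op o e f => o.eval (e.val σ M) (f.val σ M)

/-- All values that occur in the evaluation are machine words, that is, less than `B`. -/
def Fits (B : ℕ) (σ : Regs) (M : Mem) : Expr → Prop
  | const k => k < B
  | reg x => σ x < B
  | read a i => i.Fits B σ M ∧ M (a, i.val σ M) < B
  | op o e f => e.Fits B σ M ∧ f.Fits B σ M ∧ o.eval (e.val σ M) (f.val σ M) < B

/-- The memory cells read in the evaluation. -/
def reads (σ : Regs) (M : Mem) : Expr → Set Loc
  | const _ => ∅
  | reg _ => ∅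
  | read a i => insert (a, i.val σ M) (i.reads σ M)
  | op _ e f => e.reads σ M ∪ f.reads σ M

/-- The number of operations in the evaluation. -/
def size : Expr → ℕ
  | const _ => 1
  | reg _ => 1
  | read _ i => i.size + 1
  | op _ e f => e.size + f.size + 1

end Expr

/-- Programs. `par x e c` runs in parallel one thread for every `i` less than the value of `e`;
it executes `c`, starting from a copy of the registers in which register `x` holds `i`. -/
inductive Cmd where
  | skip
  | assign (x : ℕ) (e : Expr)
  | store (a : ℕ) (i e : Expr)
  | seq (c d : Cmd)
  | ite (e : Expr) (c d : Cmd)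
  | while (e : Expr) (c : Cmd)
  | par (x : ℕ) (e : Expr) (c : Cmd)

/-- What an execution uses: its work (total number of operations), its depth (longest chain of
sequentially dependent operations), and the memory cells that it reads and writes. -/
structure Usage where
  work : ℕ
  depth : ℕ
  reads : Set Loc
  writes : Set Loc

/-- Sequential composition. -/
def Usage.seq (u v : Usage) : Usage :=
  ⟨u.work + v.work, u.depth + v.depth, u.reads ∪ v.reads, u.writes ∪ v.writes⟩

/-- Parallel composition of the threads `0, …, k - 1`. -/
def Usage.par (k : ℕ) (u : ℕ → Usage) : Usage :=
  ⟨∑ i ∈ Finset.range k, (u i).work, (Finset.range k).sup fun i => (u i).depth,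
    ⋃ i < k, (u i).reads, ⋃ i < k, (u i).writes⟩

/-- The usage of evaluating an expression and of one further operation. -/
def Expr.usage (σ : Regs) (M : Mem) (e : Expr) : Usage :=
  ⟨e.size + 1, e.size + 1, e.reads σ M, ∅⟩

/-- `Exec B c σ M σ' M' u`: with words less than `B`, the program `c`, started with registers `σ`
and memory `M`, terminates without a fault with registers `σ'` and memory `M'`, and uses `u`.

A value that is not a word is a fault. In a parallel block any number of threads may read a cell
that no other thread of the block writes, and several threads may write a cell if they leave the
same value in it (so every rule for the resolution of concurrent writes gives the same result);
a cell that one thread writes and another thread reads is a fault. -/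
inductive Exec (B : ℕ) : Cmd → Regs → Mem → Regs → Mem → Usage → Prop
  | skip (σ : Regs) (M : Mem) : Exec B .skip σ M σ M ⟨1, 1, ∅, ∅⟩
  | assign (x : ℕ) (e : Expr) (σ : Regs) (M : Mem) (he : e.Fits B σ M) :
      Exec B (.assign x e) σ M (Function.update σ x (e.val σ M)) M (e.usage σ M)
  | store (a : ℕ) (i e : Expr) (σ : Regs) (M : Mem) (hi : i.Fits B σ M) (he : e.Fits B σ M) :
      Exec B (.store a i e) σ M σ (Function.update M (a, i.val σ M) (e.val σ M))
        (((i.usage σ M).seq (e.usage σ M)).seq ⟨1, 1, ∅, {(a, i.val σ M)}⟩)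
  | seq {c d : Cmd} {σ σ₁ σ₂ : Regs} {M M₁ M₂ : Mem} {u v : Usage}
      (hc : Exec B c σ M σ₁ M₁ u) (hd : Exec B d σ₁ M₁ σ₂ M₂ v) :
      Exec B (.seq c d) σ M σ₂ M₂ (u.seq v)
  | ite_true {e : Expr} {c : Cmd} (d : Cmd) {σ σ' : Regs} {M M' : Mem} {u : Usage}
      (he : e.Fits B σ M) (h : e.val σ M ≠ 0) (hc : Exec B c σ M σ' M' u) :
      Exec B (.ite e c d) σ M σ' M' ((e.usage σ M).seq u)
  | ite_false {e : Expr} (c : Cmd) {d : Cmd} {σ σ' : Regs} {M M' : Mem} {u : Usage}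
      (he : e.Fits B σ M) (h : e.val σ M = 0) (hd : Exec B d σ M σ' M' u) :
      Exec B (.ite e c d) σ M σ' M' ((e.usage σ M).seq u)
  | while_true {e : Expr} {c : Cmd} {σ σ₁ σ₂ : Regs} {M M₁ M₂ : Mem} {u v : Usage}
      (he : e.Fits B σ M) (h : e.val σ M ≠ 0) (hc : Exec B c σ M σ₁ M₁ u)
      (hw : Exec B (.while e c) σ₁ M₁ σ₂ M₂ v) :
      Exec B (.while e c) σ M σ₂ M₂ ((e.usage σ M).seq (u.seq v))
  | while_false {e : Expr} (c : Cmd) {σ : Regs} {M : Mem}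
      (he : e.Fits B σ M) (h : e.val σ M = 0) :
      Exec B (.while e c) σ M σ M (e.usage σ M)
  | par {x : ℕ} {e : Expr} {c : Cmd} {σ : Regs} {M M' : Mem}
      (τ : ℕ → Regs) (N : ℕ → Mem) (u : ℕ → Usage)
      (he : e.Fits B σ M)
      (hc : ∀ i < e.val σ M, Exec B c (Function.update σ x i) M (τ i) (N i) (u i))
      (race : ∀ i < e.val σ M, ∀ j < e.val σ M, i ≠ j → Disjoint (u i).reads (u j).writes)
      (written : ∀ i < e.val σ M, ∀ p ∈ (u i).writes, M' p = N i p)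
      (unwritten : ∀ p, (∀ i < e.val σ M, p ∉ (u i).writes) → M' p = M p) :
      Exec B (.par x e c) σ M σ M' ((e.usage σ M).seq (Usage.par (e.val σ M) u))

/-- The outcome of an execution is determined by the program and the start. -/
theorem Exec.unique {B : ℕ} {c : Cmd} {σ σ₁ σ₂ : Regs} {M M₁ M₂ : Mem} {u v : Usage}
    (h₁ : Exec B c σ M σ₁ M₁ u) (h₂ : Exec B c σ M σ₂ M₂ v) :
    σ₁ = σ₂ ∧ M₁ = M₂ ∧ u = v := by
  induction h₁ generalizing σ₂ M₂ v with
  | skip σ M => cases h₂; simp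
  | assign => cases h₂; simp
  | store => cases h₂; simp
  | seq hc hd ihc ihd =>
    cases h₂ with
    | seq hc' hd' =>
      obtain ⟨rfl, rfl, rfl⟩ := ihc hc'
      obtain ⟨rfl, rfl, rfl⟩ := ihd hd'
      simp
  | ite_true d he h hc ih =>
    cases h₂ with
    | ite_true _ _ _ hc' => obtain ⟨rfl, rfl, rfl⟩ := ih hc'; simp
    | ite_false _ _ h' => exact absurd h' h
  | ite_false c he h hc ih =>
    cases h₂ with
    | ite_false _ _ _ hc' => obtain ⟨rfl, rfl, rfl⟩ := ih hc'; simp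
    | ite_true _ _ h' => exact absurd h h'
  | while_true he h hc hw ihc ihw =>
    cases h₂ with
    | while_true _ _ hc' hw' =>
      obtain ⟨rfl, rfl, rfl⟩ := ihc hc'
      obtain ⟨rfl, rfl, rfl⟩ := ihw hw'
      simp
    | while_false _ _ h' => exact absurd h' h
  | while_false c he h =>
    cases h₂ with
    | while_true _ h' => exact absurd h h'
    | while_false => simp
  | @par x e c σ M M' τ N u he hc race written unwritten ih =>
    cases h₂ with
    | par τ' N' u' he' hc' race' written' unwritten' =>
      have key := fun i hi => ih i hi (hc' i hi)
      have hu : ∀ i < e.val σ M, u i = u' i := fun i hi => (key i hi).2.2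
      refine ⟨rfl, ?_, ?_⟩
      · funext p
        by_cases hp : ∃ i < e.val σ M, p ∈ (u i).writes
        · obtain ⟨i, hi, hp⟩ := hp
          rw [written i hi p hp, written' i hi p (hu i hi ▸ hp), (key i hi).2.1]
        · push Not at hp
          rw [unwritten p hp, unwritten' p fun i hi => hu i hi ▸ hp i hi]
      · congr 1
        simp only [Usage.par, Usage.mk.injEq]
        refine ⟨Finset.sum_congr rfl fun i hi => ?_, Finset.sup_congr rfl fun i hi => ?_, ?_, ?_⟩
        · rw [hu i (Finset.mem_range.1 hi)]
        · rw [hu i (Finset.mem_range.1 hi)]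
        · exact Set.iUnion₂_congr fun i hi => by rw [hu i hi]
        · exact Set.iUnion₂_congr fun i hi => by rw [hu i hi]

end WorkDepth

/-! ### Shortest-path trees of bounded depth -/

/-- `DiWalk E k u v`: there is a walk with `k` edges from `u` to `v` in the directed graph with
edge set `E`, in which `(x, y)` stands for the edge from `x` to `y`. -/
inductive DiWalk {V : Type*} (E : Set (V × V)) : ℕ → V → V → Prop
  | nil (v : V) : DiWalk E 0 v v
  | snoc {k : ℕ} {u v w : V} (h : DiWalk E k u v) (e : (v, w) ∈ E) : DiWalk E (k + 1) u w

/-- The distance from `u` to `v` is (finite and equal to) `d`. -/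
def HasDist {V : Type*} (E : Set (V × V)) (u v : V) (d : ℕ) : Prop :=
  IsLeast {k | DiWalk E k u v} d

/-- The edge set `T` is a shortest-path tree of depth `L` from `s` in the graph with edge set `E`:
a tree of edges of the graph, rooted at `s`, whose vertices are those at distance at most `L`
from `s`, and in which the path from `s` to each of these has minimum length. -/
structure IsShortestPathTree {V : Type*} (E T : Set (V × V)) (s : V) (L : ℕ) : Prop where
  subset : T ⊆ E
  root : ∀ u, (u, s) ∉ T
  parent_unique : ∀ u u' v, (u, v) ∈ T → (u', v) ∈ T → u = u'
  depth_le : ∀ u v, (u, v) ∈ T → ∃ d ≤ L, HasDist E s v d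
  path : ∀ v, ∀ d ≤ L, HasDist E s v d → DiWalk T d s v

/-! ### Input and output of the data structure

Vertices are `0, …, n - 1`. Array `0` holds, in cell `0`, the length of a list of edges, whose
sources and targets are in the arrays `1` and `2`. Array `3` holds `n`, `s` and `L`. The output is
in the arrays `4` and `5`. -/

open WorkDepth

/-- Write a list of edges into the input arrays. -/
def loadEdges {n : ℕ} (l : List (Fin n × Fin n)) (M : Mem) : Mem := fun p =>
  if p = (0, 0) then l.length
  else if p.1 = 1 then (l.map fun e => (e.1 : ℕ)).getD p.2 0
  else if p.1 = 2 then (l.map fun e => (e.2 : ℕ)).getD p.2 0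
  else M p

/-- The memory that holds `n`, `s` and `L` in array `3`, and is `0` everywhere else. -/
def paramMem (n : ℕ) (s : Fin n) (L : ℕ) : Mem := fun p =>
  if p = (3, 0) then n else if p = (3, 1) then (s : ℕ) else if p = (3, 2) then L else 0

/-- The memory `M` holds a shortest-path tree of depth `L`: for a vertex `v`, cell `v` of array `4`
holds `d + 1` if `v` is at distance `d ≤ L` from `s`, and `0` if `v` is not at such a distance;
cell `v` of array `5` holds `u + 1` if `u` is the parent of `v`, and `0` if `v` has no parent. -/
def HoldsTree {n : ℕ} (M : Mem) (E : Set (Fin n × Fin n)) (s : Fin n) (L : ℕ) : Prop :=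
  (∀ v : Fin n, (∀ d ≤ L, HasDist E s v d → M (4, v) = d + 1) ∧
    ((¬ ∃ d ≤ L, HasDist E s v d) → M (4, v) = 0)) ∧
  ∃ T : Set (Fin n × Fin n), IsShortestPathTree E T s L ∧
    ∀ v : Fin n, (∀ u : Fin n, (u, v) ∈ T → M (5, v) = u + 1) ∧
      ((∀ u : Fin n, (u, v) ∉ T) → M (5, v) = 0)

/-! ### Parallel stores and their cost -/

namespace WorkDepth

namespace Expr

/-! The algorithm is a parallel form of the Even–Shiloach tree. Every vertex has a level, its
distance from the source, stored plus `1` in array `4`, with `0` for a distance above `L`. Two local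
facts certify such a tree (`Certified`). No edge leads from a level `d < L` to a level above `d +
1`, so levels are at most the distances. Every vertex of positive level has a parent one level
lower, so levels are at least the distances.

A deletion preserves the first fact and may break the second, which is repaired level by level
(`Pending.step`). A queued vertex at level `i` looks for an in-neighbour at level `i - 1`, a level
that is already final. If there is one it becomes the parent. If there is none, then all
in-neighbours have level at least `i`, so the vertex may move to level `i + 1` (or leave the tree if
`i = L`), and it and its out-neighbours are queued for the next level. Vertices of one level do not
influence each other, so they are treated in parallel.

The search has to be cheap. For every vertex `w` and level `d` a balanced binary tree in array `6`
has leaf `u` marked with `u + 1` if `u` is an in-neighbour of `w` at level `d`. An inner node holds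
the value of one marked leaf below it, so the root is a parent, already in the encoding of the
output (`InTrees.root`). A vertex that rises moves its leaf in the trees of its out-neighbours, at
logarithmic cost for each (`moveLeaves_runs`). The lists of out-neighbours are never updated: across
a deleted edge the leaf is empty, and moving it has no effect.

The queue must be a list without repetitions. The new elements mark the leaves of a tree, subtree
counts are computed, the rank of each element is read off its root path, and the element is stored
at that rank (`insert_runs`). Every queue uses a new row of memory that is still zero (an epoch), so
nothing is ever cleared.

The targets of deleted edges lie at different levels. An auxiliary vertex `n` without in-neighbours,
with these targets and itself as out-neighbours, starts at level `0` and rises in every round; thus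
the targets are in the queue of every level from `1` on. Each vertex that can enter a queue is also
stored as its own out-neighbour, so that it is queued again when it rises and has at least one
thread.

Each level takes logarithmic depth, hence a batch has depth `O(L log n)`, which is better than
required. For the work, a rise costs out-degree times `log n`, and each vertex rises at most `L + 1`
times over all batches; the potential, the sum of degree times level, records this
(`deleteLoop_runs`, `sum_telescope`). The auxiliary vertex and the fixed cost of the rounds give
`O(L log n)` for each edge of the batch, since batches are nonempty. The initialization is a
breadth-first search with the same queue; it stops when the queue is empty, and all its other steps
run over the edges, so its work is `O(m log n)` even if `m < n`.

Words are handled uniformly: all cells stay below `b = n ^ 8`, and an expression of degree at most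
`400` has a value below `b ^ 400 = n ^ 3200` (`Expr.fits`). -/

instance : Add Expr := ⟨.op .add⟩
instance : Sub Expr := ⟨.op .sub⟩
instance : Mul Expr := ⟨.op .mul⟩
instance : Div Expr := ⟨.op .div⟩
instance : Mod Expr := ⟨.op .mod⟩
instance (k : ℕ) : OfNat Expr k := ⟨.const k⟩

section val
variable (σ : Regs) (M : Mem) (e f : Expr)

@[simp] theorem val_add : (e + f).val σ M = e.val σ M + f.val σ M := rfl
@[simp] theorem val_sub : (e - f).val σ M = e.val σ M - f.val σ M := rfl
@[simp] theorem val_mul : (e * f).val σ M = e.val σ M * f.val σ M := rfl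
@[simp] theorem val_div : (e / f).val σ M = e.val σ M / f.val σ M := rfl
@[simp] theorem val_mod : (e % f).val σ M = e.val σ M % f.val σ M := rfl
@[simp] theorem val_lt :
    (op .lt e f).val σ M = if e.val σ M < f.val σ M then 1 else 0 := rfl
@[simp] theorem val_eq :
    (op .eq e f).val σ M = if e.val σ M = f.val σ M then 1 else 0 := rfl
@[simp] theorem val_const (k : ℕ) : (const k).val σ M = k := rfl
@[simp] theorem val_reg (x : ℕ) : (reg x).val σ M = σ x := rfl
@[simp] theorem val_read (a : ℕ) : (read a e).val σ M = M (a, e.val σ M) := rfl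
@[simp] theorem val_ofNat (k : ℕ) :
    (ofNat(k) : Expr).val σ M = (OfNat.ofNat k : ℕ) := rfl

end val

/-- An upper bound for the size of an expression and for the degree in which its value grows. -/
def deg : Expr → ℕ
  | const k => k + 1
  | reg _ => 1
  | read _ i => i.deg + 1
  | op _ e f => e.deg + f.deg + 1

/-- The arrays that an expression reads. -/
def arrays : Expr → List ℕ
  | const _ => []
  | reg _ => []
  | read a i => a :: i.arrays
  | op _ e f => e.arrays ++ f.arrays

/-- The registers that an expression mentions. -/
def regs : Expr → List ℕ
  | const _ => []
  | reg x => [x]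
  | read _ i => i.regs
  | op _ e f => e.regs ++ f.regs

@[simp] theorem deg_add (e f : Expr) : (e + f).deg = e.deg + f.deg + 1 := rfl
@[simp] theorem deg_sub (e f : Expr) : (e - f).deg = e.deg + f.deg + 1 := rfl
@[simp] theorem deg_mul (e f : Expr) : (e * f).deg = e.deg + f.deg + 1 := rfl
@[simp] theorem deg_div (e f : Expr) : (e / f).deg = e.deg + f.deg + 1 := rfl
@[simp] theorem deg_mod (e f : Expr) : (e % f).deg = e.deg + f.deg + 1 := rfl
@[simp] theorem deg_op (o : BinOp) (e f : Expr) : (op o e f).deg = e.deg + f.deg + 1 := rfl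
@[simp] theorem deg_const (k : ℕ) : (const k).deg = k + 1 := rfl
@[simp] theorem deg_ofNat (k : ℕ) : (ofNat(k) : Expr).deg = (OfNat.ofNat k : ℕ) + 1 := rfl
@[simp] theorem deg_reg (x : ℕ) : (reg x).deg = 1 := rfl
@[simp] theorem deg_read (a : ℕ) (i : Expr) : (read a i).deg = i.deg + 1 := rfl

@[simp] theorem arrays_add (e f : Expr) : (e + f).arrays = e.arrays ++ f.arrays := rfl
@[simp] theorem arrays_sub (e f : Expr) : (e - f).arrays = e.arrays ++ f.arrays := rfl
@[simp] theorem arrays_mul (e f : Expr) : (e * f).arrays = e.arrays ++ f.arrays := rfl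
@[simp] theorem arrays_div (e f : Expr) : (e / f).arrays = e.arrays ++ f.arrays := rfl
@[simp] theorem arrays_mod (e f : Expr) : (e % f).arrays = e.arrays ++ f.arrays := rfl
@[simp] theorem arrays_op (o : BinOp) (e f : Expr) :
    (op o e f).arrays = e.arrays ++ f.arrays := rfl
@[simp] theorem arrays_const (k : ℕ) : (const k).arrays = [] := rfl
@[simp] theorem arrays_ofNat (k : ℕ) : (ofNat(k) : Expr).arrays = [] := rfl
@[simp] theorem arrays_reg (x : ℕ) : (reg x).arrays = [] := rfl
@[simp] theorem arrays_read (a : ℕ) (i : Expr) : (read a i).arrays = a :: i.arrays := rfl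

section reads
variable (σ : Regs) (M : Mem) (e f : Expr)

@[simp] theorem reads_add : (e + f).reads σ M = e.reads σ M ∪ f.reads σ M := rfl
@[simp] theorem reads_sub : (e - f).reads σ M = e.reads σ M ∪ f.reads σ M := rfl
@[simp] theorem reads_mul : (e * f).reads σ M = e.reads σ M ∪ f.reads σ M := rfl
@[simp] theorem reads_div : (e / f).reads σ M = e.reads σ M ∪ f.reads σ M := rfl
@[simp] theorem reads_mod : (e % f).reads σ M = e.reads σ M ∪ f.reads σ M := rfl
@[simp] theorem reads_op (o : BinOp) :
    (op o e f).reads σ M = e.reads σ M ∪ f.reads σ M := rfl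
@[simp] theorem reads_const (k : ℕ) : (const k).reads σ M = ∅ := rfl
@[simp] theorem reads_ofNat (k : ℕ) : (ofNat(k) : Expr).reads σ M = ∅ := rfl
@[simp] theorem reads_reg (x : ℕ) : (reg x).reads σ M = ∅ := rfl
@[simp] theorem reads_read (a : ℕ) :
    (read a e).reads σ M = insert (a, e.val σ M) (e.reads σ M) := rfl

end reads

theorem size_le_deg (e : Expr) : e.size ≤ e.deg := by
  induction e with
  | const k => simp [size]
  | reg x => simp [size]
  | read a i ih => simp [size, ih]
  | op o e f ihe ihf => simp only [size, deg_op]; omega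

theorem mem_arrays_of_mem_reads {σ : Regs} {M : Mem} {e : Expr} {p : Loc}
    (h : p ∈ e.reads σ M) : p.1 ∈ e.arrays := by
  induction e with
  | const k => simp [reads] at h
  | reg x => simp [reads] at h
  | read a i ih =>
    rcases h with rfl | h
    · simp
    · simp [ih h]
  | op o e f ihe ihf =>
    rcases h with h | h
    · simp [ihe h]
    · simp [ihf h]

theorem val_congr {σ σ' : Regs} {M M' : Mem} {e : Expr} (hσ : ∀ x ∈ e.regs, σ' x = σ x)
    (hM : ∀ a ∈ e.arrays, ∀ i, M' (a, i) = M (a, i)) : e.val σ' M' = e.val σ M := by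
  induction e with
  | const k => rfl
  | reg x => exact hσ x (by simp [regs])
  | read a i ih =>
    have := ih hσ fun a' h' => hM a' (by simp [h'])
    simp only [val_read, this]
    exact hM a (by simp) _
  | op o e f ihe ihf =>
    have h1 := ihe (fun x hx => hσ x (by simp [regs, hx])) fun a' h' => hM a' (by simp [h'])
    have h2 := ihf (fun x hx => hσ x (by simp [regs, hx])) fun a' h' => hM a' (by simp [h'])
    simp only [val, h1, h2]

end Expr

/-! ### Word sizes. -/

theorem BinOp.eval_lt_pow {b x y i j : ℕ} (hb : 2 ≤ b) (hx : x < b ^ i) (hy : y < b ^ j)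
    (o : BinOp) : o.eval x y < b ^ (i + j + 1) := by
  have hb0 : 0 < b := by omega
  have e1 : b ^ i ≤ b ^ (i + j) := Nat.pow_le_pow_right hb0 (by omega)
  have e2 : b ^ j ≤ b ^ (i + j) := Nat.pow_le_pow_right hb0 (by omega)
  have e3 : b ^ (i + j) * 2 ≤ b ^ (i + j + 1) := by
    rw [pow_succ]; exact Nat.mul_le_mul_left _ hb
  have e4 : 0 < b ^ (i + j) := Nat.pow_pos hb0
  cases o with
  | add => simp only [eval]; omega
  | sub => simp only [eval]; omega
  | mul =>
    have : x * y < b ^ (i + j) := by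
      rw [pow_add]; exact Nat.mul_lt_mul'' hx hy
    simp only [eval]; omega
  | div => have := Nat.div_le_self x y; simp only [eval]; omega
  | mod => have := Nat.mod_le x y; simp only [eval]; omega
  | lt => simp only [eval]; split <;> omega
  | eq => simp only [eval]; split <;> omega

/-- All registers and all memory cells hold values less than `b`. -/
structure Below (b : ℕ) (σ : Regs) (M : Mem) : Prop where
  regs : ∀ x, σ x < b
  mem : ∀ p, M p < b

theorem Below.update {b : ℕ} {σ : Regs} {M : Mem} (h : Below b σ M) {x v : ℕ} (hv : v < b) :
    Below b (Function.update σ x v) M :=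
  ⟨fun y => by by_cases hy : y = x <;> simp [Function.update, hy, hv, h.regs], h.mem⟩

theorem Below.store {b : ℕ} {σ : Regs} {M : Mem} (h : Below b σ M) {p : Loc} {v : ℕ} (hv : v < b) :
    Below b σ (Function.update M p v) :=
  ⟨h.regs, fun y => by by_cases hy : y = p <;> simp [Function.update, hy, hv, h.mem]⟩

/-- Degrees add under multiplication; the extra `1` in the degree of an operation absorbs the factor
`2` of a sum, because `2 ≤ b`. -/
theorem Expr.val_lt_pow {b : ℕ} (hb : 2 ≤ b) {σ : Regs} {M : Mem} (h : Below b σ M) (e : Expr) :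
    e.val σ M < b ^ e.deg := by
  induction e with
  | const k => exact (Nat.lt_pow_self hb).trans (Nat.pow_lt_pow_right hb (by simp))
  | reg x => simpa using h.regs x
  | read a i ih =>
    refine (h.mem _).trans_le ?_
    simp only [deg_read]
    exact Nat.le_self_pow (by simp) b
  | op o e f ihe ihf => exact BinOp.eval_lt_pow hb ihe ihf o

theorem Expr.fits {b B D : ℕ} (hb : 2 ≤ b) (hB : b ^ D ≤ B) {σ : Regs} {M : Mem}
    (h : Below b σ M) {e : Expr} (he : e.deg ≤ D) : e.Fits B σ M := by
  have hv : ∀ f : Expr, f.deg ≤ D → f.val σ M < B := fun f hf =>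
    (f.val_lt_pow hb h).trans_le ((Nat.pow_le_pow_right (by omega) hf).trans hB)
  induction e with
  | const k => exact hv (.const k) he
  | reg x => exact hv (.reg x) he
  | read a i ih => exact ⟨ih (by simp at he; omega), hv (.read a i) he⟩
  | op o e f ihe ihf =>
    exact ⟨ihe (by simp at he; omega), ihf (by simp at he; omega), hv (.op o e f) he⟩

instance : Inhabited Usage := ⟨⟨0, 0, ∅, ∅⟩⟩

/-- `c` runs from `(σ, M)` to `(σ', M')` with work at most `w` and depth at most `d`. -/
def Runs (B : ℕ) (c : Cmd) (σ : Regs) (M : Mem) (σ' : Regs) (M' : Mem) (w d : ℕ) : Prop :=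
  ∃ u, Exec B c σ M σ' M' u ∧ u.work ≤ w ∧ u.depth ≤ d

/-! ### Cost bounds for sequential programs. -/

namespace Runs
variable {B : ℕ} {c c' : Cmd} {σ σ₁ σ₂ : Regs} {M M₁ M₂ : Mem} {w w' d d' : ℕ}

theorem seq (h : Runs B c σ M σ₁ M₁ w d) (h' : Runs B c' σ₁ M₁ σ₂ M₂ w' d') :
    Runs B (.seq c c') σ M σ₂ M₂ (w + w') (d + d') := by
  obtain ⟨u, hu, h1, h2⟩ := h
  obtain ⟨v, hv, h3, h4⟩ := h'
  exact ⟨_, .seq hu hv, Nat.add_le_add h1 h3, Nat.add_le_add h2 h4⟩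

theorem mono (h : Runs B c σ M σ₁ M₁ w d) (hw : w ≤ w') (hd : d ≤ d') :
    Runs B c σ M σ₁ M₁ w' d' := by
  obtain ⟨u, hu, h1, h2⟩ := h
  exact ⟨u, hu, h1.trans hw, h2.trans hd⟩

variable {b : ℕ}

theorem assign (hb : 2 ≤ b) (hB : b ^ 400 ≤ B) (h : Below b σ M) (x : ℕ) {e : Expr} {v : ℕ}
    (he : e.deg ≤ 400) (hv : e.val σ M = v) :
    Runs B (.assign x e) σ M (Function.update σ x v) M 401 401 := by
  subst hv
  refine ⟨_, .assign x e σ M (Expr.fits hb hB h he), ?_, ?_⟩ <;>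
  · have := e.size_le_deg
    simp only [Expr.usage]; omega

theorem store (hb : 2 ≤ b) (hB : b ^ 400 ≤ B) (h : Below b σ M) (a : ℕ) {i e : Expr} {iv v : ℕ}
    (hi : i.deg ≤ 400) (he : e.deg ≤ 400) (hiv : i.val σ M = iv) (hv : e.val σ M = v) :
    Runs B (.store a i e) σ M σ (Function.update M (a, iv) v) 803 803 := by
  subst hv hiv
  refine ⟨_, .store a i e σ M (Expr.fits hb hB h hi) (Expr.fits hb hB h he), ?_, ?_⟩ <;>
  · have := e.size_le_deg
    have := i.size_le_deg
    simp only [Expr.usage, Usage.seq]; omega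

/-- The rule for loops. `I t σ M w` describes the state after `t` rounds with total work `w`. -/
theorem while_rule (hb : 2 ≤ b) (hB : b ^ 400 ≤ B) {e : Expr} (he : e.deg ≤ 400) {T d : ℕ}
    (I : ℕ → Regs → Mem → ℕ → Prop) (hI : ∀ t σ M w, I t σ M w → Below b σ M)
    (h_exit : ∀ σ M w, I T σ M w → e.val σ M = 0)
    (step : ∀ t < T, ∀ σ M w, I t σ M w → e.val σ M ≠ 0 →
      ∃ σ' M' w', Runs B c σ M σ' M' w' d ∧ I (t + 1) σ' M' (w + w' + 401))
    {t w : ℕ} (ht : t ≤ T) (h : I t σ M w) :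
    ∃ t' ≤ T, ∃ σ' M' w', I t' σ' M' (w + w') ∧ e.val σ' M' = 0 ∧
      Runs B (.while e c) σ M σ' M' (w' + 401) ((T - t) * (d + 401) + 401) := by
  induction hk : T - t generalizing t σ M w with
  | zero =>
    obtain rfl : t = T := by omega
    refine ⟨t, le_rfl, σ, M, 0, h, h_exit _ _ _ h, ⟨_, .while_false c (Expr.fits hb hB (hI _ _ _ _ h) he) (h_exit _ _ _ h), ?_, ?_⟩⟩ <;>
    · have := e.size_le_deg
      simp only [Expr.usage]; omega
  | succ k ih =>
    by_cases hz : e.val σ M = 0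
    · refine ⟨t, ht, σ, M, 0, h, hz, ⟨_, .while_false c (Expr.fits hb hB (hI _ _ _ _ h) he) hz, ?_, ?_⟩⟩ <;>
      · have := e.size_le_deg
        simp only [Expr.usage]; omega
    · obtain ⟨σ₁, M₁, w₁, ⟨u, hu, hu1, hu2⟩, h1⟩ := step t (by omega) σ M w h hz
      obtain ⟨t', ht', σ', M', w₂, h2, h3, v, hv, hv1, hv2⟩ := ih (t := t + 1) (by omega) h1 (by omega)
      refine ⟨t', ht', σ', M', w₁ + 401 + w₂, by convert h2 using 1; ring, h3,
        _, .while_true (Expr.fits hb hB (hI _ _ _ _ h) he) hz hu hv, ?_, ?_⟩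
      · have := e.size_le_deg
        simp only [Expr.usage, Usage.seq]; omega
      · have := e.size_le_deg
        simp only [Expr.usage, Usage.seq]
        have : (k + 1) * (d + 401) = k * (d + 401) + (d + 401) := by ring
        omega

end Runs

/-- The registers of the thread `(j, i)` of a nested parallel block. -/
def thread (σ : Regs) (j i : ℕ) : Regs := Function.update (Function.update σ 0 j) 1 i

@[simp] theorem thread_zero (σ : Regs) (j i : ℕ) : thread σ j i 0 = j := by
  simp [thread, Function.update]

@[simp] theorem thread_one (σ : Regs) (j i : ℕ) : thread σ j i 1 = i := by
  simp [thread, Function.update]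

theorem thread_of_two_le (σ : Regs) (j i : ℕ) {x : ℕ} (hx : 2 ≤ x) : thread σ j i x = σ x := by
  have h0 : x ≠ 0 := by omega
  have h1 : x ≠ 1 := by omega
  simp [thread, Function.update, h0, h1]

/-- In parallel for `j` less than `len` and `i` less than `deg`: if `cond`, then store `val` in
cell `idx` of array `a`. Registers `0` and `1` hold `j` and `i`. -/
def pfor (len deg cond : Expr) (a : ℕ) (idx val : Expr) : Cmd :=
  .par 0 len (.par 1 deg (.ite cond (.store a idx val) .skip))

/-- The number of threads of a nested parallel block, up to a constant factor. -/
def extent (ln : ℕ) (dg : ℕ → ℕ) : ℕ := 1 + ln + ∑ j ∈ Finset.range ln, dg j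

/-- The read and write sets are kept here because the race conditions of a parallel block need them.
`Runs` forgets them, which is harmless since every parallel block of the programs is a `pfor`. -/
theorem guarded_store {b B : ℕ} (hb : 2 ≤ b) (hB : b ^ 400 ≤ B) {σ : Regs} {M M' : Mem}
    (h : Below b σ M) {cond idx val : Expr} {a : ℕ} (hcond : cond.deg ≤ 400)
    (hidx : idx.deg ≤ 400) (hval : val.deg ≤ 400)
    (hM : M' = if cond.val σ M ≠ 0 then Function.update M (a, idx.val σ M) (val.val σ M) else M) :
    ∃ u, Exec B (.ite cond (.store a idx val) .skip) σ M σ M' u ∧ u.work ≤ 1204 ∧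
      u.depth ≤ 1204 ∧ u.reads ⊆ cond.reads σ M ∪ idx.reads σ M ∪ val.reads σ M ∧
      u.writes = {p | cond.val σ M ≠ 0 ∧ p = (a, idx.val σ M)} := by
  have h1 := cond.size_le_deg
  have h2 := idx.size_le_deg
  have h3 := val.size_le_deg
  by_cases hc : cond.val σ M = 0
  · simp only [hc, ne_eq, not_true_eq_false, if_false] at hM
    subst hM
    refine ⟨_, .ite_false _ (Expr.fits hb hB h hcond) hc (.skip σ M'), ?_, ?_, ?_, ?_⟩
    · simp only [Expr.usage, Usage.seq]; omega
    · simp only [Expr.usage, Usage.seq]; omega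
    · intro p hp
      simp only [Expr.usage, Usage.seq, Set.union_empty] at hp
      exact .inl (.inl hp)
    · simp [Expr.usage, Usage.seq, hc]
  · simp only [hc, ne_eq, not_false_eq_true, if_true] at hM
    subst hM
    refine ⟨_, .ite_true _ (Expr.fits hb hB h hcond) hc
      (.store a idx val σ M (Expr.fits hb hB h hidx) (Expr.fits hb hB h hval)), ?_, ?_, ?_, ?_⟩
    · simp only [Expr.usage, Usage.seq]; omega
    · simp only [Expr.usage, Usage.seq]; omega
    · intro p hp
      simp only [Expr.usage, Usage.seq, Set.union_empty] at hp
      rcases hp with hp | hp | hp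
      · exact .inl (.inl hp)
      · exact .inl (.inr hp)
      · exact .inr hp
    · ext p
      simp [Expr.usage, Usage.seq, hc]

/-- Race freedom is mostly syntactic: the array that is written does not occur in the count, the
condition or the index. Only the stored value may read that array, and `rval` keeps those reads away
from the written cells. Concurrent writes to one cell agree by `cons`. -/
theorem pfor_runs {b B : ℕ} (hb : 2 ≤ b) (hB : b ^ 400 ≤ B) {σ : Regs} {M : Mem}
    (h : Below b σ M) {len deg cond idx val : Expr} {a : ℕ}
    (dlen : len.deg ≤ 400) (ddeg : deg.deg ≤ 400) (dcond : cond.deg ≤ 400)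
    (didx : idx.deg ≤ 400) (dval : val.deg ≤ 400)
    {ln : ℕ} {dg : ℕ → ℕ} {cv : ℕ → ℕ → Prop} {iv vv : ℕ → ℕ → ℕ}
    (hlen : len.val σ M = ln) (lnb : ln ≤ b)
    (hdeg : ∀ j < ln, deg.val (Function.update σ 0 j) M = dg j) (dgb : ∀ j < ln, dg j ≤ b)
    (hcond : ∀ j < ln, ∀ i < dg j, cond.val (thread σ j i) M ≠ 0 ↔ cv j i)
    (hidx : ∀ j < ln, ∀ i < dg j, cv j i → idx.val (thread σ j i) M = iv j i)
    (hval : ∀ j < ln, ∀ i < dg j, cv j i → val.val (thread σ j i) M = vv j i)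
    (cons : ∀ j < ln, ∀ i < dg j, ∀ j' < ln, ∀ i' < dg j', cv j i → cv j' i' →
      iv j i = iv j' i' → vv j i = vv j' i')
    (rdeg : a ∉ deg.arrays) (rcond : a ∉ cond.arrays) (ridx : a ∉ idx.arrays)
    (rval : ∀ j < ln, ∀ i < dg j, ∀ j' < ln, ∀ i' < dg j', cv j i →
      (a, iv j i) ∉ val.reads (thread σ j' i') M) :
    ∃ M', Runs B (pfor len deg cond a idx val) σ M σ M' (2006 * extent ln dg) 2006 ∧
      (∀ j < ln, ∀ i < dg j, cv j i → M' (a, iv j i) = vv j i) ∧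
      (∀ p, (∀ j < ln, ∀ i < dg j, cv j i → p ≠ (a, iv j i)) → M' p = M p) := by
  classical
  let W : ℕ → Set Loc := fun j => {p | ∃ i < dg j, cv j i ∧ p = (a, iv j i)}
  -- A written cell receives the value of an arbitrary thread that writes it; `cons` makes the
  -- choice irrelevant.
  let M' : Mem := fun p =>
    if hp : ∃ q : ℕ × ℕ, q.1 < ln ∧ q.2 < dg q.1 ∧ cv q.1 q.2 ∧ p = (a, iv q.1 q.2) then
      vv hp.choose.1 hp.choose.2 else M p
  have hM1 : ∀ j < ln, ∀ i < dg j, cv j i → M' (a, iv j i) = vv j i := by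
    intro j hj i hi hc
    have hp : ∃ q : ℕ × ℕ, q.1 < ln ∧ q.2 < dg q.1 ∧ cv q.1 q.2 ∧
        ((a, iv j i) : Loc) = (a, iv q.1 q.2) := ⟨(j, i), hj, hi, hc, rfl⟩
    simp only [M', dif_pos hp]
    obtain ⟨h1, h2, h3, h4⟩ := hp.choose_spec
    exact cons _ h1 _ h2 _ hj _ hi h3 hc (by simpa using h4.symm)
  have hM2 : ∀ p, (∀ j < ln, ∀ i < dg j, cv j i → p ≠ (a, iv j i)) → M' p = M p := by
    intro p hp
    have : ¬ ∃ q : ℕ × ℕ, q.1 < ln ∧ q.2 < dg q.1 ∧ cv q.1 q.2 ∧ p = (a, iv q.1 q.2) := by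
      rintro ⟨q, h1, h2, h3, h4⟩
      exact hp _ h1 _ h2 h3 h4
    simp only [M', dif_neg this]
  -- The inner block of `j` leaves the final memory on its own cells `W j` and the old memory
  -- elsewhere, which is what the outer rule asks of each of its threads.
  have key : ∀ j < ln, ∃ u, Exec B (.par 1 deg (.ite cond (.store a idx val) .skip))
      (Function.update σ 0 j) M (Function.update σ 0 j) (fun p => if p ∈ W j then M' p else M p) u ∧
      u.work ≤ 401 + 1204 * dg j ∧ u.depth ≤ 1605 ∧ u.writes = W j ∧
      u.reads ⊆ {p | (p.1 ≠ a ∨ ∃ i < dg j, p ∈ val.reads (thread σ j i) M)} := by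
    intro j hj
    have hj1 : Below b (Function.update σ 0 j) M := h.update (by omega)
    have hth : ∀ i < dg j, ∃ u, Exec B (.ite cond (.store a idx val) .skip) (thread σ j i) M
        (thread σ j i) (if cond.val (thread σ j i) M ≠ 0 then
          Function.update M (a, idx.val (thread σ j i) M) (val.val (thread σ j i) M) else M) u ∧
        u.work ≤ 1204 ∧ u.depth ≤ 1204 ∧
        u.reads ⊆ cond.reads (thread σ j i) M ∪ idx.reads (thread σ j i) M ∪
          val.reads (thread σ j i) M ∧
        u.writes = {p | cv j i ∧ p = (a, iv j i)} := by
      intro i hi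
      have hi1 : Below b (thread σ j i) M := hj1.update (by have := dgb j hj; omega)
      obtain ⟨u, h1, h2, h3, h4, h5⟩ := guarded_store (a := a) hb hB hi1 dcond didx dval rfl
      refine ⟨u, h1, h2, h3, h4, ?_⟩
      rw [h5]; ext p
      simp only [Set.mem_ofPred_eq, hcond j hj i hi]
      constructor
      · rintro ⟨hc, rfl⟩; exact ⟨hc, by rw [hidx j hj i hi hc]⟩
      · rintro ⟨hc, rfl⟩; exact ⟨hc, by rw [hidx j hj i hi hc]⟩
    choose! u hu1 hu2 hu3 hu4 hu5 using hth
    have hreads : ∀ i < dg j, (u i).reads ⊆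
        {p | (p.1 ≠ a ∨ ∃ i < dg j, p ∈ val.reads (thread σ j i) M)} := by
      intro i hi p hp
      rcases hu4 i hi hp with (hp | hp) | hp
      · exact .inl fun hh => rcond (hh ▸ Expr.mem_arrays_of_mem_reads hp)
      · exact .inl fun hh => ridx (hh ▸ Expr.mem_arrays_of_mem_reads hp)
      · exact .inr ⟨i, hi, hp⟩
    refine ⟨_, .par (fun i => thread σ j i) (fun i => if cond.val (thread σ j i) M ≠ 0 then
          Function.update M (a, idx.val (thread σ j i) M) (val.val (thread σ j i) M) else M) u
          (Expr.fits hb hB hj1 ddeg) ?_ ?_ ?_ ?_, ?_, ?_, ?_, ?_⟩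
    · rw [hdeg j hj]; exact hu1
    · rw [hdeg j hj]
      intro i hi i' hi' _
      rw [Set.disjoint_left]
      intro p hp hp'
      rw [hu5 i' hi'] at hp'
      obtain ⟨hc, rfl⟩ := hp'
      rcases hreads i hi hp with hp | ⟨i'', hi'', hp⟩
      · exact hp rfl
      · exact rval j hj i' hi' j hj i'' hi'' hc hp
    · rw [hdeg j hj]
      intro i hi p hp
      rw [hu5 i hi] at hp
      obtain ⟨hc, rfl⟩ := hp
      have hW : ((a, iv j i) : Loc) ∈ W j := ⟨i, hi, hc, rfl⟩
      simp only [hW, if_true, hM1 j hj i hi hc, (hcond j hj i hi).2 hc, ne_eq, not_false_eq_true,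
        hidx j hj i hi hc, hval j hj i hi hc, Function.update_self]
    · rw [hdeg j hj]
      intro p hp
      have : p ∉ W j := by
        rintro ⟨i, hi, hc, rfl⟩
        exact hp i hi (by rw [hu5 i hi]; exact ⟨hc, rfl⟩)
      simp only [this, if_false]
    · rw [hdeg j hj]
      have h1 := deg.size_le_deg
      have h2 : ∑ i ∈ Finset.range (dg j), (u i).work ≤ dg j * 1204 := by
        refine (Finset.sum_le_card_nsmul _ _ 1204 fun i hi => hu2 i (Finset.mem_range.1 hi)).trans ?_
        simp
      simp only [Expr.usage, Usage.seq, Usage.par]; omega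
    · rw [hdeg j hj]
      have h1 := deg.size_le_deg
      have h2 : (Finset.range (dg j)).sup (fun i => (u i).depth) ≤ 1204 :=
        Finset.sup_le fun i hi => hu3 i (Finset.mem_range.1 hi)
      simp only [Expr.usage, Usage.seq, Usage.par]; omega
    · rw [hdeg j hj]
      simp only [Expr.usage, Usage.seq, Usage.par, Set.empty_union]
      ext p
      simp only [Set.mem_iUnion, exists_prop, W, Set.mem_ofPred_eq]
      constructor
      · rintro ⟨i, hi, hp⟩
        rw [hu5 i hi] at hp
        exact ⟨i, hi, hp⟩
      · rintro ⟨i, hi, hp⟩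
        exact ⟨i, hi, by rw [hu5 i hi]; exact hp⟩
    · rw [hdeg j hj]
      simp only [Expr.usage, Usage.seq, Usage.par, Set.union_subset_iff, Set.iUnion_subset_iff]
      refine ⟨fun p hp => ?_, hreads⟩
      exact .inl fun hh => rdeg (hh ▸ Expr.mem_arrays_of_mem_reads hp)
  choose! u hu1 hu2 hu3 hu4 hu5 using key
  refine ⟨M', ⟨_, .par (fun j => Function.update σ 0 j) (fun j p => if p ∈ W j then M' p else M p) u
    (Expr.fits hb hB h dlen) ?_ ?_ ?_ ?_, ?_, ?_⟩, hM1, hM2⟩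
  · rw [hlen]; exact hu1
  · rw [hlen]
    intro j hj j' hj' _
    rw [Set.disjoint_left]
    intro p hp hp'
    rw [hu4 j' hj'] at hp'
    obtain ⟨i', hi', hc, rfl⟩ := hp'
    rcases hu5 j hj hp with hp | ⟨i'', hi'', hp⟩
    · exact hp rfl
    · exact rval j' hj' i' hi' j hj i'' hi'' hc hp
  · rw [hlen]
    intro j hj p hp
    rw [hu4 j hj] at hp
    simp only [hp, if_true]
  · rw [hlen]
    intro p hp
    refine hM2 p fun j hj i hi hc hp' => hp j hj ?_
    rw [hu4 j hj]
    exact ⟨i, hi, hc, hp'⟩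
  · rw [hlen]
    have h1 := len.size_le_deg
    have h2 : ∑ j ∈ Finset.range ln, (u j).work ≤ ∑ j ∈ Finset.range ln, (401 + 1204 * dg j) :=
      Finset.sum_le_sum fun j hj => hu2 j (Finset.mem_range.1 hj)
    rw [Finset.sum_add_distrib, ← Finset.mul_sum] at h2
    simp only [Finset.sum_const, Finset.card_range, smul_eq_mul] at h2
    simp only [Expr.usage, Usage.seq, Usage.par, extent]
    omega
  · rw [hlen]
    have h1 := len.size_le_deg
    have h2 : (Finset.range ln).sup (fun j => (u j).depth) ≤ 1605 :=
      Finset.sup_le fun j hj => hu3 j (Finset.mem_range.1 hj)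
    simp only [Expr.usage, Usage.seq, Usage.par]; omega

end WorkDepth

/-! ### Balanced trees in the shared memory

Tree `r` of an array has its leaves in the cells `addr K r x 0`; the node `y` at height `t + 1`
has the children `2 * y` and `2 * y + 1` at height `t`. Here `K = 2 ^ k` is in register `4`, `k` is
in register `5`; registers `8` and `9` hold the height `t` and `2 ^ t` in a loop over the heights. -/

namespace WorkDepth

/-- The cell of node `y` at height `t` of tree `r`. -/
def addr (K r y t : ℕ) : ℕ := (r * K + y) * K + t

/-- The expression for `addr`. -/
def addrE (r y t : Expr) : Expr := (r * .reg 4 + y) * .reg 4 + t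

/-- The address is a number in base `K` with last digits `y` and `t`; the row is the unbounded
leading part. -/
theorem addr_inj {K r y t r' y' t' : ℕ} (hy : y < K) (ht : t < K) (hy' : y' < K) (ht' : t' < K)
    (h : addr K r y t = addr K r' y' t') : r = r' ∧ y = y' ∧ t = t' := by
  have key : ∀ {a a' c c' : ℕ}, c < K → c' < K → a * K + c = a' * K + c' → a = a' ∧ c = c' := by
    intro a a' c c' hc hc' h
    have h1 : (a * K + c) / K = a := by
      rw [mul_comm, Nat.mul_add_div (by omega), Nat.div_eq_of_lt hc, add_zero]
    have h2 : (a' * K + c') / K = a' := by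
      rw [mul_comm, Nat.mul_add_div (by omega), Nat.div_eq_of_lt hc', add_zero]
    have : a = a' := by rw [← h1, ← h2, h]
    subst this
    exact ⟨rfl, by omega⟩
  obtain ⟨h1, h2⟩ := key ht ht' h
  obtain ⟨h3, h4⟩ := key hy hy' h1
  exact ⟨h3, h4, h2⟩

theorem addr_div {K r y t : ℕ} (hy : y < K) (ht : t < K) : addr K r y t / (K * K) = r := by
  unfold addr
  rw [← Nat.div_div_eq_div_mul, mul_comm _ K, Nat.mul_add_div (by omega), Nat.div_eq_of_lt ht,
    add_zero, mul_comm, Nat.mul_add_div (by omega), Nat.div_eq_of_lt hy, add_zero]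

@[simp] theorem addrE_val (r y t : Expr) (σ : Regs) (M : Mem) :
    (addrE r y t).val σ M = addr (σ 4) (r.val σ M) (y.val σ M) (t.val σ M) := rfl

@[simp] theorem addrE_deg (r y t : Expr) :
    (addrE r y t).deg = r.deg + y.deg + t.deg + 6 := by
  simp [addrE]; ring

@[simp] theorem addrE_arrays (r y t : Expr) :
    (addrE r y t).arrays = r.arrays ++ y.arrays ++ t.arrays := by
  simp [addrE]

/-- `k` is the height of the trees, `b` bounds the contents of the memory, `B` the words. -/
structure Machine (b B k : ℕ) : Prop where
  two_le : 2 ≤ b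
  pow_le : b ^ 400 ≤ B
  two_le_k : 2 ≤ k
  sq_le : 2 ^ k * 2 ^ k ≤ b

namespace Machine
variable {b B k : ℕ}

theorem lt (_ : Machine b B k) : k < 2 ^ k := Nat.lt_two_pow_self

theorem K_lt (h : Machine b B k) : 2 ^ k < b := by
  have h1 := h.sq_le
  have h2 : 2 ≤ 2 ^ k := Nat.le_self_pow (by have := h.two_le_k; omega) 2
  nlinarith

end Machine

/-- The registers in round `t` of a loop over the heights. -/
def atHeight (σ : Regs) (t : ℕ) : Regs := Function.update (Function.update σ 8 t) 9 (2 ^ t)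

@[simp] theorem atHeight_eight (σ : Regs) (t : ℕ) : atHeight σ t 8 = t := by
  simp [atHeight, Function.update]

@[simp] theorem atHeight_nine (σ : Regs) (t : ℕ) : atHeight σ t 9 = 2 ^ t := by
  simp [atHeight, Function.update]

theorem atHeight_of_ne (σ : Regs) (t : ℕ) {x : ℕ} (h8 : x ≠ 8) (h9 : x ≠ 9) :
    atHeight σ t x = σ x := by
  simp [atHeight, Function.update, h8, h9]

theorem Below.atHeight {b B k t : ℕ} (hm : Machine b B k) {σ : Regs} {M : Mem} (h : Below b σ M)
    (ht : t ≤ k) : Below b (atHeight σ t) M := by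
  have := hm.lt
  have := hm.K_lt
  have : 2 ^ t ≤ 2 ^ k := Nat.pow_le_pow_right (by omega) ht
  exact (h.update (by omega)).update (by omega)

/-- A loop over the heights `0, …, k - 1`. -/
def forHeights (c : Cmd) : Cmd :=
  .seq (.assign 8 0) (.seq (.assign 9 1) (.while (.op .lt (.reg 8) (.reg 5))
    (.seq c (.seq (.assign 8 (.reg 8 + 1)) (.assign 9 (.reg 9 * 2))))))

theorem forHeights_runs {b B k : ℕ} (hm : Machine b B k) {c : Cmd} {σ : Regs} {M : Mem}
    (h : Below b σ M) (hk : σ 5 = k) {w d : ℕ} (I : ℕ → Mem → Prop) (h0 : I 0 M)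
    (step : ∀ t < k, ∀ M', I t M' → Below b (atHeight σ t) M' →
      ∃ M'', Runs B c (atHeight σ t) M' (atHeight σ t) M'' w d ∧ I (t + 1) M'' ∧ ∀ p, M'' p < b) :
    ∃ M', Runs B (forHeights c) σ M (atHeight σ k) M' ((k + 1) * (w + 1700)) ((k + 1) * (d + 1700)) ∧
      I k M' ∧ ∀ p, M' p < b := by
  have hb := hm.two_le
  have hB := hm.pow_le
  have r1 : Runs B (.assign 8 0) σ M (Function.update σ 8 0) M 401 401 :=
    Runs.assign hb hB h 8 (by simp) (by simp)
  have h' : Below b (Function.update σ 8 0) M := h.update (by omega)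
  have r2 : Runs B (.assign 9 1) (Function.update σ 8 0) M (atHeight σ 0) M 401 401 :=
    Runs.assign hb hB h' 9 (by simp) (by simp)
  have h'' : Below b (atHeight σ 0) M := h'.update (by omega)
  obtain ⟨t', ht', σ', M', w', ⟨-, rfl, hI, hM', hw'⟩, hz, hr⟩ :=
    Runs.while_rule (w := 0) (t := 0) (T := k) (d := d + 802)
      (c := .seq c (.seq (.assign 8 (.reg 8 + 1)) (.assign 9 (.reg 9 * 2))))
      hb hB (e := .op .lt (.reg 8) (.reg 5)) (by simp)
      (fun t σ' M' w' => t ≤ k ∧ σ' = atHeight σ t ∧ I t M' ∧ Below b σ' M' ∧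
        w' ≤ t * (w + 802 + 401))
      (fun t σ' M' w' hh => hh.2.2.2.1)
      (by rintro σ' M' w' ⟨-, rfl, -⟩; simp [atHeight_of_ne, hk])
      (by
        rintro t ht σ' M' w' ⟨-, rfl, hI, hbl, hw'⟩ -
        obtain ⟨M'', hr, hI', hM''⟩ := step t ht M' hI hbl
        have b1 : Below b (atHeight σ t) M'' := ⟨hbl.regs, hM''⟩
        have b2 := h''.update (x := 8) (v := 0) (by omega)
        have e1 : Runs B (.assign 8 (.reg 8 + 1)) (atHeight σ t) M''
          (Function.update (atHeight σ t) 8 (t + 1)) M'' 401 401 :=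
          Runs.assign hb hB b1 8 (by simp) (by simp)
        have b3 : Below b (Function.update (atHeight σ t) 8 (t + 1)) M'' :=
          b1.update (by have := hm.lt; have := hm.K_lt; omega)
        have e2 : Runs B (.assign 9 (.reg 9 * 2)) (Function.update (atHeight σ t) 8 (t + 1)) M''
          (Function.update (Function.update (atHeight σ t) 8 (t + 1)) 9 (2 ^ (t + 1))) M'' 401 401 :=
          Runs.assign hb hB b3 9 (by simp) (by simp [pow_succ])
        have e3 : Function.update (Function.update (atHeight σ t) 8 (t + 1)) 9 (2 ^ (t + 1)) =
            atHeight σ (t + 1) := by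
          funext x
          simp only [atHeight, Function.update]
          split_ifs <;> simp_all
        rw [e3] at e2
        refine ⟨atHeight σ (t + 1), M'', w + 802, (hr.seq (e1.seq e2)).mono (by omega) (by omega),
          by omega, rfl, hI', ?_, ?_⟩
        · exact ⟨(h.atHeight hm (by omega : t + 1 ≤ k)).regs, hM''⟩
        · rw [add_mul]; omega)
      (by omega) ⟨by omega, rfl, h0, h'', by omega⟩
  have ht : t' = k := by
    simp only [Expr.val_lt, Expr.val_reg, atHeight_eight] at hz
    rw [atHeight_of_ne _ _ (by omega) (by omega), hk] at hz
    by_contra hne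
    rw [if_pos (by omega)] at hz
    omega
  subst ht
  refine ⟨M', (r1.seq (r2.seq hr)).mono ?_ ?_, hI, hM'.mem⟩
  · have : (t' + 1) * (w + 1700) = t' * (w + 802 + 401) + t' * 497 + w + 1700 := by ring
    omega
  · have : (t' + 1) * (d + 1700) = (t' - 0) * (d + 802 + 401) + t' * 497 + d + 1700 := by
      rw [Nat.sub_zero]; ring
    omega

/-- A nested parallel block of threads, each with a row and an element computed from its number. -/
structure Frame where
  len : Expr
  deg : Expr
  row : Expr
  elt : Expr

/-- The values of a `Frame`. -/
structure Items where
  ln : ℕ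
  dg : ℕ → ℕ
  row : ℕ → ℕ → ℕ
  elt : ℕ → ℕ → ℕ

/-- Some thread has row `r` and element `x`. -/
def Items.Has (A : Items) (r x : ℕ) : Prop :=
  ∃ j < A.ln, ∃ i < A.dg j, A.row j i = r ∧ A.elt j i = x

namespace Frame

/-- The arrays that the frame reads. -/
def arrays (F : Frame) : List ℕ := F.len.arrays ++ F.deg.arrays ++ F.row.arrays ++ F.elt.arrays

/-- The registers that the frame mentions. -/
def regs (F : Frame) : List ℕ := F.len.regs ++ F.deg.regs ++ F.row.regs ++ F.elt.regs

/-- The expressions are short and independent of the registers of the loop over the heights. -/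
def Small (F : Frame) : Prop :=
  F.len.deg ≤ 40 ∧ F.deg.deg ≤ 40 ∧ F.row.deg ≤ 40 ∧ F.elt.deg ≤ 40 ∧ 8 ∉ F.regs ∧ 9 ∉ F.regs

instance (F : Frame) : Decidable F.Small := by unfold Small; infer_instance

/-- In the given state the frame has the values `A`. -/
structure Den (b : ℕ) (F : Frame) (σ : Regs) (M : Mem) (A : Items) : Prop where
  len : F.len.val σ M = A.ln
  len_le : A.ln ≤ b
  deg : ∀ j < A.ln, F.deg.val (Function.update σ 0 j) M = A.dg j
  deg_le : ∀ j < A.ln, A.dg j ≤ b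
  row : ∀ j < A.ln, ∀ i < A.dg j, F.row.val (thread σ j i) M = A.row j i
  elt : ∀ j < A.ln, ∀ i < A.dg j, F.elt.val (thread σ j i) M = A.elt j i

/-- This transports the values of a frame through the loops over the heights, which change only the
registers `8` and `9` and arrays that the frame does not read. -/
theorem Den.congr {b : ℕ} {F : Frame} {σ σ' : Regs} {M M' : Mem} {A : Items}
    (h : F.Den b σ M A) (hσ : ∀ x ∈ F.regs, σ' x = σ x)
    (hM : ∀ a ∈ F.arrays, ∀ i, M' (a, i) = M (a, i)) : F.Den b σ' M' A := by
  have ht : ∀ e : Expr, e.regs ⊆ F.regs → ∀ j i, ∀ x ∈ e.regs,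
      thread σ' j i x = thread σ j i x := by
    intro e he j i x hx
    simp only [thread, Function.update, hσ x (he hx)]
  have hu : ∀ j, ∀ x ∈ F.deg.regs, Function.update σ' 0 j x = Function.update σ 0 j x := by
    intro j x hx
    simp only [Function.update, hσ x (by simp [regs, hx])]
  constructor
  · rw [← h.len]
    exact Expr.val_congr (fun x hx => hσ x (by simp [regs, hx]))
      fun a ha => hM a (by simp [arrays, ha])
  · exact h.len_le
  · intro j hj
    rw [← h.deg j hj]
    exact Expr.val_congr (hu j) fun a ha => hM a (by simp [arrays, ha])
  · exact h.deg_le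
  · intro j hj i hi
    rw [← h.row j hj i hi]
    exact Expr.val_congr (ht _ (fun x hx => by simp [regs, hx]) j i)
      fun a ha => hM a (by simp [arrays, ha])
  · intro j hj i hi
    rw [← h.elt j hj i hi]
    exact Expr.val_congr (ht _ (fun x hx => by simp [regs, hx]) j i)
      fun a ha => hM a (by simp [arrays, ha])

theorem Den.atHeight {b : ℕ} {F : Frame} {σ : Regs} {M M' : Mem} {A : Items}
    (h : F.Den b σ M A) (hF : F.Small) (t : ℕ)
    (hM : ∀ a ∈ F.arrays, ∀ i, M' (a, i) = M (a, i)) : F.Den b (atHeight σ t) M' A :=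
  h.congr (fun _ hx => atHeight_of_ne _ _ (fun h => hF.2.2.2.2.1 (h ▸ hx))
    fun h => hF.2.2.2.2.2 (h ▸ hx)) hM

end Frame

/-- The value of a node with children `x` and `y`: their sum if `f` is positive, the first of them
that is not `0` otherwise. -/
def comb (f K x y : ℕ) : ℕ := (x + (if 0 < (if x = 0 then 1 else 0) + f then 1 else 0) * y) % (K * K)

/-- The expression for `comb`. -/
def combE (f : ℕ) (x y : Expr) : Expr :=
  (x + .op .lt 0 (.op .eq x 0 + .const f) * y) % (.reg 4 * .reg 4)

@[simp] theorem combE_val (f : ℕ) (x y : Expr) (σ : Regs) (M : Mem) :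
    (combE f x y).val σ M = comb f (σ 4) (x.val σ M) (y.val σ M) := rfl

/-- The reduction modulo `K * K` in `comb` exists for this bound: it holds for arbitrary children,
so cells stay small without any knowledge of what the trees contain. -/
theorem comb_lt {f K x y : ℕ} (hK : 0 < K) : comb f K x y < K * K := Nat.mod_lt _ (by positivity)

/-- Recompute the ancestors of the leaves of the frame. -/
def treeUp (F : Frame) (a f : ℕ) : Cmd :=
  forHeights (pfor F.len F.deg 1 a (addrE F.row (F.elt / .reg 9 / 2) (.reg 8 + 1))
    (combE f (.read a (addrE F.row (2 * (F.elt / .reg 9 / 2)) (.reg 8)))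
      (.read a (addrE F.row (2 * (F.elt / .reg 9 / 2) + 1) (.reg 8)))))

/-- All nodes of the trees have the right value, except perhaps for the ancestors of the leaves
in `Q`. -/
def Consistent (k a f : ℕ) (M : Mem) (Q : ℕ → ℕ → Prop) : Prop :=
  ∀ r y t, t < k → 2 * y + 1 < 2 ^ k → (∀ x, Q r x → x / 2 ^ (t + 1) ≠ y) →
    M (a, addr (2 ^ k) r y (t + 1)) =
      comb f (2 ^ k) (M (a, addr (2 ^ k) r (2 * y) t)) (M (a, addr (2 ^ k) r (2 * y + 1) t))

theorem two_mul_div_add_one_lt {k x t : ℕ} (hk : 2 ≤ k) (hx : x < 2 ^ k) :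
    2 * (x / 2 ^ (t + 1)) + 1 < 2 ^ k := by
  obtain ⟨k, rfl⟩ : ∃ l, k = l + 1 := ⟨k - 1, by omega⟩
  have h1 : x / 2 ^ (t + 1) ≤ x / 2 := by
    rw [pow_succ', ← Nat.div_div_eq_div_mul]; exact Nat.div_le_self _ _
  have h2 : 2 ^ (k + 1) = 2 * 2 ^ k := by ring
  omega

theorem div_pow_div_two (x t : ℕ) : x / 2 ^ t / 2 = x / 2 ^ (t + 1) := by
  rw [Nat.div_div_eq_div_mul, pow_succ]

/-- Round `t` reads nodes of height `t` and writes nodes of height `t + 1`, so there is no race and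
finished heights are not disturbed; threads with a common ancestor write the same value. A node that
is above no leaf of the frame keeps its value, as do its children. Hence the leaves of the frame can
be dropped from the exceptions to consistency. -/
theorem treeUp_runs {b B k : ℕ} (hm : Machine b B k) {F : Frame} (hF : F.Small) {a f : ℕ}
    (hf : f ≤ 1) (ha : a ∉ F.arrays) {σ : Regs} {M : Mem} (h : Below b σ M) (hK : σ 4 = 2 ^ k)
    (hk : σ 5 = k) {A : Items} (hA : F.Den b σ M A) (hx : ∀ r x, A.Has r x → x < 2 ^ k) :
    ∃ M', Runs B (treeUp F a f) σ M (atHeight σ k) M' (4000 * ((k + 1) * extent A.ln A.dg))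
        (4000 * (k + 1)) ∧
      (∀ p, M' p < b) ∧ (∀ p, p.1 ≠ a → M' p = M p) ∧
      (∀ r, ∀ x < 2 ^ k, M' (a, addr (2 ^ k) r x 0) = M (a, addr (2 ^ k) r x 0)) ∧
      (∀ i, (∀ r x, A.Has r x → i / (2 ^ k * 2 ^ k) ≠ r) → M' (a, i) = M (a, i)) ∧
      (∀ Q : ℕ → ℕ → Prop, Consistent k a f M (fun r x => Q r x ∨ A.Has r x) →
        Consistent k a f M' Q) := by
  have hb := hm.two_le
  have hlt := hm.lt
  have har : ∀ a' ∈ F.arrays, a' ≠ a := fun a' h' e => ha (e ▸ h')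
  simp only [Frame.arrays, List.mem_append, not_or] at ha
  obtain ⟨d1, d2, d3, d4, -, -⟩ := id hF
  have lt_K : ∀ {r x}, A.Has r x → ∀ t, x / 2 ^ t < 2 ^ k := fun hh t =>
    (Nat.div_le_self _ _).trans_lt (hx _ _ hh)
  have lt_K' : ∀ {r x}, A.Has r x → ∀ t, 2 * (x / 2 ^ (t + 1)) + 1 < 2 ^ k := fun hh t =>
    two_mul_div_add_one_lt hm.two_le_k (hx _ _ hh)
  obtain ⟨M', hr, ⟨hM1, hM2, hM3⟩, hM4⟩ := forHeights_runs (w := 2006 * extent A.ln A.dg)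
    (d := 2006) (c := pfor F.len F.deg 1 a (addrE F.row (F.elt / .reg 9 / 2) (.reg 8 + 1))
    (combE f (.read a (addrE F.row (2 * (F.elt / .reg 9 / 2)) (.reg 8)))
      (.read a (addrE F.row (2 * (F.elt / .reg 9 / 2) + 1) (.reg 8))))) hm h hk
    (fun t M' => (∀ p, p.1 ≠ a → M' p = M p) ∧
      (∀ p, (∀ r x, A.Has r x → ∀ t' < t, p ≠ (a, addr (2 ^ k) r (x / 2 ^ (t' + 1)) (t' + 1))) →
        M' p = M p) ∧
      (∀ r x, A.Has r x → ∀ t' < t, M' (a, addr (2 ^ k) r (x / 2 ^ (t' + 1)) (t' + 1)) =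
        comb f (2 ^ k) (M' (a, addr (2 ^ k) r (2 * (x / 2 ^ (t' + 1))) t'))
          (M' (a, addr (2 ^ k) r (2 * (x / 2 ^ (t' + 1)) + 1) t'))))
    ⟨fun _ _ => rfl, fun _ _ => rfl, fun _ _ _ _ h => absurd h (by omega)⟩ (by
      rintro t ht M' ⟨i1, i2, i3⟩ hbl
      have hA' : F.Den b (atHeight σ t) M' A := hA.atHeight hF t fun a' h' i => i1 _ (har a' h')
      have s4 : ∀ j i, thread (atHeight σ t) j i 4 = 2 ^ k := fun j i => by
        rw [thread_of_two_le _ _ _ (by omega), atHeight_of_ne _ _ (by omega) (by omega), hK]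
      have s8 : ∀ j i, thread (atHeight σ t) j i 8 = t := fun j i => by
        rw [thread_of_two_le _ _ _ (by omega), atHeight_eight]
      have s9 : ∀ j i, thread (atHeight σ t) j i 9 = 2 ^ t := fun j i => by
        rw [thread_of_two_le _ _ _ (by omega), atHeight_nine]
      obtain ⟨M'', hr, w1, w2⟩ := pfor_runs (a := a) (σ := atHeight σ t) (M := M') hb hm.pow_le hbl
        (len := F.len) (deg := F.deg) (cond := 1)
        (idx := addrE F.row (F.elt / .reg 9 / 2) (.reg 8 + 1))
        (val := combE f (.read a (addrE F.row (2 * (F.elt / .reg 9 / 2)) (.reg 8)))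
          (.read a (addrE F.row (2 * (F.elt / .reg 9 / 2) + 1) (.reg 8))))
        (by omega) (by omega) (by simp) (by simp; omega) (by simp [combE]; omega)
        (ln := A.ln) (dg := A.dg) (cv := fun _ _ => True)
        (iv := fun j i => addr (2 ^ k) (A.row j i) (A.elt j i / 2 ^ (t + 1)) (t + 1))
        (vv := fun j i => comb f (2 ^ k)
          (M' (a, addr (2 ^ k) (A.row j i) (2 * (A.elt j i / 2 ^ (t + 1))) t))
          (M' (a, addr (2 ^ k) (A.row j i) (2 * (A.elt j i / 2 ^ (t + 1)) + 1) t)))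
        hA'.len hA'.len_le hA'.deg hA'.deg_le (by simp)
        (fun j hj i hi _ => by
          simp [hA'.row j hj i hi, hA'.elt j hj i hi, s4, s8, s9, div_pow_div_two])
        (fun j hj i hi _ => by
          simp [hA'.row j hj i hi, hA'.elt j hj i hi, s4, s8, s9, div_pow_div_two])
        (fun j hj i hi j' hj' i' hi' _ _ he => by
          have g : A.Has (A.row j i) (A.elt j i) := ⟨j, hj, i, hi, rfl, rfl⟩
          have g' : A.Has (A.row j' i') (A.elt j' i') := ⟨j', hj', i', hi', rfl, rfl⟩
          obtain ⟨e1, e2, -⟩ := addr_inj (lt_K g _) (by omega) (lt_K g' _) (by omega) he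
          simp only [e1, e2])
        ha.1.1.2 (by simp) (by simp [ha])
        (fun j hj i hi j' hj' i' hi' _ hmem => by
          have g : A.Has (A.row j i) (A.elt j i) := ⟨j, hj, i, hi, rfl, rfl⟩
          have g' : A.Has (A.row j' i') (A.elt j' i') := ⟨j', hj', i', hi', rfl, rfl⟩
          have n1 : ∀ e : Expr, a ∉ e.arrays → ∀ i σ M, ((a, i) : Loc) ∉ e.reads σ M :=
            fun e he i σ M hh => he (Expr.mem_arrays_of_mem_reads hh)
          have n2 := n1 F.row ha.1.2
          have n3 := n1 F.elt ha.2
          simp only [combE, addrE, Expr.reads_mod, Expr.reads_add, Expr.reads_read, Expr.reads_mul,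
            Expr.reads_div, Expr.reads_reg, Expr.reads_ofNat, Expr.reads_op, Expr.reads_const,
            Set.union_empty, Set.empty_union, Set.mem_union, Set.mem_insert_iff, n2, n3, or_false,
            Prod.mk.injEq, true_and, Expr.val_add, Expr.val_mul, Expr.val_reg, Expr.val_div,
            Expr.val_ofNat, s4, s8, s9, hA'.row j' hj' i' hi', hA'.elt j' hj' i' hi',
            div_pow_div_two] at hmem
          have hne : ∀ y < 2 ^ k, ∀ r, addr (2 ^ k) (A.row j i) (A.elt j i / 2 ^ (t + 1)) (t + 1) ≠
              addr (2 ^ k) r y t := fun y hy r he => by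
            have := (addr_inj (lt_K g _) (by omega) hy (by omega) he).2.2
            omega
          have q := lt_K' g' t
          rcases hmem with hmem | hmem | hmem
          · exact hne _ (by omega) _ hmem
          · exact hne _ (by omega) _ hmem
          · exact hne _ (by omega) _ hmem)
      -- The round changes no node of height at most `t`, so the equations of earlier rounds
      -- survive.
      have hun : ∀ y < 2 ^ k, ∀ t' ≤ t, ∀ r, M'' (a, addr (2 ^ k) r y t') = M' (a, addr (2 ^ k) r y t') := by
        intro y hy t' ht' r
        refine w2 _ fun j hj i hi _ he => ?_
        have g : A.Has (A.row j i) (A.elt j i) := ⟨j, hj, i, hi, rfl, rfl⟩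
        have := (addr_inj hy (by omega) (lt_K g _) (by omega) (Prod.mk.inj he).2).2.2
        omega
      refine ⟨M'', hr, ⟨fun p hp => ?_, fun p hp => ?_, ?_⟩, fun p => ?_⟩
      · rw [w2 p fun j hj i hi _ he => hp (by rw [he]), i1 p hp]
      · rw [w2 p fun j hj i hi _ he => hp _ _ ⟨j, hj, i, hi, rfl, rfl⟩ t (by omega) he, i2 p]
        exact fun r x hh t' ht' => hp r x hh t' (by omega)
      · intro r x hh t' ht'
        have q := lt_K' hh t'
        rw [hun _ (by omega) t' (by omega), hun _ (by omega) t' (by omega)]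
        rcases Nat.lt_succ_iff_lt_or_eq.1 ht' with ht' | rfl
        · rw [hun _ (lt_K hh _) _ (by omega), i3 r x hh t' ht']
        · obtain ⟨j, hj, i, hi, rfl, rfl⟩ := hh
          exact w1 j hj i hi trivial
      · by_cases hp : ∃ j < A.ln, ∃ i < A.dg j,
          p = (a, addr (2 ^ k) (A.row j i) (A.elt j i / 2 ^ (t + 1)) (t + 1))
        · obtain ⟨j, hj, i, hi, rfl⟩ := hp
          rw [w1 j hj i hi trivial]
          exact (comb_lt (by positivity)).trans_le hm.sq_le
        · push Not at hp
          rw [w2 p fun j hj i hi _ => hp j hj i hi]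
          exact hbl.mem p)
  refine ⟨M', hr.mono ?_ ?_, hM4, hM1, ?_, ?_, ?_⟩
  · have : 1 ≤ extent A.ln A.dg := by unfold extent; omega
    calc (k + 1) * (2006 * extent A.ln A.dg + 1700) ≤ (k + 1) * (4000 * extent A.ln A.dg) :=
          Nat.mul_le_mul_left _ (by omega)
      _ = _ := by ring
  · omega
  · intro r x hxk
    refine hM2 _ fun r' x' hh t' ht' he => ?_
    have := (addr_inj hxk (by omega) (lt_K hh _) (by omega) (Prod.mk.inj he).2).2.2
    omega
  · intro i hi
    refine hM2 _ fun r' x' hh t' ht' he => hi r' x' hh ?_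
    rw [(Prod.mk.inj he).2, addr_div (lt_K hh _) (by omega)]
  · intro Q hQ r y t ht hy hyQ
    by_cases hyA : ∃ x, A.Has r x ∧ x / 2 ^ (t + 1) = y
    · obtain ⟨x, hh, rfl⟩ := hyA
      exact hM3 r x hh t ht
    · push Not at hyA
      have key : ∀ y' t', y' < 2 ^ k → t' ≤ k → (∀ x, A.Has r x → x / 2 ^ t' ≠ y') →
          M' (a, addr (2 ^ k) r y' t') = M (a, addr (2 ^ k) r y' t') := by
        intro y' t' hy' ht' hn
        refine hM2 _ fun r' x hh t'' ht'' he => ?_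
        obtain ⟨rfl, rfl, rfl⟩ := addr_inj hy' (by omega) (lt_K hh _) (by omega) (Prod.mk.inj he).2
        exact hn x hh rfl
      rw [key y (t + 1) (by omega) (by omega) hyA, key (2 * y) t (by omega) (by omega),
        key (2 * y + 1) t (by omega) (by omega)]
      · refine hQ r y t ht hy fun x hx' => ?_
        rcases hx' with hx' | hx'
        · exact hyQ x hx'
        · exact hyA x hx'
      · intro x hh he
        refine hyA x hh ?_
        rw [← div_pow_div_two, he]; omega
      · intro x hh he
        refine hyA x hh ?_
        rw [← div_pow_div_two, he]; omega

end WorkDepth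

/-! ### Sums and witnesses in trees, ranks, compaction -/

namespace WorkDepth

/-- With leaves `0` or `1` every sum is at most `2 ^ k`, which is less than `2 ^ k * 2 ^ k`, so the
reduction in `comb` has no effect. -/
theorem node_eq_sum {k : ℕ} {T : ℕ → ℕ → ℕ}
    (h : ∀ t < k, ∀ y, 2 * y + 1 < 2 ^ k →
      T y (t + 1) = comb 1 (2 ^ k) (T (2 * y) t) (T (2 * y + 1) t))
    (hl : ∀ x < 2 ^ k, T x 0 ≤ 1) {t : ℕ} (ht : t ≤ k) {y : ℕ} (hy : y < 2 ^ (k - t)) :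
    T y t = ∑ x ∈ Finset.Ico (y * 2 ^ t) ((y + 1) * 2 ^ t), T x 0 := by
  induction t generalizing y with
  | zero => simp
  | succ t ih =>
    have e : 2 ^ (k - t) = 2 * 2 ^ (k - (t + 1)) := by
      rw [← pow_succ']; congr 1; omega
    have e' : 2 ^ k = 2 ^ (k - t) * 2 ^ t := by rw [← pow_add]; congr 1; omega
    have h1 : 1 ≤ 2 ^ t := Nat.one_le_two_pow
    have h2 : 2 ^ (k - t) ≤ 2 ^ k := Nat.pow_le_pow_right (by omega) (by omega)
    have hs : ∑ x ∈ Finset.Ico (y * 2 ^ (t + 1)) ((y + 1) * 2 ^ (t + 1)), T x 0 ≤ 2 ^ k := by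
      have hle : (y + 1) * 2 ^ (t + 1) ≤ 2 ^ k := by
        have : 2 ^ k = 2 ^ (k - (t + 1)) * 2 ^ (t + 1) := by rw [← pow_add]; congr 1; omega
        rw [this]; exact Nat.mul_le_mul_right _ (by omega)
      refine (Finset.sum_le_card_nsmul _ _ 1 fun x hx => hl x ?_).trans ?_
      · have := (Finset.mem_Ico.1 hx).2; omega
      · simp; omega
    have hs' : ∑ x ∈ Finset.Ico (y * 2 ^ (t + 1)) ((y + 1) * 2 ^ (t + 1)), T x 0 =
        T (2 * y) t + T (2 * y + 1) t := by
      rw [ih (by omega) (by omega), ih (by omega) (by omega),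
        ← Finset.sum_Ico_consecutive _ (n := (2 * y + 1) * 2 ^ t) (by rw [pow_succ]; nlinarith)
          (by rw [pow_succ]; nlinarith)]
      congr 2
      · rw [pow_succ]; congr 1; ring
      · rw [pow_succ]; congr 1; ring
    rw [hs'] at hs ⊢
    rw [h t (by omega) y (by omega)]
    have hK : 2 ≤ 2 ^ k := Nat.le_self_pow (by omega) 2
    unfold comb
    rw [if_pos (by omega), one_mul]
    refine Nat.mod_eq_of_lt ?_
    nlinarith

/-- For `f = 0` the second child counts only if the first is `0`. So no two nonzero values are ever
added, and a nonzero node passes on the value of a leaf. -/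
theorem node_witness {k : ℕ} {T : ℕ → ℕ → ℕ}
    (h : ∀ t < k, ∀ y, 2 * y + 1 < 2 ^ k →
      T y (t + 1) = comb 0 (2 ^ k) (T (2 * y) t) (T (2 * y + 1) t))
    (hl : ∀ x < 2 ^ k, T x 0 < 2 ^ k * 2 ^ k) {t : ℕ} (ht : t ≤ k) {y : ℕ} (hy : y < 2 ^ (k - t)) :
    (T y t = 0 ∧ ∀ x ∈ Finset.Ico (y * 2 ^ t) ((y + 1) * 2 ^ t), T x 0 = 0) ∨
      ∃ x < 2 ^ k, T x 0 ≠ 0 ∧ T y t = T x 0 := by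
  induction t generalizing y with
  | zero =>
    by_cases h0 : T y 0 = 0
    · refine .inl ⟨h0, fun x hx => ?_⟩
      simp only [pow_zero, mul_one, Finset.mem_Ico] at hx
      obtain rfl : x = y := by omega
      exact h0
    · exact .inr ⟨y, by simpa using hy, h0, rfl⟩
  | succ t ih =>
    have e : 2 ^ (k - t) = 2 * 2 ^ (k - (t + 1)) := by
      rw [← pow_succ']; congr 1; omega
    have h2 : 2 ^ (k - t) ≤ 2 ^ k := Nat.pow_le_pow_right (by omega) (by omega)
    have hn := h t (by omega) y (by omega)
    unfold comb at hn
    rcases ih (by omega) (y := 2 * y) (by omega) with ⟨h0, ha⟩ | ⟨x, hx, hx0, he⟩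
    · rw [h0] at hn
      simp only [add_zero, if_true, zero_add, zero_lt_one, one_mul] at hn
      rcases ih (by omega) (y := 2 * y + 1) (by omega) with ⟨h0', ha'⟩ | ⟨x, hx, hx0, he⟩
      · rw [h0', Nat.zero_mod] at hn
        refine .inl ⟨hn, fun x hx => ?_⟩
        rw [Finset.mem_Ico, pow_succ] at hx
        by_cases hlt : x < (2 * y + 1) * 2 ^ t
        · exact ha x (Finset.mem_Ico.2 ⟨by nlinarith, hlt⟩)
        · exact ha' x (Finset.mem_Ico.2 ⟨by omega, by nlinarith⟩)
      · rw [he, Nat.mod_eq_of_lt (hl x hx)] at hn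
        exact .inr ⟨x, hx, hx0, hn⟩
    · rw [he, if_neg hx0, if_neg (by omega), zero_mul, add_zero, Nat.mod_eq_of_lt (hl x hx)] at hn
      exact .inr ⟨x, hx, hx0, hn⟩

/-- Compute the ranks of the elements of the frame among the marked leaves of their rows. -/
def ranks (F : Frame) (a a' : ℕ) : Cmd :=
  forHeights (pfor F.len F.deg 1 a' (addrE F.row F.elt (.reg 8 + 1))
    ((.op .lt 0 (.reg 8) * .read a' (addrE F.row F.elt (.reg 8)) +
      F.elt / .reg 9 % 2 * .read a (addrE F.row (F.elt / .reg 9 - 1) (.reg 8))) %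
        (.reg 4 * .reg 4)))

/-- The rank is accumulated along the binary expansion of `x`. The interval from `x / 2 ^ (t + 1) *
2 ^ (t + 1)` to `x` is the one for `t`, preceded by the block of the left sibling of the ancestor at
height `t` if bit `t` of `x` is `1`. After `k` rounds the interval starts at `0`. The partial sums
of `x` lie in cells indexed by `x` itself, not by its ancestors. -/
theorem ranks_runs {b B k : ℕ} (hm : Machine b B k) {F : Frame} (hF : F.Small) {a a' : ℕ}
    (haa : a ≠ a') (ha : a' ∉ F.arrays) {σ : Regs} {M : Mem} (h : Below b σ M) (hK : σ 4 = 2 ^ k)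
    (hk : σ 5 = k) {A : Items} (hA : F.Den b σ M A) (hx : ∀ r x, A.Has r x → x < 2 ^ k)
    {f : ℕ → ℕ → ℕ} (hf : ∀ r x, A.Has r x → ∀ y, f r y ≤ 1)
    (hM : ∀ r x, A.Has r x → ∀ t ≤ k, ∀ y < 2 ^ (k - t), M (a, addr (2 ^ k) r y t) =
      ∑ z ∈ Finset.Ico (y * 2 ^ t) ((y + 1) * 2 ^ t), f r z) :
    ∃ M', Runs B (ranks F a a') σ M (atHeight σ k) M' (4000 * ((k + 1) * extent A.ln A.dg))
        (4000 * (k + 1)) ∧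
      (∀ p, M' p < b) ∧ (∀ p, p.1 ≠ a' → M' p = M p) ∧
      ∀ r x, A.Has r x → M' (a', addr (2 ^ k) r x k) = ∑ z ∈ Finset.range x, f r z := by
  have hb := hm.two_le
  have hlt := hm.lt
  have hK2 : 2 ≤ 2 ^ k := Nat.le_self_pow (by have := hm.two_le_k; omega) 2
  have har : ∀ a ∈ F.arrays, a ≠ a' := fun a h' e => ha (e ▸ h')
  simp only [Frame.arrays, List.mem_append, not_or] at ha
  obtain ⟨d1, d2, d3, d4, -, -⟩ := id hF
  have step : ∀ r x, A.Has r x → ∀ t < k,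
      (∑ z ∈ Finset.Ico (x / 2 ^ t * 2 ^ t) x, f r z) +
        x / 2 ^ t % 2 * M (a, addr (2 ^ k) r (x / 2 ^ t - 1) t) =
      ∑ z ∈ Finset.Ico (x / 2 ^ (t + 1) * 2 ^ (t + 1)) x, f r z := by
    intro r x hh t ht
    have hxk := hx r x hh
    have hq : x / 2 ^ t < 2 ^ (k - t) := by
      rw [Nat.div_lt_iff_lt_mul (by positivity), ← pow_add]
      rwa [show k - t + t = k by omega]
    have hqx : x / 2 ^ t * 2 ^ t ≤ x := Nat.div_mul_le_self _ _
    rw [← div_pow_div_two, pow_succ]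
    rcases Nat.mod_two_eq_zero_or_one (x / 2 ^ t) with h0 | h1
    · rw [h0, zero_mul, add_zero]
      congr 2
      rw [mul_comm (2 ^ t) 2, ← mul_assoc]; congr 1; omega
    · have e1 : x / 2 ^ t / 2 * (2 ^ t * 2) = (x / 2 ^ t - 1) * 2 ^ t := by
        rw [mul_comm (2 ^ t) 2, ← mul_assoc]
        congr 1
        exact (by omega : ∀ q : ℕ, q % 2 = 1 → q / 2 * 2 = q - 1) _ h1
      have e2 : x / 2 ^ t - 1 + 1 = x / 2 ^ t :=
        (by omega : ∀ q : ℕ, q % 2 = 1 → q - 1 + 1 = q) _ h1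
      rw [h1, one_mul, hM r x hh t ht.le _ ((Nat.sub_le _ _).trans_lt hq), e1, e2, add_comm]
      exact Finset.sum_Ico_consecutive _ (Nat.mul_le_mul_right _ (by omega)) hqx
  have small : ∀ r x, A.Has r x → ∀ l, ∑ z ∈ Finset.Ico l x, f r z < 2 ^ k * 2 ^ k := by
    intro r x hh l
    have hxk := hx r x hh
    have : ∑ z ∈ Finset.Ico l x, f r z ≤ x := by
      refine (Finset.sum_le_card_nsmul _ _ 1 fun z _ => hf r x hh z).trans ?_
      simp
    nlinarith
  obtain ⟨M', hr, ⟨hM1, hM2⟩, hM4⟩ := forHeights_runs (w := 2006 * extent A.ln A.dg)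
    (d := 2006) (c := pfor F.len F.deg 1 a' (addrE F.row F.elt (.reg 8 + 1))
    ((.op .lt 0 (.reg 8) * .read a' (addrE F.row F.elt (.reg 8)) +
      F.elt / .reg 9 % 2 * .read a (addrE F.row (F.elt / .reg 9 - 1) (.reg 8))) %
        (.reg 4 * .reg 4))) hm h hk
    (fun t M' => (∀ p, p.1 ≠ a' → M' p = M p) ∧
      (∀ r x, A.Has r x → t ≠ 0 → M' (a', addr (2 ^ k) r x t) =
        ∑ z ∈ Finset.Ico (x / 2 ^ t * 2 ^ t) x, f r z))
    ⟨fun _ _ => rfl, fun _ _ _ h => absurd rfl h⟩ (by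
      rintro t ht M' ⟨i1, i2⟩ hbl
      have hA' : F.Den b (atHeight σ t) M' A := hA.atHeight hF t fun a' h' i => i1 _ (har a' h')
      have s4 : ∀ j i, thread (atHeight σ t) j i 4 = 2 ^ k := fun j i => by
        rw [thread_of_two_le _ _ _ (by omega), atHeight_of_ne _ _ (by omega) (by omega), hK]
      have s8 : ∀ j i, thread (atHeight σ t) j i 8 = t := fun j i => by
        rw [thread_of_two_le _ _ _ (by omega), atHeight_eight]
      have s9 : ∀ j i, thread (atHeight σ t) j i 9 = 2 ^ t := fun j i => by
        rw [thread_of_two_le _ _ _ (by omega), atHeight_nine]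
      -- For `t = 0` the interval is empty and the accumulator cell may hold anything; the factor `0
      -- < t` discards it.
      have hv : ∀ r x, A.Has r x → ((if 0 < t then 1 else 0) * M' (a', addr (2 ^ k) r x t) +
          x / 2 ^ t % 2 * M' (a, addr (2 ^ k) r (x / 2 ^ t - 1) t)) % (2 ^ k * 2 ^ k) =
          ∑ z ∈ Finset.Ico (x / 2 ^ (t + 1) * 2 ^ (t + 1)) x, f r z := by
        intro r x hh
        rw [i1 (a, _) haa, ← step r x hh t ht, Nat.mod_eq_of_lt]
        · congr 1
          split_ifs with h0
          · rw [one_mul, i2 r x hh (by omega)]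
          · obtain rfl : t = 0 := by omega
            simp
        · refine lt_of_eq_of_lt ?_ (small r x hh (x / 2 ^ (t + 1) * 2 ^ (t + 1)))
          rw [← step r x hh t ht]
          congr 1
          split_ifs with h0
          · rw [one_mul, i2 r x hh (by omega)]
          · obtain rfl : t = 0 := by omega
            simp
      obtain ⟨M'', hr, w1, w2⟩ := pfor_runs (a := a') (σ := atHeight σ t) (M := M') hb hm.pow_le hbl
        (len := F.len) (deg := F.deg) (cond := 1)
        (idx := addrE F.row F.elt (.reg 8 + 1))
        (val := (.op .lt 0 (.reg 8) * .read a' (addrE F.row F.elt (.reg 8)) +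
          F.elt / .reg 9 % 2 * .read a (addrE F.row (F.elt / .reg 9 - 1) (.reg 8))) %
          (.reg 4 * .reg 4))
        (by omega) (by omega) (by simp) (by simp; omega) (by simp; omega)
        (ln := A.ln) (dg := A.dg) (cv := fun _ _ => True)
        (iv := fun j i => addr (2 ^ k) (A.row j i) (A.elt j i) (t + 1))
        (vv := fun j i => ∑ z ∈ Finset.Ico (A.elt j i / 2 ^ (t + 1) * 2 ^ (t + 1)) (A.elt j i),
          f (A.row j i) z)
        hA'.len hA'.len_le hA'.deg hA'.deg_le (by simp)
        (fun j hj i hi _ => by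
          simp [hA'.row j hj i hi, hA'.elt j hj i hi, s4, s8])
        (fun j hj i hi _ => by
          rw [← hv (A.row j i) (A.elt j i) ⟨j, hj, i, hi, rfl, rfl⟩]
          simp [hA'.row j hj i hi, hA'.elt j hj i hi, s4, s8, s9])
        (fun j hj i hi j' hj' i' hi' _ _ he => by
          have g := hx _ _ ⟨j, hj, i, hi, rfl, rfl⟩
          have g' := hx _ _ ⟨j', hj', i', hi', rfl, rfl⟩
          obtain ⟨e1, e2, -⟩ := addr_inj g (by omega) g' (by omega) he
          simp only [e1, e2])
        ha.1.1.2 (by simp) (by simp [ha])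
        (fun j hj i hi j' hj' i' hi' _ hmem => by
          have g := hx _ _ ⟨j, hj, i, hi, rfl, rfl⟩
          have g' := hx _ _ ⟨j', hj', i', hi', rfl, rfl⟩
          have n1 : ∀ e : Expr, a' ∉ e.arrays → ∀ i σ M, ((a', i) : Loc) ∉ e.reads σ M :=
            fun e he i σ M hh => he (Expr.mem_arrays_of_mem_reads hh)
          have n2 := n1 F.row ha.1.2
          have n3 := n1 F.elt ha.2
          simp only [addrE, Expr.reads_mod, Expr.reads_add, Expr.reads_read, Expr.reads_mul,
            Expr.reads_div, Expr.reads_sub, Expr.reads_reg, Expr.reads_ofNat, Expr.reads_op,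
            Set.union_empty, Set.empty_union, Set.mem_union, Set.mem_insert_iff, n2, n3, or_false,
            Prod.mk.injEq, true_and, Expr.val_add, Expr.val_mul, Expr.val_reg,
            s4, s8, hA'.row j' hj' i' hi', hA'.elt j' hj' i' hi', haa.symm, false_and] at hmem
          have := (addr_inj g (by omega) g' (by omega) hmem).2.2
          omega)
      refine ⟨M'', hr, ⟨fun p hp => ?_, fun r x hh _ => ?_⟩, fun p => ?_⟩
      · rw [w2 p fun j hj i hi _ he => hp (by rw [he]), i1 p hp]
      · obtain ⟨j, hj, i, hi, rfl, rfl⟩ := hh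
        exact w1 j hj i hi trivial
      · by_cases hp : ∃ j < A.ln, ∃ i < A.dg j,
          p = (a', addr (2 ^ k) (A.row j i) (A.elt j i) (t + 1))
        · obtain ⟨j, hj, i, hi, rfl⟩ := hp
          rw [w1 j hj i hi trivial]
          exact (small _ _ ⟨j, hj, i, hi, rfl, rfl⟩ _).trans_le hm.sq_le
        · push Not at hp
          rw [w2 p fun j hj i hi _ => hp j hj i hi]
          exact hbl.mem p)
  refine ⟨M', hr.mono ?_ ?_, hM4, hM1, fun r x hh => ?_⟩
  · have : 1 ≤ extent A.ln A.dg := by unfold extent; omega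
    calc (k + 1) * (2006 * extent A.ln A.dg + 1700) ≤ (k + 1) * (4000 * extent A.ln A.dg) :=
          Nat.mul_le_mul_left _ (by omega)
      _ = _ := by ring
  · omega
  · rw [hM2 r x hh (by have := hm.two_le_k; omega), Nat.div_eq_of_lt (hx r x hh), zero_mul,
      Finset.range_eq_Ico]

/-- `X` lists the elements of `Q` in its first `c` cells, without repetition. -/
def Lists (X : ℕ → ℕ) (c : ℕ) (Q : Finset ℕ) : Prop := (Finset.range c).image X = Q ∧ c = Q.card

theorem Lists.sum {X : ℕ → ℕ} {c : ℕ} {Q : Finset ℕ} (h : Lists X c Q) (f : ℕ → ℕ) :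
    ∑ j ∈ Finset.range c, f (X j) = ∑ v ∈ Q, f v := by
  obtain ⟨rfl, hc⟩ := h
  rw [Finset.sum_image]
  exact Finset.card_image_iff.1 (by rw [← hc, Finset.card_range])

theorem Lists.mem {X : ℕ → ℕ} {c : ℕ} {Q : Finset ℕ} (h : Lists X c Q) {j : ℕ} (hj : j < c) :
    X j ∈ Q := by
  rw [← h.1]; exact Finset.mem_image_of_mem _ (Finset.mem_range.2 hj)

theorem Lists.exists {X : ℕ → ℕ} {c : ℕ} {Q : Finset ℕ} (h : Lists X c Q) {v : ℕ} (hv : v ∈ Q) :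
    ∃ j < c, X j = v := by
  rw [← h.1] at hv; simpa using hv

theorem Lists.inj {X : ℕ → ℕ} {c : ℕ} {Q : Finset ℕ} (h : Lists X c Q) {i j : ℕ} (hi : i < c)
    (hj : j < c) (hij : X i = X j) : i = j := by
  have hc : ((Finset.range c).image X).card = (Finset.range c).card := by
    rw [h.1, ← h.2, Finset.card_range]
  exact Finset.card_image_iff.1 hc (by simpa) (by simpa) hij

-- Ranks are less than `Q.card`, so the first `Q.card` cells cover `Q`; by cardinality they contain
-- nothing else.
open Classical in
theorem lists_of_rank {Q : Finset ℕ} {X : ℕ → ℕ} (h : ∀ x ∈ Q, X (Q.filter (· < x)).card = x) :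
    Lists X Q.card Q := by
  refine ⟨(Finset.eq_of_subset_of_card_le (fun x hx => ?_) ?_).symm, rfl⟩
  · refine Finset.mem_image.2 ⟨_, Finset.mem_range.2 (Finset.card_lt_card ?_), h x hx⟩
    exact Finset.filter_ssubset.2 ⟨x, hx, lt_irrefl x⟩
  · exact Finset.card_image_le.trans (by simp)

/-- Insert the elements of the frame into their rows: the rows are trees with marked leaves in the
array `a`, and lists of the marked elements in the array `c`. -/
def insert (F : Frame) (a a' c : ℕ) : Cmd :=
  .seq (pfor F.len F.deg 1 a (addrE F.row F.elt 0) 1) (.seq (treeUp F a 1) (.seq (ranks F a a')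
    (pfor F.len F.deg 1 c (F.row * .reg 4 * .reg 4 + .read a' (addrE F.row F.elt (.reg 5))) F.elt)))

/-- Repeated elements mark the same leaf, get the same rank and write the same cell, which removes
duplicates. Only rows that are still zero are filled, so there is no cost for clearing. The last
clause also covers zero rows without any element of the frame: their count is `0`. -/
theorem insert_runs {b B k : ℕ} (hm : Machine b B k) {F : Frame} (hF : F.Small) {a a' c : ℕ}
    (haa : a ≠ a') (hac : a ≠ c) (hac' : a' ≠ c) (ha : a ∉ F.arrays) (ha' : a' ∉ F.arrays)
    (hc : c ∉ F.arrays)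
    {σ : Regs} {M : Mem} (h : Below b σ M) (hK : σ 4 = 2 ^ k)
    (hk : σ 5 = k) {A : Items} (hA : F.Den b σ M A) (hx : ∀ r x, A.Has r x → x < 2 ^ k)
    (hfresh : ∀ r x, A.Has r x → ∀ y < 2 ^ k, ∀ t < 2 ^ k, M (a, addr (2 ^ k) r y t) = 0) :
    ∃ M', Runs B (insert F a a' c) σ M (atHeight σ k) M' (13000 * ((k + 1) * extent A.ln A.dg))
        (13000 * (k + 1)) ∧
      (∀ p, M' p < b) ∧ (∀ p, p.1 ≠ a → p.1 ≠ a' → p.1 ≠ c → M' p = M p) ∧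
      (∀ i, (∀ r x, A.Has r x → i / (2 ^ k * 2 ^ k) ≠ r) → M' (a, i) = M (a, i)) ∧
      (∀ i, (∀ r x, A.Has r x → i / (2 ^ k * 2 ^ k) ≠ r) → M' (c, i) = M (c, i)) ∧
      ∀ r, (∀ y < 2 ^ k, ∀ t < 2 ^ k, M (a, addr (2 ^ k) r y t) = 0) →
        ∃ Q : Finset ℕ, (∀ x, x ∈ Q ↔ A.Has r x) ∧
          Lists (fun j => M' (c, r * (2 ^ k * 2 ^ k) + j)) (M' (a, addr (2 ^ k) r 0 k)) Q := by
  classical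
  have hb := hm.two_le
  have hlt := hm.lt
  have hKb := hm.K_lt
  have hK2 : 2 ≤ 2 ^ k := Nat.le_self_pow (by have := hm.two_le_k; omega) 2
  obtain ⟨d1, d2, d3, d4, -, -⟩ := id hF
  have nmem : ∀ a, a ∉ F.arrays → a ∉ F.len.arrays ∧ a ∉ F.deg.arrays ∧ a ∉ F.row.arrays ∧
      a ∉ F.elt.arrays := by
    intro a ha
    simp only [Frame.arrays, List.mem_append, not_or] at ha
    tauto
  obtain ⟨na1, na2, na3, na4⟩ := nmem a ha
  obtain ⟨nc1, nc2, nc3, nc4⟩ := nmem c hc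
  have s4 : ∀ j i, thread σ j i 4 = 2 ^ k := fun j i => by
    rw [thread_of_two_le _ _ _ (by omega), hK]
  -- mark the leaves
  obtain ⟨M₁, hr₁, w1, w2⟩ := pfor_runs (a := a) (σ := σ) (M := M) hb hm.pow_le h
    (len := F.len) (deg := F.deg) (cond := 1) (idx := addrE F.row F.elt 0) (val := 1)
    (by omega) (by omega) (by simp) (by simp; omega) (by simp)
    (ln := A.ln) (dg := A.dg) (cv := fun _ _ => True)
    (iv := fun j i => addr (2 ^ k) (A.row j i) (A.elt j i) 0) (vv := fun _ _ => 1)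
    hA.len hA.len_le hA.deg hA.deg_le (by simp)
    (fun j hj i hi _ => by simp [hA.row j hj i hi, hA.elt j hj i hi, s4]) (by simp) (by simp)
    na2 (by simp) (by simp [na3, na4]) (by simp)
  have hM₁ : ∀ p, p.1 ≠ a → M₁ p = M p := fun p hp => w2 p fun j hj i hi _ he => hp (by rw [he])
  have hb₁ : Below b σ M₁ := by
    refine ⟨h.regs, fun p => ?_⟩
    by_cases hp : ∃ j < A.ln, ∃ i < A.dg j, p = (a, addr (2 ^ k) (A.row j i) (A.elt j i) 0)
    · obtain ⟨j, hj, i, hi, rfl⟩ := hp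
      rw [w1 j hj i hi trivial]; omega
    · push Not at hp
      rw [w2 p fun j hj i hi _ => hp j hj i hi]
      exact h.mem p
  have leaf1 : ∀ r x, A.Has r x → M₁ (a, addr (2 ^ k) r x 0) = 1 := by
    rintro r x ⟨j, hj, i, hi, rfl, rfl⟩
    exact w1 j hj i hi trivial
  have leaf2 : ∀ r x t, x < 2 ^ k → t < 2 ^ k → (t = 0 → ¬ A.Has r x) →
      M₁ (a, addr (2 ^ k) r x t) = M (a, addr (2 ^ k) r x t) := by
    intro r x t hxk ht hn
    refine w2 _ fun j hj i hi _ he => ?_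
    obtain ⟨rfl, rfl, rfl⟩ := addr_inj hxk ht (hx _ _ ⟨j, hj, i, hi, rfl, rfl⟩) (by omega)
      (Prod.mk.inj he).2
    exact hn rfl ⟨j, hj, i, hi, rfl, rfl⟩
  have row1 : ∀ i, (∀ r x, A.Has r x → i / (2 ^ k * 2 ^ k) ≠ r) → M₁ (a, i) = M (a, i) := by
    intro i hi
    refine w2 _ fun j hj i' hi' _ he => ?_
    have hh : A.Has (A.row j i') (A.elt j i') := ⟨j, hj, i', hi', rfl, rfl⟩
    refine hi _ _ hh ?_
    rw [(Prod.mk.inj he).2, addr_div (hx _ _ hh) (by omega)]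
  have den : ∀ M', (∀ p, p.1 ≠ a → p.1 ≠ a' → M' p = M p) → F.Den b σ M' A := fun M' hM' =>
    hA.congr (fun _ _ => rfl) fun a₁ h₁ i => hM' _ (fun e => ha (e ▸ h₁)) fun e => ha' (e ▸ h₁)
  -- count
  obtain ⟨M₂, hr₂, hb₂, hM₂, leaf₂, row₂, cons₂⟩ := treeUp_runs hm hF (f := 1) le_rfl ha hb₁ hK hk
    (den M₁ fun p hp _ => hM₁ p hp) hx
  have hbl₂ : Below b (atHeight σ k) M₂ := ⟨(h.atHeight hm le_rfl).regs, hb₂⟩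
  let f : ℕ → ℕ → ℕ := fun r x => if A.Has r x then 1 else 0
  have sums : ∀ r, (∀ y < 2 ^ k, ∀ t < 2 ^ k, M (a, addr (2 ^ k) r y t) = 0) →
      ∀ t ≤ k, ∀ y < 2 ^ (k - t), M₂ (a, addr (2 ^ k) r y t) =
      ∑ z ∈ Finset.Ico (y * 2 ^ t) ((y + 1) * 2 ^ t), f r z := by
    intro r hr t ht y hy
    have hle : (y + 1) * 2 ^ t ≤ 2 ^ k := by
      have : 2 ^ k = 2 ^ (k - t) * 2 ^ t := by rw [← pow_add]; congr 1; omega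
      rw [this]; exact Nat.mul_le_mul_right _ (by omega)
    have hl : ∀ x < 2 ^ k, M₂ (a, addr (2 ^ k) r x 0) = f r x := by
      intro x hxk
      rw [leaf₂ r x hxk]
      by_cases hh : A.Has r x
      · simp [f, hh, leaf1]
      · rw [leaf2 r x 0 hxk (by omega) fun _ => hh, hr x hxk 0 (by omega)]
        simp [f, hh]
    -- Nothing is known about rows other than `r`, so all their leaves are exempted. In row `r` a
    -- node above no marked leaf is `0` and so are its children.
    have hcons : Consistent k a 1 M₂ (fun r' _ => r' ≠ r) := by
      refine cons₂ _ fun r' y t ht hy hq => ?_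
      by_cases hr' : r' = r
      · subst hr'
        rw [leaf2 _ _ _ (by omega) (by omega) (by omega), hr _ (by omega) _ (by omega)]
        have z : ∀ y', y' < 2 ^ k → y' / 2 = y → M₁ (a, addr (2 ^ k) r' y' t) = 0 := by
          intro y' hy' hyy
          rw [leaf2 _ _ _ (by omega) (by omega), hr _ (by omega) _ (by omega)]
          rintro rfl hh
          exact hq y' (.inr hh) (by simpa using hyy)
        rw [z _ (by omega) (by omega), z _ (by omega) (by omega)]
        simp [comb]
      · exact absurd (Nat.mul_div_cancel y (by positivity : 0 < 2 ^ (t + 1)))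
          (hq (y * 2 ^ (t + 1)) (.inl hr'))
    rw [node_eq_sum (T := fun y t => M₂ (a, addr (2 ^ k) r y t))
      (fun t ht y hy => hcons r y t ht hy fun x hx => absurd rfl hx) (fun x hxk => ?_) ht hy]
    · refine Finset.sum_congr rfl fun x hx => hl x ?_
      have := (Finset.mem_Ico.1 hx).2
      omega
    · simp only [hl x hxk, f]; split_ifs <;> omega
  -- ranks
  have h4 : atHeight σ k 4 = 2 ^ k := by rw [atHeight_of_ne _ _ (by omega) (by omega), hK]
  have h5 : atHeight σ k 5 = k := by rw [atHeight_of_ne _ _ (by omega) (by omega), hk]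
  have den₂ : F.Den b (atHeight σ k) M₂ A :=
    (den M₂ fun p hp hp' => by rw [hM₂ p hp, hM₁ p hp]).atHeight hF k fun _ _ _ => rfl
  obtain ⟨M₃, hr₃, hb₃, hM₃, rank₃⟩ := ranks_runs hm hF haa ha' hbl₂ h4 h5 den₂ hx (f := f)
    (fun r x _ y => by simp only [f]; split_ifs <;> omega)
    (fun r x hh => sums r (hfresh r x hh))
  have hat : atHeight (atHeight σ k) k = atHeight σ k := by
    funext x
    simp only [atHeight, Function.update]
    split_ifs <;> rfl
  rw [hat] at hr₃
  have hbl₃ : Below b (atHeight σ k) M₃ := ⟨hbl₂.regs, hb₃⟩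
  have den₃ : F.Den b (atHeight σ k) M₃ A := den₂.congr (fun _ _ => rfl) fun a₁ h₁ i =>
    hM₃ _ fun e => ha' (e ▸ h₁)
  have card : ∀ r x, ∑ z ∈ Finset.range x, f r z = ((Finset.range x).filter (A.Has r)).card := by
    intro r x; rw [Finset.card_filter]
  have rank_lt : ∀ r x, A.Has r x → ∑ z ∈ Finset.range x, f r z < 2 ^ k := by
    intro r x hh
    rw [card]
    exact ((Finset.card_filter_le _ _).trans (by simp)).trans_lt (hx r x hh)
  have t4 : ∀ j i, thread (atHeight σ k) j i 4 = 2 ^ k := fun j i => by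
    rw [thread_of_two_le _ _ _ (by omega), h4]
  have t5 : ∀ j i, thread (atHeight σ k) j i 5 = k := fun j i => by
    rw [thread_of_two_le _ _ _ (by omega), h5]
  -- Distinct marked elements of a row have distinct ranks, so only threads with equal elements meet
  -- in a cell of the list.
  have rank_inj : ∀ r x x', A.Has r x → A.Has r x' →
      ∑ z ∈ Finset.range x, f r z = ∑ z ∈ Finset.range x', f r z → x = x' := by
    have aux : ∀ r x x', A.Has r x → x < x' →
        ∑ z ∈ Finset.range x, f r z < ∑ z ∈ Finset.range x', f r z := by
      intro r x x' hh hlt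
      have : ∑ z ∈ Finset.range (x + 1), f r z ≤ ∑ z ∈ Finset.range x', f r z :=
        Finset.sum_le_sum_of_subset (Finset.range_subset_range.2 hlt)
      rw [Finset.sum_range_succ] at this
      have : f r x = 1 := if_pos hh
      omega
    intro r x x' hh hh' he
    rcases lt_trichotomy x x' with hlt | rfl | hlt
    · have := aux r x x' hh hlt; omega
    · rfl
    · have := aux r x' x hh' hlt; omega
  -- compact
  have hcell : ∀ r j r' j' : ℕ, j < 2 ^ k → j' < 2 ^ k →
      r * (2 ^ k * 2 ^ k) + j = r' * (2 ^ k * 2 ^ k) + j' → r = r' ∧ j = j' := by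
    intro r j r' j' hj hj' he
    have := addr_inj (K := 2 ^ k) (r := r) (y := 0) (t := j) (r' := r') (y' := 0) (t' := j')
      (by omega) hj (by omega) hj' (by unfold addr; linarith)
    exact ⟨this.1, this.2.2⟩
  obtain ⟨M₄, hr₄, v1, v2⟩ := pfor_runs (a := c) (σ := atHeight σ k) (M := M₃) hb hm.pow_le hbl₃
    (len := F.len) (deg := F.deg) (cond := 1)
    (idx := F.row * .reg 4 * .reg 4 + .read a' (addrE F.row F.elt (.reg 5))) (val := F.elt)
    (by omega) (by omega) (by simp) (by simp; omega) (by omega)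
    (ln := A.ln) (dg := A.dg) (cv := fun _ _ => True)
    (iv := fun j i => A.row j i * (2 ^ k * 2 ^ k) + ∑ z ∈ Finset.range (A.elt j i), f (A.row j i) z)
    (vv := fun j i => A.elt j i)
    den₃.len den₃.len_le den₃.deg den₃.deg_le (by simp)
    (fun j hj i hi _ => by
      simp only [Expr.val_add, Expr.val_mul, den₃.row j hj i hi, Expr.val_reg, t4, Expr.val_read,
        addrE_val, den₃.elt j hj i hi, t5, rank₃ _ _ ⟨j, hj, i, hi, rfl, rfl⟩, mul_assoc])
    (fun j hj i hi _ => den₃.elt j hj i hi)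
    (fun j hj i hi j' hj' i' hi' _ _ he => by
      have g : A.Has (A.row j i) (A.elt j i) := ⟨j, hj, i, hi, rfl, rfl⟩
      have g' : A.Has (A.row j' i') (A.elt j' i') := ⟨j', hj', i', hi', rfl, rfl⟩
      obtain ⟨e1, e2⟩ := hcell _ _ _ _ (rank_lt _ _ g) (rank_lt _ _ g') he
      rw [← e1] at g' e2
      exact rank_inj _ _ _ g g' e2)
    nc2 (by simp) (by simp [nc3, nc4, hac'.symm])
    (fun j hj i hi j' hj' i' hi' _ hmem => nc4 (Expr.mem_arrays_of_mem_reads hmem))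
  have hM₄ : ∀ p, p.1 ≠ c → M₄ p = M₃ p := fun p hp => v2 p fun j hj i hi _ he => hp (by rw [he])
  have ea : ∀ i, M₄ (a, i) = M₂ (a, i) := fun i => by rw [hM₄ _ hac, hM₃ _ haa]
  refine ⟨M₄, (hr₁.seq (hr₂.seq (hr₃.seq hr₄))).mono ?_ ?_, ?_, ?_, ?_, ?_, ?_⟩
  · have : extent A.ln A.dg ≤ (k + 1) * extent A.ln A.dg := Nat.le_mul_of_pos_left _ (by omega)
    omega
  · omega
  · intro p
    by_cases hp : ∃ j < A.ln, ∃ i < A.dg j,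
      p = (c, A.row j i * (2 ^ k * 2 ^ k) + ∑ z ∈ Finset.range (A.elt j i), f (A.row j i) z)
    · obtain ⟨j, hj, i, hi, rfl⟩ := hp
      rw [v1 j hj i hi trivial]
      exact (hx _ _ ⟨j, hj, i, hi, rfl, rfl⟩).trans hKb
    · push Not at hp
      rw [v2 p fun j hj i hi _ => hp j hj i hi]
      exact hb₃ p
  · intro p h1 h2 h3
    rw [hM₄ p h3, hM₃ p h2, hM₂ p h1, hM₁ p h1]
  · intro i hi
    rw [ea, row₂ i hi, row1 i hi]
  · intro i hi
    rw [v2 (c, i), hM₃ _ hac'.symm, hM₂ _ hac.symm, hM₁ _ hac.symm]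
    intro j hj i' hi' _ he
    have hh : A.Has (A.row j i') (A.elt j i') := ⟨j, hj, i', hi', rfl, rfl⟩
    refine hi _ _ hh ?_
    have := rank_lt _ _ hh
    rw [(Prod.mk.inj he).2, mul_comm, Nat.mul_add_div (by positivity), Nat.div_eq_of_lt, add_zero]
    nlinarith
  · intro r hr
    refine ⟨(Finset.range (2 ^ k)).filter (A.Has r), fun x => ?_, ?_⟩
    · simp only [Finset.mem_filter, Finset.mem_range]
      exact ⟨fun h => h.2, fun h => ⟨hx r x h, h⟩⟩
    · have hcard : M₄ (a, addr (2 ^ k) r 0 k) = ((Finset.range (2 ^ k)).filter (A.Has r)).card := by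
        rw [ea, sums r hr k le_rfl 0 (by simp), ← card r, Finset.range_eq_Ico]
        simp
      rw [hcard]
      refine lists_of_rank fun x hxQ => ?_
      simp only [Finset.mem_filter, Finset.mem_range] at hxQ
      have e : ((Finset.range (2 ^ k)).filter (A.Has r)).filter (· < x) =
          (Finset.range x).filter (A.Has r) := by
        ext z
        simp only [Finset.mem_filter, Finset.mem_range]
        constructor
        · rintro ⟨⟨_, h1⟩, h2⟩; exact ⟨h2, h1⟩
        · rintro ⟨h1, h2⟩; exact ⟨⟨by omega, h2⟩, h1⟩
      obtain ⟨j, hj, i, hi, hjr, hjx⟩ := hxQ.2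
      have := v1 j hj i hi trivial
      rw [hjr, hjx, card] at this
      rw [e]; exact this

end WorkDepth

/-! ### Levels and parents -/

/-- A local certificate that the levels `D` (the distances plus `1`, or `0` if the distance exceeds
`L`) and the parents `P` (plus `1`, or `0` if there is none) describe a shortest-path tree of depth
`L` of the graph with the edges `E` on the vertices less than `n`. -/
structure Certified (n s L : ℕ) (E : ℕ → ℕ → Prop) (D P : ℕ → ℕ) : Prop where
  root : D s = 1
  eq_root : ∀ v < n, D v = 1 → v = s
  le : ∀ v < n, D v ≤ L + 1
  parent : ∀ v < n, 2 ≤ D v → ∃ u, P v = u + 1 ∧ E u v ∧ D u + 1 = D v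
  orphan : ∀ v < n, D v ≤ 1 → P v = 0
  edge : ∀ u v, E u v → D u ≠ 0 → D u ≤ L → D v ≠ 0 ∧ D v ≤ D u + 1

theorem DiWalk.mono {V : Type*} {E E' : Set (V × V)} (h : E ⊆ E') {k : ℕ} {u v : V}
    (hw : DiWalk E k u v) : DiWalk E' k u v := by
  induction hw with
  | nil v => exact .nil v
  | snoc _ e ih => exact .snoc ih (h e)

/-- Following parents from level `d` gives a walk with `d` tree edges from `s`. Conversely the edge
condition, applied along a walk of at most `L` edges, bounds the level of its end by its length. So
levels are distances and the tree paths are shortest. -/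
theorem Certified.holdsTree {n L : ℕ} {s : Fin n} {E : ℕ → ℕ → Prop} {M : Mem}
    (hE : ∀ u v, E u v → u < n ∧ v < n)
    (h : Certified n s L E (fun v => M (4, v)) (fun v => M (5, v))) :
    HoldsTree M {e : Fin n × Fin n | E e.1 e.2} s L := by
  set F : Set (Fin n × Fin n) := {e | E e.1 e.2} with hF
  set T : Set (Fin n × Fin n) := {e | M (5, e.2) = e.1 + 1 ∧ 2 ≤ M (4, (e.2 : ℕ))} with hT
  have hparent : ∀ v : Fin n, 2 ≤ M (4, (v : ℕ)) →
      ∃ u : Fin n, (u, v) ∈ T ∧ (u, v) ∈ F ∧ M (4, (u : ℕ)) + 1 = M (4, (v : ℕ)) := by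
    intro v hv
    obtain ⟨u, h1, h2, h3⟩ := h.parent v v.2 hv
    exact ⟨⟨u, (hE _ _ h2).1⟩, ⟨h1, hv⟩, h2, h3⟩
  have hTF : T ⊆ F := by
    rintro ⟨u, v⟩ ⟨h1, h2⟩
    obtain ⟨u', h3, h4, -⟩ := hparent v h2
    obtain rfl : u = u' := Fin.ext (by have := h3.1; simp only at this h1; omega)
    exact h4
  have sound : ∀ d (v : Fin n), M (4, (v : ℕ)) = d + 1 → DiWalk T d s v := by
    intro d
    induction d with
    | zero =>
      intro v hv
      obtain rfl : v = s := Fin.ext (h.eq_root v v.2 hv)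
      exact .nil v
    | succ d ih =>
      intro v hv
      obtain ⟨u, h1, -, h3⟩ := hparent v (by omega)
      exact .snoc (ih u (by omega)) h1
  have lower' : ∀ d (a v : Fin n), DiWalk F d a v → a = s → d ≤ L →
      M (4, (v : ℕ)) ≠ 0 ∧ M (4, (v : ℕ)) ≤ d + 1 := by
    intro d a v hw ha
    induction hw with
    | nil v => intro _; have : M (4, (s : ℕ)) = 1 := h.root; rw [ha]; omega
    | @snoc k a u v hw e ih =>
      intro hk
      obtain ⟨h1, h2⟩ := ih ha (by omega)
      obtain ⟨h3, h4⟩ := h.edge u v e h1 (by omega)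
      exact ⟨h3, by omega⟩
  have lower : ∀ d (v : Fin n), DiWalk F d s v → d ≤ L →
      M (4, (v : ℕ)) ≠ 0 ∧ M (4, (v : ℕ)) ≤ d + 1 := fun d v hw => lower' d s v hw rfl
  have dist : ∀ d (v : Fin n), M (4, (v : ℕ)) = d + 1 → HasDist F s v d := by
    intro d v hv
    refine ⟨(sound d v hv).mono hTF, fun k hk => ?_⟩
    by_contra hlt
    have hle : M (4, (v : ℕ)) ≤ L + 1 := h.le v v.2
    have := lower k v hk (by omega)
    omega
  have dist' : ∀ d (v : Fin n), d ≤ L → HasDist F s v d → M (4, (v : ℕ)) = d + 1 := by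
    intro d v hd hv
    have h1 := lower d v hv.1 hd
    have h2 := hv.2 ((sound (M (4, (v : ℕ)) - 1) v (by omega)).mono hTF)
    omega
  refine ⟨fun v => ⟨fun d hd hv => dist' d v hd hv, fun hv => ?_⟩, T, ⟨hTF, ?_, ?_, ?_, ?_⟩,
    fun v => ⟨fun u hu => hu.1, fun hv => ?_⟩⟩
  · by_contra hne
    have hle : M (4, (v : ℕ)) ≤ L + 1 := h.le v v.2
    exact hv ⟨M (4, (v : ℕ)) - 1, by omega, dist _ v (by omega)⟩
  · rintro u ⟨-, h2⟩
    have hr : M (4, (s : ℕ)) = 1 := h.root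
    simp only at h2
    omega
  · rintro u u' v ⟨h1, -⟩ ⟨h2, -⟩
    exact Fin.ext (by simp only at h1 h2; omega)
  · rintro u v ⟨h1, h2⟩
    have hle : M (4, (v : ℕ)) ≤ L + 1 := h.le v v.2
    simp only at h2
    exact ⟨M (4, (v : ℕ)) - 1, by omega, dist _ v (by omega)⟩
  · intro v d hd hv
    exact sound d v (dist' d v hd hv)
  · by_cases h2 : 2 ≤ M (4, (v : ℕ))
    · obtain ⟨u, hu, -⟩ := hparent v h2
      exact absurd hu (hv u)
    · exact h.orphan v v.2 (show M (4, (v : ℕ)) ≤ 1 by omega)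

/-- The state of a deletion before level `i` is processed: the vertices with a wrong parent are in
the queue `Q`, or have a higher level and are in the set `Z` of targets of deleted edges. The
auxiliary vertex `n` always has the level that is processed. -/
structure Pending (n s L : ℕ) (E A : ℕ → ℕ → Prop) (Z : ℕ → Prop) (i : ℕ) (D P : ℕ → ℕ)
    (Q : Finset ℕ) : Prop where
  root : D s = 1
  eq_root : ∀ v < n, D v = 1 → v = s
  le : ∀ v < n, D v ≤ L + 1
  orphan : ∀ v < n, D v ≤ 1 → P v = 0
  edge : ∀ u v, E u v → D u ≠ 0 → D u ≤ L → D v ≠ 0 ∧ D v ≤ D u + 1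
  parent : ∀ v < n, 2 ≤ D v → (∃ u, P v = u + 1 ∧ E u v ∧ D u + 1 = D v) ∨
    (D v = i + 1 ∧ v ∈ Q) ∨ (i + 1 < D v ∧ Z v)
  self : ∀ v < n, 2 ≤ D v → A v v
  aux : D n = if i ≤ L then i + 1 else 0
  aux_mem : n ∈ Q
  mem_le : ∀ v ∈ Q, v ≤ n
  mem_zero : i = 0 → ∀ v ∈ Q, v = n

/-- At `i = L + 1` both exceptions in `parent` would need a stored level of at least `L + 2`. -/
theorem Pending.certified {n s L : ℕ} {E A : ℕ → ℕ → Prop} {Z : ℕ → Prop} {D P : ℕ → ℕ}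
    {Q : Finset ℕ} (h : Pending n s L E A Z (L + 1) D P Q) : Certified n s L E D P where
  root := h.root
  eq_root := h.eq_root
  le := h.le
  orphan := h.orphan
  edge := h.edge
  parent := fun v hv h2 => by
    have := h.le v hv
    rcases h.parent v hv h2 with h1 | h1 | h1
    · exact h1
    · omega
    · omega

/-- The vertices that leave level `i`. -/
def Rises (i : ℕ) (D R : ℕ → ℕ) (Q : Finset ℕ) (v : ℕ) : Prop := v ∈ Q ∧ D v = i + 1 ∧ R v = 0

open Classical in
/-- The effect of processing level `i`. -/
theorem Pending.step {n s L i : ℕ} {E A : ℕ → ℕ → Prop} {Z : ℕ → Prop} {D P D' P' R : ℕ → ℕ}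
    {Q Q' : Finset ℕ} (h : Pending n s L E A Z i D P Q) (hi : i ≤ L) (hs : s < n)
    (hE : ∀ u v, E u v → u < n ∧ v < n) (hEA : ∀ u v, E u v → A u v)
    (hZ : ∀ v, Z v → A n v) (hn : A n n) (hA : ∀ u v, u ≤ n → A u v → v ≤ n)
    (hRn : R n = 0)
    (hR : ∀ v ∈ Q, v < n → D v = i + 1 → (R v = 0 ∧ ∀ u, E u v → D u ≠ i) ∨
      ∃ u, R v = u + 1 ∧ E u v ∧ D u = i)
    (hD' : ∀ v, D' v = if Rises i D R Q v then (if i < L then i + 2 else 0) else D v)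
    (hP' : ∀ v, P' v = if v ∈ Q ∧ D v = i + 1 then R v else P v)
    (hQ' : ∀ w, w ∈ Q' ↔ ∃ u, Rises i D R Q u ∧ A u w) :
    Pending n s L E A Z (i + 1) D' P' Q' := by
  -- At level `0` only the auxiliary vertex is queued; this keeps the source in place.
  have pos : ∀ v < n, v ∈ Q → i ≠ 0 := fun v hv hQ h0 => by
    have := h.mem_zero h0 v hQ; omega
  have hDn : D n = i + 1 := by rw [h.aux, if_pos hi]
  have hRise : Rises i D R Q n := ⟨h.aux_mem, hDn, hRn⟩
  have hD1 : ∀ v, Rises i D R Q v → D' v = if i < L then i + 2 else 0 := fun v hv => by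
    rw [hD', if_pos hv]
  have hD2 : ∀ v, ¬ Rises i D R Q v → D' v = D v := fun v hv => by rw [hD', if_neg hv]
  constructor
  · rw [hD2, h.root]
    rintro ⟨h1, h2, -⟩
    have := pos s hs h1
    have := h.root
    omega
  · intro v hv h1
    by_cases hr : Rises i D R Q v
    · rw [hD1 v hr] at h1
      split_ifs at h1; omega
    · rw [hD2 v hr] at h1
      exact h.eq_root v hv h1
  · intro v hv
    by_cases hr : Rises i D R Q v
    · rw [hD1 v hr]
      split_ifs <;> omega
    · rw [hD2 v hr]; exact h.le v hv
  · intro v hv h1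
    rw [hP']
    by_cases hq : v ∈ Q ∧ D v = i + 1
    · rw [if_pos hq]
      by_contra hR0
      rw [hD2 v fun hr => hR0 hr.2.2] at h1
      have := pos v hv hq.1
      omega
    · rw [if_neg hq]
      rw [hD2 v fun hr => hq ⟨hr.1, hr.2.1⟩] at h1
      exact h.orphan v hv h1
  · intro u v hE' h1 h2
    have hv := (hE u v hE').2
    by_cases hu : Rises i D R Q u
    · have hDu := hu.2.1
      rw [hD1 u hu] at h1 h2 ⊢
      by_cases hiL : i < L
      · rw [if_pos hiL] at h1 h2 ⊢
        by_cases hr : Rises i D R Q v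
        · rw [hD1 v hr, if_pos hiL]; omega
        · rw [hD2 v hr]
          have := h.edge u v hE' (by omega) (by omega)
          omega
      · rw [if_neg hiL] at h1; omega
    · rw [hD2 u hu] at h1 h2 ⊢
      have hold := h.edge u v hE' h1 h2
      -- If `v` rises and `u` does not, the old edge condition gives `i ≤ D u` and the failed search
      -- excludes equality, so raising `D v` to `i + 2` is allowed. For `i = L` this contradicts `D
      -- u ≤ L`.
      by_cases hr : Rises i D R Q v
      · have : D u ≠ i := by
          rcases hR v hr.1 hv hr.2.1 with h3 | ⟨u', h3, -⟩
          · exact h3.2 u hE'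
          · have := hr.2.2; omega
        have := hr.2.1
        rw [hD1 v hr, if_pos (by omega)]; omega
      · rw [hD2 v hr]; exact hold
  · intro v hv h2
    by_cases hr : Rises i D R Q v
    · have hD1v := hD1 v hr
      -- A vertex that rises is its own out-neighbour and so waits in the next queue for a new
      -- parent.
      have hvv : A v v := h.self v hv (by have := pos v hv hr.1; have := hr.2.1; omega)
      refine .inr (.inl ⟨?_, (hQ' v).2 ⟨v, hr, hvv⟩⟩)
      by_cases hiL : i < L
      · rw [if_pos hiL] at hD1v; omega
      · rw [if_neg hiL] at hD1v; omega
    · rw [hD2 v hr] at h2 ⊢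
      rw [hP']
      by_cases hq : v ∈ Q ∧ D v = i + 1
      · rw [if_pos hq]
        rcases hR v hq.1 hv hq.2 with h3 | ⟨u, h3, h4, h5⟩
        · exact absurd ⟨hq.1, hq.2, h3.1⟩ hr
        · refine .inl ⟨u, h3, h4, ?_⟩
          rw [hD2 u fun hu => by have := hu.2.1; omega]
          omega
      · rw [if_neg hq]
        rcases h.parent v hv h2 with ⟨u, h3, h4, h5⟩ | h3 | ⟨h3, h4⟩
        · by_cases hu : Rises i D R Q u
          · refine .inr (.inl ⟨?_, (hQ' v).2 ⟨u, hu, hEA u v h4⟩⟩)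
            have := hu.2.1; omega
          · exact .inl ⟨u, h3, h4, by rw [hD2 u hu, h5]⟩
        · exact absurd ⟨h3.2, h3.1⟩ hq
        · by_cases h5 : D v = i + 1 + 1
          · exact .inr (.inl ⟨h5, (hQ' v).2 ⟨n, hRise, hZ v h4⟩⟩)
          · exact .inr (.inr ⟨by omega, h4⟩)
  · intro v hv h2
    by_cases hr : Rises i D R Q v
    · exact h.self v hv (by have := pos v hv hr.1; have := hr.2.1; omega)
    · rw [hD2 v hr] at h2
      exact h.self v hv h2
  · rw [hD1 n hRise]
    by_cases hiL : i < L
    · rw [if_pos hiL, if_pos (by omega)]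
    · rw [if_neg hiL, if_neg (by omega)]
  · exact (hQ' n).2 ⟨n, hRise, hn⟩
  · intro v hv
    obtain ⟨u, hu, huv⟩ := (hQ' v).1 hv
    exact hA u v (h.mem_le u hu.1) huv
  · omega

/-- The state of a breadth-first search before level `i` is assigned to the new vertices of the
queue `Q`. -/
structure Searching (n s : ℕ) (E : ℕ → ℕ → Prop) (i : ℕ) (D : ℕ → ℕ) (Q : Finset ℕ) : Prop where
  le : ∀ v < n, D v ≤ i
  root : i = 0 ∧ s ∈ Q ∨ D s = 1
  eq_root : ∀ v < n, D v = 1 → v = s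
  parent : ∀ v < n, 2 ≤ D v → ∃ u, E u v ∧ D u + 1 = D v
  edge : ∀ u v, E u v → D u ≠ 0 → (D v ≠ 0 ∧ D v ≤ D u + 1) ∨ (D u = i ∧ v ∈ Q)
  mem : ∀ v ∈ Q, v < n ∧ (D v ≠ 0 ∨ (i = 0 ∧ v = s) ∨ (i ≠ 0 ∧ ∃ u, E u v ∧ D u = i))

-- A queued vertex without a level has an in-neighbour at the previous level, or is the source in
-- round `0`. Conversely an edge from an old vertex to one without a level must end in the queue,
-- hence its target gets a level now; the edges out of the new vertices are covered by the next
-- queue.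
open Classical in
theorem Searching.step {n s i : ℕ} {E A : ℕ → ℕ → Prop} {D D' : ℕ → ℕ} {Q Q' : Finset ℕ}
    (h : Searching n s E i D Q) (hs : s < n)
    (hE : ∀ u v, E u v → u < n ∧ v < n) (hEA : ∀ u v, E u v → A u v)
    (hAE : ∀ u v, u < n → A u v → v < n ∧ (E u v ∨ v = u))
    (hD' : ∀ v, D' v = if v ∈ Q ∧ D v = 0 then i + 1 else D v)
    (hQ' : ∀ w, w ∈ Q' ↔ ∃ u, (u ∈ Q ∧ D u = 0) ∧ A u w) :
    Searching n s E (i + 1) D' Q' := by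
  have hD1 : ∀ v, v ∈ Q ∧ D v = 0 → D' v = i + 1 := fun v hv => by rw [hD', if_pos hv]
  have hD2 : ∀ v, ¬ (v ∈ Q ∧ D v = 0) → D' v = D v := fun v hv => by rw [hD', if_neg hv]
  constructor
  · intro v hv
    have := h.le v hv
    rw [hD']; split_ifs <;> omega
  · right
    rcases h.root with ⟨rfl, h1⟩ | h1
    · rw [hD1 s ⟨h1, by have := h.le s hs; omega⟩]
    · rw [hD2 s (by omega), h1]
  · intro v hv h1
    by_cases hr : v ∈ Q ∧ D v = 0
    · rw [hD1 v hr] at h1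
      rcases (h.mem v hr.1).2 with h2 | h2 | h2
      · exact absurd hr.2 h2
      · exact h2.2
      · omega
    · rw [hD2 v hr] at h1
      exact h.eq_root v hv h1
  · intro v hv h2
    by_cases hr : v ∈ Q ∧ D v = 0
    · rw [hD1 v hr] at h2 ⊢
      rcases (h.mem v hr.1).2 with h3 | h3 | ⟨h3, u, h4, h5⟩
      · exact absurd hr.2 h3
      · omega
      · exact ⟨u, h4, by rw [hD2 u (by omega), h5]⟩
    · rw [hD2 v hr] at h2 ⊢
      obtain ⟨u, h3, h4⟩ := h.parent v hv h2
      exact ⟨u, h3, by rw [hD2 u (by omega), h4]⟩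
  · intro u v huv h1
    by_cases hu : u ∈ Q ∧ D u = 0
    · exact .inr ⟨hD1 u hu, (hQ' v).2 ⟨u, hu, hEA u v huv⟩⟩
    · rw [hD2 u hu] at h1 ⊢
      left
      by_cases hr : v ∈ Q ∧ D v = 0
      · rw [hD1 v hr]
        rcases h.edge u v huv h1 with h3 | h3
        · exact absurd hr.2 h3.1
        · omega
      · rw [hD2 v hr]
        rcases h.edge u v huv h1 with h3 | h3
        · exact h3
        · have := h.le v (hE u v huv).2
          have : D v ≠ 0 := fun h0 => hr ⟨h3.2, h0⟩
          omega
  · intro w hw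
    obtain ⟨u, hu, huw⟩ := (hQ' w).1 hw
    obtain ⟨h1, h2⟩ := hAE u w (h.mem u hu.1).1 huw
    refine ⟨h1, ?_⟩
    rcases h2 with h2 | rfl
    · exact .inr (.inr ⟨by omega, u, h2, hD1 u hu⟩)
    · exact .inl (by rw [hD1 _ hu]; omega)

/-- The only excepted edges start at the last assigned level and end in the queue. After round `L`
that level is beyond the range considered; if the queue is empty there are none. -/
theorem Searching.edge_of_finished {n s L i : ℕ} {E : ℕ → ℕ → Prop} {D : ℕ → ℕ} {Q : Finset ℕ}
    (h : Searching n s E i D Q) (hi : i = L + 1 ∨ Q = ∅) (u v : ℕ) (huv : E u v) (h1 : D u ≠ 0)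
    (h2 : D u ≤ L) : D v ≠ 0 ∧ D v ≤ D u + 1 := by
  rcases h.edge u v huv h1 with h3 | h3
  · exact h3
  · rcases hi with rfl | rfl
    · omega
    · simp at h3

/-! ### The queue and the trees of in-neighbours -/

namespace WorkDepth

theorem pfor_store {b B : ℕ} (hb : 2 ≤ b) (hB : b ^ 400 ≤ B) {σ : Regs} {M : Mem}
    (h : Below b σ M) {len deg cond idx val : Expr} {a : ℕ}
    (small : len.deg ≤ 400 ∧ deg.deg ≤ 400 ∧ cond.deg ≤ 400 ∧ idx.deg ≤ 400 ∧ val.deg ≤ 400)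
    {ln : ℕ} {dg : ℕ → ℕ} {cv : ℕ → ℕ → Prop} {iv vv : ℕ → ℕ → ℕ}
    (hlen : len.val σ M = ln) (lnb : ln ≤ b)
    (hdeg : ∀ j < ln, deg.val (Function.update σ 0 j) M = dg j) (dgb : ∀ j < ln, dg j ≤ b)
    (hcond : ∀ j < ln, ∀ i < dg j, cond.val (thread σ j i) M ≠ 0 ↔ cv j i)
    (hidx : ∀ j < ln, ∀ i < dg j, cv j i → idx.val (thread σ j i) M = iv j i)
    (hval : ∀ j < ln, ∀ i < dg j, cv j i → val.val (thread σ j i) M = vv j i)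
    (cons : ∀ j < ln, ∀ i < dg j, ∀ j' < ln, ∀ i' < dg j', cv j i → cv j' i' →
      iv j i = iv j' i' → vv j i = vv j' i')
    (race : a ∉ deg.arrays ∧ a ∉ cond.arrays ∧ a ∉ idx.arrays)
    (rval : a ∉ val.arrays ∨ ∀ j < ln, ∀ i < dg j, ∀ j' < ln, ∀ i' < dg j', cv j i →
      (a, iv j i) ∉ val.reads (thread σ j' i') M)
    (vvb : ∀ j < ln, ∀ i < dg j, cv j i → vv j i < b) :
    ∃ M', Runs B (pfor len deg cond a idx val) σ M σ M' (2006 * extent ln dg) 2006 ∧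
      Below b σ M' ∧ (∀ p, p.1 ≠ a → M' p = M p) ∧
      (∀ j < ln, ∀ i < dg j, cv j i → M' (a, iv j i) = vv j i) ∧
      (∀ x, (∀ j < ln, ∀ i < dg j, cv j i → x ≠ iv j i) → M' (a, x) = M (a, x)) := by
  obtain ⟨s1, s2, s3, s4, s5⟩ := small
  obtain ⟨M', hr, w1, w2⟩ := pfor_runs (a := a) hb hB h s1 s2 s3 s4 s5 hlen lnb hdeg dgb hcond hidx
    hval cons race.1 race.2.1 race.2.2 (fun j hj i hi j' hj' i' hi' hc hmem => by
      rcases rval with r | r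
      · exact r (Expr.mem_arrays_of_mem_reads hmem)
      · exact r j hj i hi j' hj' i' hi' hc hmem)
  refine ⟨M', hr, ⟨h.regs, fun p => ?_⟩, fun p hp => w2 p fun j hj i hi _ he => hp (by rw [he]), w1,
    fun x hx => w2 _ fun j hj i hi hc he => hx j hj i hi hc (Prod.mk.inj he).2⟩
  by_cases hp : ∃ j < ln, ∃ i < dg j, cv j i ∧ p = (a, iv j i)
  · obtain ⟨j, hj, i, hi, hc, rfl⟩ := hp
    rw [w1 j hj i hi hc]
    exact vvb j hj i hi hc
  · push Not at hp
    rw [w2 p fun j hj i hi hc => hp j hj i hi hc]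
    exact h.mem p

/-- A node equation involves a changed leaf only if the node is the parent of that leaf, hence one
of its ancestors. -/
theorem Consistent.of_leaves {k a f : ℕ} (hk : 2 ≤ k) {M M' : Mem} {P T : ℕ → ℕ → Prop}
    (hc : Consistent k a f M P)
    (h : ∀ i, (∀ r x, x < 2 ^ k → T r x → i ≠ addr (2 ^ k) r x 0) → M' (a, i) = M (a, i)) :
    Consistent k a f M' (fun r x => P r x ∨ T r x) := by
  have hlt : k < 2 ^ k := Nat.lt_two_pow_self
  intro r y t ht hy hq
  have key : ∀ y' t', y' < 2 ^ k → t' < 2 ^ k → (t' = 0 → ¬ T r y') →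
      M' (a, addr (2 ^ k) r y' t') = M (a, addr (2 ^ k) r y' t') := by
    intro y' t' hy' ht' hn
    refine h _ fun r' x hx hT he => ?_
    obtain ⟨rfl, rfl, rfl⟩ := addr_inj hy' ht' hx (by omega) he
    exact hn rfl hT
  have child : ∀ y', y' / 2 = y → t = 0 → ¬ T r y' := by
    rintro y' hy' rfl hT
    exact hq y' (.inr hT) (by simpa using hy')
  rw [key y (t + 1) (by omega) (by omega) (by omega),
    key (2 * y) t (by omega) (by omega) (child _ (by omega)),
    key (2 * y + 1) t (by omega) (by omega) (child _ (by omega))]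
  exact hc r y t ht hy fun x hx => hq x (.inl hx)

/-- The state of the machine between two operations of the data structure: the parameters, the
current epoch `e` and the current level `i`. -/
structure Env (b k n L e i : ℕ) (σ : Regs) (M : Mem) : Prop where
  below : Below b σ M
  r2 : σ 2 = n
  r3 : σ 3 = L
  r4 : σ 4 = 2 ^ k
  r5 : σ 5 = k
  r6 : σ 6 = e
  r7 : σ 7 = i

theorem Env.mem {b k n L e i : ℕ} {σ : Regs} {M M' : Mem} (h : Env b k n L e i σ M)
    (hM : ∀ p, M' p < b) : Env b k n L e i σ M' :=
  { h with below := ⟨h.below.regs, hM⟩ }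

theorem Env.update {b k n L e i : ℕ} {σ : Regs} {M : Mem} (h : Env b k n L e i σ M)
    {x v : ℕ} (hx : 8 ≤ x) (hv : v < b) : Env b k n L e i (Function.update σ x v) M := by
  have : ∀ y < 8, Function.update σ x v y = σ y := fun y hy =>
    Function.update_of_ne (by omega) _ _
  constructor
  · exact h.below.update hv
  all_goals rw [this _ (by omega)]
  exacts [h.r2, h.r3, h.r4, h.r5, h.r6, h.r7]

theorem Env.atHeight {b B k n L e i : ℕ} (hm : Machine b B k) {σ : Regs} {M : Mem}
    (h : Env b k n L e i σ M) : Env b k n L e i (atHeight σ k) M := by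
  have := hm.K_lt
  have := hm.lt
  exact (h.update (by omega) (by omega)).update (by omega) (by omega)

/-- The vertex of a thread in the current queue. -/
def vertex : Expr := .read 14 (.reg 0)

/-- The neighbour of this vertex that a thread treats. -/
def neighbor : Expr := .read 9 (vertex * .reg 4 * .reg 4 + .reg 1)

/-- In epoch `e`, the queue `Q` is listed in array `12` and counted in array `10`; the part of
array `10` for later epochs is empty. -/
structure Queue (k e : ℕ) (M : Mem) (Q : Finset ℕ) : Prop where
  lists : Lists (fun j => M (12, e * (2 ^ k * 2 ^ k) + j)) (M (10, addr (2 ^ k) e 0 k)) Q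
  fresh : ∀ i, (e + 1) * (2 ^ k * 2 ^ k) ≤ i → M (10, i) = 0

/-- Copy the queue to array `14` and its length to register `11`. -/
def loadQueue : Cmd :=
  .seq (.assign 11 (.read 10 (addrE (.reg 6) 0 (.reg 5))))
    (pfor (.reg 11) 1 1 14 (.reg 0) (.read 12 (.reg 6 * .reg 4 * .reg 4 + .reg 0)))

/-- The copy in array `14` allows the next queue to be written to array `12` while the current one
is still read. -/
theorem loadQueue_runs {b B k n L e i : ℕ} (hm : Machine b B k) {σ : Regs} {M : Mem}
    (h : Env b k n L e i σ M) {c : ℕ} (hc : M (10, addr (2 ^ k) e 0 k) = c) :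
    ∃ M', Runs B loadQueue σ M (Function.update σ 11 c) M' (401 + 2006 * (1 + c + c)) 2407 ∧
      Env b k n L e i (Function.update σ 11 c) M' ∧ (∀ p, p.1 ≠ 14 → M' p = M p) ∧
      ∀ j < c, M' (14, j) = M (12, e * (2 ^ k * 2 ^ k) + j) := by
  have hcb : c < b := by rw [← hc]; exact h.below.mem _
  have h' := h.update (x := 11) (v := c) (by omega) hcb
  have r1 : Runs B (.assign 11 (.read 10 (addrE (.reg 6) 0 (.reg 5)))) σ M
      (Function.update σ 11 c) M 401 401 :=
    Runs.assign hm.two_le hm.pow_le h.below 11 (by simp) (by simp [h.r4, h.r5, h.r6, hc])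
  have ht : ∀ j i, ∀ x, 2 ≤ x → thread (Function.update σ 11 c) j i x =
      Function.update σ 11 c x := fun j i x hx => thread_of_two_le _ _ _ hx
  obtain ⟨M', r2, hbl, hM, w1, -⟩ := pfor_store (a := 14) hm.two_le hm.pow_le h'.below
    (len := .reg 11) (deg := 1) (cond := 1) (idx := .reg 0)
    (val := .read 12 (.reg 6 * .reg 4 * .reg 4 + .reg 0)) (by simp)
    (ln := c) (dg := fun _ => 1) (cv := fun _ _ => True) (iv := fun j _ => j)
    (vv := fun j _ => M (12, e * (2 ^ k * 2 ^ k) + j))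
    (by simp) hcb.le (by simp) (by have := hm.two_le; intros; omega) (by simp) (by simp)
    (fun j _ i _ _ => by simp [ht, h.r4, h.r6, mul_assoc])
    (by rintro j - i - j' - i' - - - rfl; rfl) (by simp) (by simp)
    (fun _ _ _ _ _ => h.below.mem _)
  refine ⟨M', (r1.seq r2).mono ?_ (by omega), h'.mem hbl.mem, hM,
    fun j hj => w1 j hj 0 (by omega) trivial⟩
  simp [extent]

/-- The part of a phase that puts the neighbours of the chosen vertices into the next queue. -/
def advance : Cmd :=
  .seq (insert ⟨.reg 11, .read 13 (.reg 0), .reg 6 + 1, neighbor⟩ 10 11 12)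
    (.seq (.assign 6 (.reg 6 + 1)) (.assign 7 (.reg 7 + 1)))

/-- In the current state, array `14` holds a list `X` of `c` vertices, `rd j` neighbours of the
vertex `X j` are to be treated, and these are `nb j 0, nb j 1, …`. -/
structure Loaded (k : ℕ) (σ : Regs) (M : Mem) (c : ℕ) (X rd : ℕ → ℕ) (nb : ℕ → ℕ → ℕ) : Prop where
  len : σ 11 = c
  vertex : ∀ j < c, M (14, j) = X j
  count : ∀ j < c, M (13, j) = rd j
  neighbor : ∀ j < c, ∀ i < rd j, M (9, X j * (2 ^ k * 2 ^ k) + i) = nb j i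

theorem Loaded.congr {k : ℕ} {σ σ' : Regs} {M M' : Mem} {c : ℕ} {X rd : ℕ → ℕ} {nb : ℕ → ℕ → ℕ}
    (h : Loaded k σ M c X rd nb) (hσ : σ' 11 = σ 11)
    (hM : ∀ a i, a = 14 ∨ a = 13 ∨ a = 9 → M' (a, i) = M (a, i)) :
    Loaded k σ' M' c X rd nb where
  len := hσ.trans h.len
  vertex := fun j hj => by rw [hM _ _ (by simp), h.vertex j hj]
  count := fun j hj => by rw [hM _ _ (by simp), h.count j hj]
  neighbor := fun j hj i hi => by rw [hM _ _ (by simp), h.neighbor j hj i hi]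

section
variable {b B k n L e i c : ℕ} {σ : Regs} {M : Mem} {X rd : ℕ → ℕ} {nb : ℕ → ℕ → ℕ}

theorem Loaded.vertex_val (h : Loaded k σ M c X rd nb) {j : ℕ} (hj : j < c) (i : ℕ) :
    WorkDepth.vertex.val (thread σ j i) M = X j := by
  simp [WorkDepth.vertex, h.vertex j hj]

theorem Loaded.neighbor_val (h : Loaded k σ M c X rd nb) (h4 : σ 4 = 2 ^ k) {j : ℕ} (hj : j < c)
    {i : ℕ} (hi : i < rd j) : WorkDepth.neighbor.val (thread σ j i) M = nb j i := by
  simp only [WorkDepth.neighbor, Expr.val_read, Expr.val_add, Expr.val_mul, h.vertex_val hj,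
    Expr.val_reg, thread_one, thread_of_two_le _ _ _ (show 2 ≤ 4 by omega), h4, mul_assoc]
  exact h.neighbor j hj i hi

theorem Loaded.den (h : Loaded k σ M c X rd nb) (hb : Below b σ M) {row elt : Expr}
    {rv xv : ℕ → ℕ → ℕ}
    (hr : ∀ j < c, ∀ i < rd j, row.val (thread σ j i) M = rv j i)
    (hx : ∀ j < c, ∀ i < rd j, elt.val (thread σ j i) M = xv j i) :
    Frame.Den b ⟨.reg 11, .read 13 (.reg 0), row, elt⟩ σ M ⟨c, rd, rv, xv⟩ where
  len := h.len
  len_le := by have := hb.regs 11; rw [h.len] at this; exact this.le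
  deg := fun j hj => by simp [h.count j hj]
  deg_le := fun j hj => by have := hb.mem (13, j); rw [h.count j hj] at this; exact this.le
  row := hr
  elt := hx

theorem advance_runs (hm : Machine b B k) (h : Env b k n L e i σ M)
    (hl : Loaded k σ M c X rd nb) (he : e + 1 < b) (hi : i + 1 < b)
    (hnb : ∀ j < c, ∀ i < rd j, nb j i < 2 ^ k)
    (hfresh : ∀ i, (e + 1) * (2 ^ k * 2 ^ k) ≤ i → M (10, i) = 0) :
    ∃ σ' M', Runs B advance σ M σ' M' (14000 * ((k + 1) * extent c rd)) (14000 * (k + 1)) ∧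
      Env b k n L (e + 1) (i + 1) σ' M' ∧
      (∀ p, p.1 ≠ 10 → p.1 ≠ 11 → p.1 ≠ 12 → M' p = M p) ∧
      ∃ Q, Queue k (e + 1) M' Q ∧ ∀ w, w ∈ Q ↔ ∃ j < c, ∃ i < rd j, nb j i = w := by
  have hlt := hm.lt
  have hden := hl.den h.below (row := .reg 6 + 1) (elt := neighbor) (rv := fun _ _ => e + 1)
    (xv := nb) (fun j hj i _ => by simp [thread_of_two_le, h.r6])
    (fun j hj i hi => hl.neighbor_val h.r4 hj hi)
  have hrow : ∀ y t, (e + 1) * (2 ^ k * 2 ^ k) ≤ addr (2 ^ k) (e + 1) y t := by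
    intro y t
    unfold addr; rw [← mul_assoc, add_mul _ y]; omega
  obtain ⟨M', r1, hM1, hM2, hM3, -, hM4⟩ := insert_runs hm
    (F := ⟨.reg 11, .read 13 (.reg 0), .reg 6 + 1, neighbor⟩) (a := 10) (a' := 11) (c := 12)
    (by decide) (by decide) (by decide) (by decide) (by decide) (by decide) (by decide)
    h.below h.r4 h.r5 hden
    (by rintro r x ⟨j, hj, i, hi, -, rfl⟩; exact hnb j hj i hi)
    (by
      rintro r x ⟨j, hj, i, hi, rfl, -⟩ y hy t ht
      exact hfresh _ (hrow y t))
  have h1 := (h.atHeight hm).mem hM1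
  have b1 := h1.below
  have r2 : Runs B (.assign 6 (.reg 6 + 1)) (atHeight σ k) M'
      (Function.update (atHeight σ k) 6 (e + 1)) M' 401 401 :=
    Runs.assign hm.two_le hm.pow_le b1 6 (by simp) (by simp [h1.r6])
  have b2 : Below b (Function.update (atHeight σ k) 6 (e + 1)) M' := b1.update he
  have r3 : Runs B (.assign 7 (.reg 7 + 1)) (Function.update (atHeight σ k) 6 (e + 1)) M'
      (Function.update (Function.update (atHeight σ k) 6 (e + 1)) 7 (i + 1)) M' 401 401 :=
    Runs.assign hm.two_le hm.pow_le b2 7 (by simp) (by simp [h1.r7])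
  refine ⟨_, M', (r1.seq (r2.seq r3)).mono ?_ ?_, ?_, hM2, ?_⟩
  · have : 1 ≤ (k + 1) * extent c rd := Nat.mul_pos (by omega) (by unfold extent; omega)
    show 13000 * ((k + 1) * extent c rd) + (401 + 401) ≤ _
    omega
  · omega
  · constructor
    · exact b2.update hi
    · simpa using h1.r2
    · simpa using h1.r3
    · simpa using h1.r4
    · simpa using h1.r5
    · simp
    · simp
  · obtain ⟨Q, hQ1, hQ2⟩ := hM4 (e + 1) fun y _ t _ => hfresh _ (hrow y t)
    refine ⟨Q, ⟨hQ2, fun i hi => ?_⟩, fun w => ?_⟩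
    · rw [hM3, hfresh i (by nlinarith)]
      rintro r x ⟨j, hj, i', hi', rfl, -⟩ he
      have := (Nat.le_div_iff_mul_le (by positivity)).2 hi
      simp only at he
      omega
    · rw [hQ1]
      exact ⟨fun ⟨j, hj, i, hi, _, h⟩ => ⟨j, hj, i, hi, h⟩,
        fun ⟨j, hj, i, hi, h⟩ => ⟨j, hj, i, hi, rfl, h⟩⟩

/-- Give the chosen vertices the level that is the value of an expression. -/
theorem setLevels_runs (hm : Machine b B k) (h : Env b k n L e i σ M)
    (hl : Loaded k σ M c X rd nb) {val : Expr} {d : ℕ} (hs : val.deg ≤ 400)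
    (hv : ∀ j i, val.val (thread σ j i) M = d) (hd : d < b) (ha : 4 ∉ val.arrays) :
    ∃ M', Runs B (pfor (.reg 11) (.read 13 (.reg 0)) 1 4 vertex val) σ M σ M'
        (2006 * extent c rd) 2006 ∧ Env b k n L e i σ M' ∧ (∀ p, p.1 ≠ 4 → M' p = M p) ∧
      (∀ j < c, rd j ≠ 0 → M' (4, X j) = d) ∧
      (∀ v, (∀ j < c, rd j ≠ 0 → v ≠ X j) → M' (4, v) = M (4, v)) := by
  have hden := hl.den h.below (row := vertex) (elt := vertex) (rv := fun j _ => X j)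
    (xv := fun j _ => X j) (fun j hj i _ => hl.vertex_val hj i) (fun j hj i _ => hl.vertex_val hj i)
  obtain ⟨M', r, hbl, hM, w1, w2⟩ := pfor_store (a := 4) hm.two_le hm.pow_le h.below
    (len := .reg 11) (deg := .read 13 (.reg 0)) (cond := 1) (idx := vertex) (val := val)
    (by simp [hs, vertex]) (cv := fun _ _ => True) (iv := fun j _ => X j) (vv := fun _ _ => d)
    hden.len hden.len_le hden.deg hden.deg_le (by simp) (fun j hj i _ _ => hl.vertex_val hj i)
    (fun j _ i _ _ => hv j i) (by intros; rfl) (by simp [vertex]) (.inl ha) (by intros; exact hd)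
  -- A vertex of the list has one thread for each neighbour to be treated; with `rd j = 0` there is
  -- none and its level is not written. So the count also serves as the flag of a chosen vertex.
  exact ⟨M', r, h.mem hbl.mem, hM, fun j hj h0 => w1 j hj 0 (Nat.pos_of_ne_zero h0) trivial,
    fun v hv => w2 v fun j hj i hi _ => hv j hj (by simp only at hi; omega)⟩

/-- Move the chosen vertices from level `i` to level `i + 1` in the trees of their neighbours. -/
def moveLeaves : Cmd :=
  .seq (pfor (.reg 11) (.read 13 (.reg 0)) 1 6 (addrE (neighbor * .reg 4 + .reg 7 + 1) vertex 0)
      (.read 6 (addrE (neighbor * .reg 4 + .reg 7) vertex 0)))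
    (.seq (pfor (.reg 11) (.read 13 (.reg 0)) 1 6 (addrE (neighbor * .reg 4 + .reg 7) vertex 0) 0)
      (.seq (treeUp ⟨.reg 11, .read 13 (.reg 0), neighbor * .reg 4 + .reg 7, vertex⟩ 6 0)
        (treeUp ⟨.reg 11, .read 13 (.reg 0), neighbor * .reg 4 + .reg 7 + 1, vertex⟩ 6 0)))

theorem mul_add_inj {K r r' d d' : ℕ} (hd : d < K) (hd' : d' < K) (h : r * K + d = r' * K + d') :
    r = r' ∧ d = d' := by
  have := addr_inj (K := K) (r := r) (y := d) (t := 0) (r' := r') (y' := d') (t' := 0)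
    hd (by omega) hd' (by omega) (by unfold addr; rw [h])
  exact ⟨this.1, this.2.1⟩

/-- Leaves are copied to the row of level `i + 1` and then cleared in the row of level `i`; the two
rows are distinct, so the copying has no race. A stored neighbour whose edge is gone has an empty
leaf at level `i`, and an empty leaf is moved. The first `treeUp` repairs row `i` with the changed
leaves of row `i + 1` still excepted, the second removes that exception. -/
theorem moveLeaves_runs (hm : Machine b B k) (h : Env b k n L e i σ M)
    (hl : Loaded k σ M c X rd nb) (hi : i + 1 < 2 ^ k) (hX : ∀ j < c, X j < 2 ^ k)
    (hc : Consistent k 6 0 M fun _ _ => False) :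
    ∃ σ' M', Runs B moveLeaves σ M σ' M' (13000 * ((k + 1) * extent c rd)) (13000 * (k + 1)) ∧
      Env b k n L e i σ' M' ∧ σ' 11 = σ 11 ∧ (∀ p, p.1 ≠ 6 → M' p = M p) ∧
      Consistent k 6 0 M' (fun _ _ => False) ∧
      (∀ j < c, ∀ i' < rd j,
        M' (6, addr (2 ^ k) (nb j i' * 2 ^ k + (i + 1)) (X j) 0) =
          M (6, addr (2 ^ k) (nb j i' * 2 ^ k + i) (X j) 0) ∧
        M' (6, addr (2 ^ k) (nb j i' * 2 ^ k + i) (X j) 0) = 0) ∧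
      ∀ w, ∀ d < 2 ^ k, ∀ u < 2 ^ k,
        (∀ j < c, ∀ i' < rd j, X j = u → nb j i' = w → d ≠ i ∧ d ≠ i + 1) →
        M' (6, addr (2 ^ k) (w * 2 ^ k + d) u 0) = M (6, addr (2 ^ k) (w * 2 ^ k + d) u 0) := by
  have hlt := hm.lt
  have hb := hm.two_le
  have s4 : ∀ j i, thread σ j i 4 = 2 ^ k := fun j i => by
    rw [thread_of_two_le _ _ _ (by omega), h.r4]
  have s7 : ∀ j i', thread σ j i' 7 = i := fun j i => by
    rw [thread_of_two_le _ _ _ (by omega), h.r7]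
  have den : ∀ {σ' : Regs} {M' : Mem} (_ : Loaded k σ' M' c X rd nb) (_ : Env b k n L e i σ' M')
      (x : Expr) (d : ℕ), (∀ j i', x.val (thread σ' j i') M' = d) →
      Frame.Den b ⟨.reg 11, .read 13 (.reg 0), neighbor * .reg 4 + .reg 7 + x, vertex⟩ σ' M'
        ⟨c, rd, fun j i' => nb j i' * 2 ^ k + i + d, fun j _ => X j⟩ := by
    intro σ' M' hl' h' x d hx
    refine hl'.den h'.below (fun j hj i' hi' => ?_) fun j hj i' _ => hl'.vertex_val hj i'
    simp [hl'.neighbor_val h'.r4 hj hi', thread_of_two_le, h'.r4, h'.r7, hx]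
  have den0 : ∀ {σ' : Regs} {M' : Mem} (_ : Loaded k σ' M' c X rd nb) (_ : Env b k n L e i σ' M'),
      Frame.Den b ⟨.reg 11, .read 13 (.reg 0), neighbor * .reg 4 + .reg 7, vertex⟩ σ' M'
        ⟨c, rd, fun j i' => nb j i' * 2 ^ k + i, fun j _ => X j⟩ := by
    intro σ' M' hl' h'
    refine hl'.den h'.below (fun j hj i' hi' => ?_) fun j hj i' _ => hl'.vertex_val hj i'
    simp [hl'.neighbor_val h'.r4 hj hi', thread_of_two_le, h'.r4, h'.r7]
  have inj : ∀ j < c, ∀ i' < rd j, ∀ d < 2 ^ k, ∀ w, ∀ d' < 2 ^ k, ∀ u < 2 ^ k,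
      addr (2 ^ k) (nb j i' * 2 ^ k + d) (X j) 0 = addr (2 ^ k) (w * 2 ^ k + d') u 0 →
      nb j i' = w ∧ d = d' ∧ X j = u := by
    intro j hj i' hi' d hd w d' hd' u hu he
    obtain ⟨e1, e2, -⟩ := addr_inj (hX j hj) (by omega) hu (by omega) he
    obtain ⟨e3, e4⟩ := mul_add_inj hd hd' e1
    exact ⟨e3, e4, e2⟩
  -- copy to the next level
  have d1 := den hl h 1 1 (by simp)
  obtain ⟨M₁, r₁, hb₁, hM₁, w₁, v₁⟩ := pfor_store (a := 6) hb hm.pow_le h.below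
    (len := .reg 11) (deg := .read 13 (.reg 0)) (cond := 1)
    (idx := addrE (neighbor * .reg 4 + .reg 7 + 1) vertex 0)
    (val := .read 6 (addrE (neighbor * .reg 4 + .reg 7) vertex 0)) (by decide)
    (cv := fun _ _ => True) (iv := fun j i' => addr (2 ^ k) (nb j i' * 2 ^ k + (i + 1)) (X j) 0)
    (vv := fun j i' => M (6, addr (2 ^ k) (nb j i' * 2 ^ k + i) (X j) 0))
    d1.len d1.len_le d1.deg d1.deg_le (by simp)
    (fun j hj i' hi' _ => by
      simp [hl.neighbor_val h.r4 hj hi', hl.vertex_val hj, s4, s7, add_assoc])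
    (fun j hj i' hi' _ => by simp [hl.neighbor_val h.r4 hj hi', hl.vertex_val hj, s4, s7])
    (fun j hj i' hi' j' hj' i'' hi'' _ _ he => by
      obtain ⟨e1, -, e2⟩ := inj j hj i' hi' _ hi _ _ hi _ (hX j' hj') he
      simp only [e1, e2])
    (by decide)
    (.inr fun j hj i' hi' j' hj' i'' hi'' _ hmem => by
      simp only [addrE, vertex, neighbor, Expr.reads_read, Expr.reads_add, Expr.reads_mul,
        Expr.reads_reg, Expr.reads_ofNat, Set.mem_insert_iff, Set.mem_union,
        Set.mem_empty_iff_false, Prod.mk.injEq, or_false, show (6 : ℕ) ≠ 9 by omega,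
        show (6 : ℕ) ≠ 14 by omega, false_and, true_and] at hmem
      have e := hl.neighbor_val h.r4 hj' hi''
      have e' := hl.vertex_val hj' i''
      simp only [neighbor, vertex, Expr.val_read, Expr.val_add, Expr.val_mul, Expr.val_reg,
        s4, thread_one, thread_zero] at e e'
      rw [e'] at e
      simp only [Expr.val_read, Expr.val_add, Expr.val_mul, Expr.val_reg, s4, s7, e, e', thread_one,
        thread_zero, Expr.val_ofNat] at hmem
      have := (inj j hj i' hi' (i + 1) hi (nb j' i'') i (by omega) _ (hX j' hj') hmem).2.1
      omega)
    (fun _ _ _ _ _ => h.below.mem _)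
  have h₁ := h.mem hb₁.mem
  have hl₁ : Loaded k σ M₁ c X rd nb := hl.congr rfl fun a i ha => hM₁ _ (by
    rcases ha with rfl | rfl | rfl <;> simp)
  -- clear the old level
  obtain ⟨M₂, r₂, hb₂, hM₂, w₂, v₂⟩ := pfor_store (a := 6) hb hm.pow_le hb₁
    (len := .reg 11) (deg := .read 13 (.reg 0)) (cond := 1)
    (idx := addrE (neighbor * .reg 4 + .reg 7) vertex 0) (val := 0) (by decide)
    (cv := fun _ _ => True) (iv := fun j i' => addr (2 ^ k) (nb j i' * 2 ^ k + i) (X j) 0)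
    (vv := fun _ _ => 0)
    (den0 hl₁ h₁).len d1.len_le (den0 hl₁ h₁).deg d1.deg_le (by simp)
    (fun j hj i' hi' _ => by simp [hl₁.neighbor_val h.r4 hj hi', hl₁.vertex_val hj, s4, s7])
    (by simp) (by simp) (by decide) (by simp) (by intros; omega)
  have h₂ := h.mem hb₂.mem
  have hl₂ : Loaded k σ M₂ c X rd nb := hl₁.congr rfl fun a i ha => hM₂ _ (by
    rcases ha with rfl | rfl | rfl <;> simp)
  have hc₂ : Consistent k 6 0 M₂ (fun r x => Items.Has ⟨c, rd, fun j i' => nb j i' * 2 ^ k + i + 1,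
      fun j _ => X j⟩ r x ∨ Items.Has ⟨c, rd, fun j i' => nb j i' * 2 ^ k + i, fun j _ => X j⟩ r x) := by
    have hc₁ := (hc.of_leaves hm.two_le_k (T := Items.Has ⟨c, rd,
      fun j i' => nb j i' * 2 ^ k + i + 1, fun j _ => X j⟩) (M' := M₁) fun i' hi' =>
      v₁ i' fun j hj i'' hi'' _ => hi' _ _ (hX j hj) ⟨j, hj, i'', hi'', rfl, rfl⟩)
    have := (hc₁.of_leaves hm.two_le_k (T := Items.Has ⟨c, rd,
      fun j i' => nb j i' * 2 ^ k + i, fun j _ => X j⟩) (M' := M₂) fun i' hi' =>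
      v₂ i' fun j hj i'' hi'' _ => hi' _ _ (hX j hj) ⟨j, hj, i'', hi'', rfl, rfl⟩)
    simpa only [false_or] using this
  -- recompute the inner nodes
  obtain ⟨M₃, r₃, hb₃, hM₃, w₃, -, c₃⟩ := treeUp_runs hm
    (F := ⟨.reg 11, .read 13 (.reg 0), neighbor * .reg 4 + .reg 7, vertex⟩) (by decide) (a := 6)
    (f := 0) (by omega) (by decide) hb₂ h.r4 h.r5 (den0 hl₂ h₂)
    (by rintro r x ⟨j, hj, i', hi', -, rfl⟩; exact hX j hj)
  have h₃ : Env b k n L e i (atHeight σ k) M₃ := (h.atHeight hm).mem hb₃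
  have hl₃ : Loaded k (atHeight σ k) M₃ c X rd nb := hl₂.congr
    (atHeight_of_ne _ _ (by omega) (by omega)) fun a i ha => hM₃ _ (by
      rcases ha with rfl | rfl | rfl <;> simp)
  obtain ⟨M₄, r₄, hb₄, hM₄, w₄, -, c₄⟩ := treeUp_runs hm
    (F := ⟨.reg 11, .read 13 (.reg 0), neighbor * .reg 4 + .reg 7 + 1, vertex⟩) (by decide) (a := 6)
    (f := 0) (by omega) (by decide) h₃.below h₃.r4 h₃.r5 (den hl₃ h₃ 1 1 (by simp))
    (by rintro r x ⟨j, hj, i', hi', -, rfl⟩; exact hX j hj)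
  have leaf : ∀ r, ∀ x < 2 ^ k, M₄ (6, addr (2 ^ k) r x 0) = M₂ (6, addr (2 ^ k) r x 0) :=
    fun r x hx => by rw [w₄ r x hx, w₃ r x hx]
  refine ⟨_, M₄, (r₁.seq (r₂.seq (r₃.seq r₄))).mono ?_ ?_, (h₃.atHeight hm).mem hb₄, ?_, ?_, ?_, ?_,
    ?_⟩
  · have : extent c rd ≤ (k + 1) * extent c rd := Nat.le_mul_of_pos_left _ (by omega)
    show 2006 * extent c rd + (2006 * extent c rd + (4000 * ((k + 1) * extent c rd) +
      4000 * ((k + 1) * extent c rd))) ≤ _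
    omega
  · omega
  · rw [atHeight_of_ne _ _ (by omega) (by omega), atHeight_of_ne _ _ (by omega) (by omega)]
  · intro p hp
    rw [hM₄ p hp, hM₃ p hp, hM₂ p hp, hM₁ p hp]
  · refine c₄ _ ?_
    simpa only [false_or] using c₃ _ hc₂
  · intro j hj i' hi'
    rw [leaf _ _ (hX j hj), leaf _ _ (hX j hj)]
    refine ⟨?_, w₂ j hj i' hi' trivial⟩
    rw [v₂, w₁ j hj i' hi' trivial]
    intro j' hj' i'' hi'' _ he
    have := (inj j hj i' hi' _ hi _ i (by omega) _ (hX j' hj') he).2.1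
    omega
  · intro w d hd u hu hn
    rw [leaf _ _ hu, v₂, v₁]
    · intro j hj i' hi' _ he
      obtain ⟨e1, e2, e3⟩ := inj j hj i' hi' _ hi _ _ hd _ hu he.symm
      exact (hn j hj i' hi' e3 e1).2 e2.symm
    · intro j hj i' hi' _ he
      obtain ⟨e1, e2, e3⟩ := inj j hj i' hi' i (by omega) _ _ hd _ hu he.symm
      exact (hn j hj i' hi' e3 e1).1 e2.symm

end

end WorkDepth

/-! ### Processing one level -/

namespace WorkDepth

/-- The number of out-neighbours that are stored for a vertex. -/
def outDegree (k : ℕ) (M : Mem) (u : ℕ) : ℕ := M (7, addr (2 ^ k) u 0 k)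

/-- `w` is stored as an out-neighbour of `u`. -/
def OutNeighbor (k : ℕ) (M : Mem) (u w : ℕ) : Prop :=
  ∃ j < outDegree k M u, M (9, u * (2 ^ k * 2 ^ k) + j) = w

/-- The leaf `u` of tree `w * K + d` in array `6` is marked if there is an edge from `u` to `w` and
`u` is at distance `d`; an inner node holds one of the marked leaves below it. -/
structure InTrees (k L : ℕ) (E : ℕ → ℕ → Prop) (M : Mem) : Prop where
  consistent : Consistent k 6 0 M fun _ _ => False
  marked : ∀ w < 2 ^ k, ∀ d ≤ L, ∀ u < 2 ^ k, E u w → M (4, u) = d + 1 →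
    M (6, addr (2 ^ k) (w * 2 ^ k + d) u 0) = u + 1
  unmarked : ∀ w < 2 ^ k, ∀ d ≤ L, ∀ u < 2 ^ k, ¬ (E u w ∧ M (4, u) = d + 1) →
    M (6, addr (2 ^ k) (w * 2 ^ k + d) u 0) = 0

/-- A marked leaf `u` holds `u + 1`, so `0` is free to mean absence and the root has the encoding of
a parent. -/
theorem InTrees.root {k L : ℕ} {E : ℕ → ℕ → Prop} {M : Mem} (h : InTrees k L E M)
    (hk : 2 ≤ k) {w d : ℕ} (hw : w < 2 ^ k) (hd : d ≤ L) (hE : ∀ u, E u w → u < 2 ^ k) :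
    (M (6, addr (2 ^ k) (w * 2 ^ k + d) 0 k) = 0 ∧ ∀ u, E u w → M (4, u) ≠ d + 1) ∨
      ∃ u, M (6, addr (2 ^ k) (w * 2 ^ k + d) 0 k) = u + 1 ∧ E u w ∧ M (4, u) = d + 1 := by
  have h2 : 2 ≤ 2 ^ k := Nat.le_self_pow (by omega) 2
  have key := node_witness (k := k) (T := fun y t => M (6, addr (2 ^ k) (w * 2 ^ k + d) y t))
    (fun t ht y hy => h.consistent _ y t ht hy fun _ hf => hf.elim)
    (fun x hx => by
      by_cases hm : E x w ∧ M (4, x) = d + 1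
      · rw [h.marked w hw d hd x hx hm.1 hm.2]; nlinarith
      · rw [h.unmarked w hw d hd x hx hm]; positivity)
    le_rfl (y := 0) (by simp)
  rcases key with ⟨h0, ha⟩ | ⟨x, hx, hx0, he⟩
  · refine .inl ⟨h0, fun u hu hM => ?_⟩
    have := ha u (by simp [hE u hu])
    rw [h.marked w hw d hd u (hE u hu) hu hM] at this
    omega
  · by_cases hm : E x w ∧ M (4, x) = d + 1
    · exact .inr ⟨x, by rw [he, h.marked w hw d hd x hx hm.1 hm.2], hm⟩
    · exact absurd (h.unmarked w hw d hd x hx hm) hx0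

/-- A possible parent of the vertex of the thread, plus `1`, or `0` if there is none. -/
def candidate : Expr := .read 6 (addrE (vertex * .reg 4 + (.reg 7 - 1)) 0 (.reg 5))

/-- Process level `i` in a deletion: the vertices of the queue that have this level and no
in-neighbour at level `i - 1` move to level `i + 1`, and their out-neighbours enter the next queue. -/
def deletePhase : Cmd :=
  .seq loadQueue
    (.seq (pfor (.reg 11) 1 1 13 (.reg 0) (.op .eq (.read 4 vertex) (.reg 7 + 1) *
        .op .eq candidate 0 * .read 7 (addrE vertex 0 (.reg 5))))
      (.seq (pfor (.reg 11) 1 (.op .eq (.read 4 vertex) (.reg 7 + 1)) 5 vertex candidate)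
        (.seq (pfor (.reg 11) (.read 13 (.reg 0)) 1 4 vertex ((.reg 7 + 2) * .op .lt (.reg 7) (.reg 3)))
          (.seq moveLeaves advance))))

open Classical in
/-- The number of out-neighbours that are treated for a vertex of the queue. -/
noncomputable def riseDegree (k i : ℕ) (M : Mem) (R : ℕ → ℕ) (v : ℕ) : ℕ :=
  if M (4, v) = i + 1 ∧ R v = 0 then outDegree k M v else 0

/-- The size of the next queue is charged to the threads that fill it. -/
theorem card_le_sum_of_neighbors {c : ℕ} {rd : ℕ → ℕ} {nb : ℕ → ℕ → ℕ} {Q : Finset ℕ}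
    (h : ∀ w, w ∈ Q → ∃ j < c, ∃ i < rd j, nb j i = w) :
    Q.card ≤ ∑ j ∈ Finset.range c, rd j := by
  classical
  have hs : Q ⊆ (Finset.range c).biUnion fun j => (Finset.range (rd j)).image (nb j) := by
    intro w hw
    obtain ⟨j, hj, i, hi, he⟩ := h w hw
    simp only [Finset.mem_biUnion, Finset.mem_range, Finset.mem_image]
    exact ⟨j, hj, i, hi, he⟩
  refine (Finset.card_le_card hs).trans (Finset.card_biUnion_le.trans ?_)
  exact Finset.sum_le_sum fun j _ => Finset.card_image_le.trans (by simp)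

-- Whether a vertex rises and which parent it gets are computed from the trees before any of them
-- changes. A rising vertex is recognized by a positive number of neighbours to be treated, whence
-- the hypothesis `hdeg`. At `i = L` its leaves move to the trees of level `L + 1`, about which
-- `InTrees` says nothing. For `i = 0` the subtraction in `i - 1` is truncated, so trees of level
-- `0` are inspected; in the deletion loop only the auxiliary vertex is queued then, and all its
-- trees are empty.
open Classical in
theorem deletePhase_runs {b B k n L e i : ℕ} (hm : Machine b B k) {σ : Regs} {M : Mem}
    (h : Env b k n L e i σ M) {Q : Finset ℕ} (hQ : Queue k e M Q) (hQn : ∀ v ∈ Q, v ≤ n)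
    (hn : n + 1 < 2 ^ k) (hL : L ≤ n) (hi : i ≤ L) (he : e + 1 < b) {E : ℕ → ℕ → Prop}
    (hT : InTrees k L E M) (hEA : ∀ u v, E u v → OutNeighbor k M u v)
    (hnb : ∀ u ≤ n, ∀ v, OutNeighbor k M u v → v ≤ n)
    (hdeg : ∀ v ∈ Q, M (4, v) = i + 1 → outDegree k M v ≠ 0)
    {R : ℕ → ℕ} (hR : R = fun v => M (6, addr (2 ^ k) (v * 2 ^ k + (i - 1)) 0 k)) :
    ∃ σ' M' Q', Runs B deletePhase σ M σ' M'
        (50000 * ((k + 1) * (1 + Q.card + ∑ v ∈ Q, riseDegree k i M R v))) (50000 * (k + 1)) ∧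
      Env b k n L (e + 1) (i + 1) σ' M' ∧ Queue k (e + 1) M' Q' ∧ InTrees k L E M' ∧
      (∀ a x, a ∈ [0, 1, 2, 3, 7, 9] → M' (a, x) = M (a, x)) ∧
      (∀ v, M' (4, v) = if Rises i (fun v => M (4, v)) R Q v then
        (if i < L then i + 2 else 0) else M (4, v)) ∧
      (∀ v, M' (5, v) = if v ∈ Q ∧ M (4, v) = i + 1 then R v else M (5, v)) ∧
      (∀ w, w ∈ Q' ↔ ∃ u, Rises i (fun v => M (4, v)) R Q u ∧ OutNeighbor k M u w) ∧
      Q'.card ≤ ∑ v ∈ Q, riseDegree k i M R v := by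
  have hlt := hm.lt
  have hb := hm.two_le
  have hKb := hm.K_lt
  set c := M (10, addr (2 ^ k) e 0 k) with hc
  set X : ℕ → ℕ := fun j => M (12, e * (2 ^ k * 2 ^ k) + j) with hX
  have hlist : Lists X c Q := hQ.lists
  set rd : ℕ → ℕ := fun j => riseDegree k i M R (X j) with hrd
  have hsum : ∑ j ∈ Finset.range c, rd j = ∑ v ∈ Q, riseDegree k i M R v :=
    hlist.sum (riseDegree k i M R)
  have hXn : ∀ j < c, X j ≤ n := fun j hj => hQn _ (hlist.mem hj)
  have hcb : c < b := h.below.mem _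
  set nb : ℕ → ℕ → ℕ := fun j i => M (9, X j * (2 ^ k * 2 ^ k) + i) with hnbdef
  -- load
  obtain ⟨M₁, r₁, h₁, hM₁, w₁⟩ := loadQueue_runs hm h hc.symm
  set σ₁ := Function.update σ 11 c with hσ₁
  have s11 : σ₁ 11 = c := by simp [σ₁]
  have s4 : ∀ j i, thread σ₁ j i 4 = 2 ^ k := fun j i => by
    rw [thread_of_two_le _ _ _ (by omega), h₁.r4]
  have s5 : ∀ j i, thread σ₁ j i 5 = k := fun j i => by
    rw [thread_of_two_le _ _ _ (by omega), h₁.r5]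
  have s7 : ∀ j i', thread σ₁ j i' 7 = i := fun j i => by
    rw [thread_of_two_le _ _ _ (by omega), h₁.r7]
  have vval : ∀ (M' : Mem), (∀ x, M' (14, x) = M₁ (14, x)) → ∀ j < c, ∀ i,
      vertex.val (thread σ₁ j i) M' = X j := by
    intro M' hM' j hj i
    simp only [vertex, Expr.val_read, Expr.val_reg, thread_zero, hM', w₁ j hj, X]
  have cval : ∀ (M' : Mem), (∀ x, M' (14, x) = M₁ (14, x)) → (∀ x, M' (6, x) = M (6, x)) →
      ∀ j < c, ∀ i', candidate.val (thread σ₁ j i') M' = R (X j) := by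
    intro M' hM' hM'' j hj i'
    simp only [candidate, Expr.val_read, addrE_val, Expr.val_add, Expr.val_mul, Expr.val_sub,
      Expr.val_reg, vval M' hM' j hj, s4, s5, s7, Expr.val_ofNat, hM'', hR]
  -- choose the vertices
  obtain ⟨M₂, r₂, hb₂, hM₂, w₂, -⟩ := pfor_store (a := 13) hb hm.pow_le h₁.below
    (len := .reg 11) (deg := 1) (cond := 1) (idx := .reg 0)
    (val := .op .eq (.read 4 vertex) (.reg 7 + 1) *
        .op .eq candidate 0 * .read 7 (addrE vertex 0 (.reg 5))) (by decide)
    (ln := c) (dg := fun _ => 1) (cv := fun _ _ => True) (iv := fun j _ => j)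
    (vv := fun j _ => rd j) s11 hcb.le (by simp) (by intros; omega) (by simp) (by simp)
    (fun j hj i' _ _ => by
      simp only [Expr.val_mul, Expr.val_eq, Expr.val_read, vval M₁ (fun _ => rfl) j hj,
        cval M₁ (fun _ => rfl) (fun x => hM₁ _ (by simp)) j hj, addrE_val, Expr.val_add,
        Expr.val_reg, Expr.val_ofNat, s4, s5, s7, hM₁ (4, _) (by simp), hM₁ (7, _) (by simp), rd,
        riseDegree, outDegree]
      by_cases h1 : M (4, X j) = i + 1 <;> by_cases h2 : R (X j) = 0 <;> simp [h1, h2])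
    (by rintro j - i - j' - i' - - - rfl; rfl) (by decide) (.inl (by decide))
    (fun j _ _ _ _ => by
      simp only [rd, riseDegree]
      split_ifs
      · exact h.below.mem _
      · omega)
  -- parents
  obtain ⟨M₃, r₃, hb₃, hM₃, w₃, v₃⟩ := pfor_store (a := 5) hb hm.pow_le hb₂
    (len := .reg 11) (deg := 1) (cond := .op .eq (.read 4 vertex) (.reg 7 + 1)) (idx := vertex)
    (val := candidate) (by decide)
    (ln := c) (dg := fun _ => 1) (cv := fun j _ => M (4, X j) = i + 1) (iv := fun j _ => X j)
    (vv := fun j _ => R (X j)) s11 hcb.le (by simp) (by intros; omega)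
    (fun j hj i' _ => by
      simp only [Expr.val_eq, Expr.val_read, vval M₂ (fun x => hM₂ _ (by simp)) j hj, Expr.val_add,
        Expr.val_reg, Expr.val_ofNat, s7, hM₂ (4, _) (by simp), hM₁ (4, _) (by simp)]
      split_ifs <;> simp_all)
    (fun j hj i' _ _ => vval M₂ (fun x => hM₂ _ (by simp)) j hj i')
    (fun j hj i' _ _ => cval M₂ (fun x => hM₂ _ (by simp))
      (fun x => by rw [hM₂ _ (by simp), hM₁ _ (by simp)]) j hj i')
    (by intro j _ i _ j' _ i' _ _ _ he; simp only [he])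
    (by decide) (.inl (by decide)) (fun j _ _ _ _ => by rw [hR]; exact h.below.mem _)
  have h₃ : Env b k n L e i σ₁ M₃ := h₁.mem hb₃.mem
  have l₃ : Loaded k σ₁ M₃ c X rd nb :=
    ⟨s11, fun j hj => by rw [hM₃ _ (by simp), hM₂ _ (by simp), w₁ j hj],
      fun j hj => by rw [hM₃ _ (by simp)]; exact w₂ j hj 0 (by omega) trivial,
      fun j hj i' _ => by rw [hM₃ _ (by simp), hM₂ _ (by simp), hM₁ _ (by simp)]⟩
  -- levels
  obtain ⟨M₄, r₄, h₄, hM₄, w₄, v₄⟩ := setLevels_runs hm h₃ l₃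
    (val := (.reg 7 + 2) * .op .lt (.reg 7) (.reg 3)) (d := if i < L then i + 2 else 0)
    (by decide) (fun j i' => by
      simp only [Expr.val_mul, Expr.val_add, Expr.val_reg, Expr.val_ofNat, Expr.val_lt, s7,
        thread_of_two_le σ₁ j i' (show 2 ≤ 3 by omega), h₁.r3]
      split_ifs <;> simp)
    (by split_ifs <;> omega) (by decide)
  have l₄ : Loaded k σ₁ M₄ c X rd nb := l₃.congr rfl fun a x ha => hM₄ _ (by
    rcases ha with rfl | rfl | rfl <;> simp)
  have e6 : ∀ x, M₄ (6, x) = M (6, x) := fun x => by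
    rw [hM₄ _ (by simp), hM₃ _ (by simp), hM₂ _ (by simp), hM₁ _ (by simp)]
  -- trees of in-neighbours
  obtain ⟨σ₅, M₅, r₅, h₅, s₅, hM₅, c₅, w₅, v₅⟩ := moveLeaves_runs hm h₄ l₄ (by omega)
    (fun j hj => by have := hXn j hj; omega)
    (fun r y t ht hy hq => by simpa only [e6] using hT.consistent r y t ht hy hq)
  have l₅ : Loaded k σ₅ M₅ c X rd nb := l₄.congr s₅ fun a x ha => hM₅ _ (by
    rcases ha with rfl | rfl | rfl <;> simp)
  have rises : ∀ j < c, rd j ≠ 0 ↔ Rises i (fun v => M (4, v)) R Q (X j) := by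
    intro j hj
    have hq := hlist.mem hj
    simp only [rd, riseDegree, Rises]
    split_ifs with h1
    · exact ⟨fun _ => ⟨hq, h1⟩, fun _ => hdeg _ hq h1.1⟩
    · exact ⟨fun h0 => absurd rfl h0, fun hr => absurd hr.2 h1⟩
  have nbr : ∀ w, (∃ j < c, ∃ i' < rd j, nb j i' = w) ↔
      ∃ u, Rises i (fun v => M (4, v)) R Q u ∧ OutNeighbor k M u w := by
    intro w
    constructor
    · rintro ⟨j, hj, i', hi', rfl⟩
      have hr := (rises j hj).1 (by omega)
      refine ⟨X j, hr, i', ?_, rfl⟩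
      simpa only [rd, riseDegree, if_pos hr.2] using hi'
    · rintro ⟨u, hu, i', hi', rfl⟩
      obtain ⟨j, hj, rfl⟩ := hlist.exists hu.1
      refine ⟨j, hj, i', ?_, rfl⟩
      simpa only [rd, riseDegree, if_pos hu.2] using hi'
  have nble : ∀ j < c, ∀ i' < rd j, nb j i' ≤ n := by
    intro j hj i' hi'
    have hr := (rises j hj).1 (by omega)
    refine hnb (X j) (hXn j hj) _ ⟨i', ?_, rfl⟩
    simpa only [rd, riseDegree, if_pos hr.2] using hi'
  -- the next queue
  obtain ⟨σ₆, M₆, r₆, h₆, hM₆, Q', hQ', hQ''⟩ := advance_runs hm h₅ l₅ he (by omega)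
    (fun j hj i' hi' => by have := nble j hj i' hi'; omega)
    (fun x hx => by
      rw [hM₅ _ (by simp), hM₄ _ (by simp), hM₃ _ (by simp), hM₂ _ (by simp), hM₁ _ (by simp),
        hQ.fresh x hx])
  have lev : ∀ v, M₆ (4, v) = if Rises i (fun v => M (4, v)) R Q v then
        (if i < L then i + 2 else 0) else M (4, v) := by
    intro v
    rw [hM₆ _ (by simp) (by simp) (by simp), hM₅ _ (by simp)]
    by_cases hr : Rises i (fun v => M (4, v)) R Q v
    · rw [if_pos hr]
      obtain ⟨j, hj, rfl⟩ := hlist.exists hr.1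
      exact w₄ j hj ((rises j hj).2 hr)
    · rw [if_neg hr, v₄, hM₃ _ (by simp), hM₂ _ (by simp), hM₁ _ (by simp)]
      rintro j hj h0 rfl
      exact hr ((rises j hj).1 h0)
  refine ⟨σ₆, M₆, Q', (r₁.seq (r₂.seq (r₃.seq (r₄.seq (r₅.seq r₆))))).mono ?_ ?_, h₆, hQ', ?_, ?_,
    lev, ?_, ?_, ?_⟩
  · have e1 : extent c rd = 1 + Q.card + ∑ v ∈ Q, riseDegree k i M R v := by
      unfold extent; rw [hsum, hlist.2]
    have e2 : extent c (fun _ => 1) ≤ 2 * extent c rd := by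
      simp only [extent, Finset.sum_const, Finset.card_range, smul_eq_mul, mul_one]; omega
    have e3 : 1 + c + c ≤ 2 * extent c rd := by unfold extent; omega
    have e4 : extent c rd ≤ (k + 1) * extent c rd := Nat.le_mul_of_pos_left _ (by omega)
    have e5 : 1 ≤ extent c rd := by unfold extent; omega
    rw [← e1]; omega
  · omega
  · refine ⟨fun r y t ht hy hq => ?_, fun w hw d hd u hu hEu h4 => ?_,
      fun w hw d hd u hu hEu => ?_⟩
    · simp only [hM₆ (6, _) (by simp) (by simp) (by simp)]
      exact c₅ r y t ht hy hq
    · rw [hM₆ _ (by simp) (by simp) (by simp)]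
      rw [lev] at h4
      by_cases hr : Rises i (fun v => M (4, v)) R Q u
      · rw [if_pos hr] at h4
        have hd' : d = i + 1 := by (split_ifs at h4; omega)
        obtain ⟨i', hi', hnw⟩ := hEA u w hEu
        obtain ⟨j, hj, rfl⟩ := hlist.exists hr.1
        have hi'' : i' < rd j := by simpa only [rd, riseDegree, if_pos hr.2] using hi'
        have := (w₅ j hj i' hi'').1
        have hnw' : nb j i' = w := hnw
        rw [hnw', ← hd', e6, hT.marked w hw i hi _ hu hEu hr.2.1] at this
        exact this
      · rw [if_neg hr] at h4
        rw [v₅ w d (by omega) u hu, e6, hT.marked w hw d hd u hu hEu h4]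
        rintro j hj i' hi' rfl
        exact absurd ((rises j hj).1 (by omega)) hr
    · rw [hM₆ _ (by simp) (by simp) (by simp)]
      rw [lev] at hEu
      by_cases hit : ∃ j < c, ∃ i' < rd j, X j = u ∧ nb j i' = w ∧ (d = i ∨ d = i + 1)
      · obtain ⟨j, hj, i', hi', rfl, rfl, rfl | rfl⟩ := hit
        · exact (w₅ j hj i' hi').2
        · have hr := (rises j hj).1 (by omega)
          rw [if_pos hr, if_pos (by omega)] at hEu
          rw [(w₅ j hj i' hi').1, e6, hT.unmarked _ hw i hi _ hu]
          exact fun hh => hEu ⟨hh.1, by omega⟩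
      · push Not at hit
        rw [v₅ w d (by omega) u hu fun j hj i' hi' e1 e2 => hit j hj i' hi' e1 e2, e6,
          hT.unmarked w hw d hd u hu]
        rintro ⟨hE1, hE2⟩
        by_cases hr : Rises i (fun v => M (4, v)) R Q u
        · obtain ⟨i', hi', hnw⟩ := hEA u w hE1
          obtain ⟨j, hj, rfl⟩ := hlist.exists hr.1
          have hi'' : i' < rd j := by simpa only [rd, riseDegree, if_pos hr.2] using hi'
          have := hr.2.1
          simp only at this
          exact (hit j hj i' hi'' rfl hnw).1 (by omega)
        · rw [if_neg hr] at hEu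
          exact hEu ⟨hE1, hE2⟩
  · intro a x ha
    simp only [List.mem_cons, List.not_mem_nil, or_false] at ha
    rw [hM₆, hM₅, hM₄, hM₃, hM₂, hM₁] <;> (simp only; omega)
  · intro v
    rw [hM₆ _ (by simp) (by simp) (by simp), hM₅ _ (by simp), hM₄ _ (by simp)]
    by_cases hv : v ∈ Q ∧ M (4, v) = i + 1
    · rw [if_pos hv]
      obtain ⟨j, hj, rfl⟩ := hlist.exists hv.1
      exact w₃ j hj 0 (by omega) hv.2
    · rw [if_neg hv, v₃, hM₂ _ (by simp), hM₁ _ (by simp)]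
      rintro j hj i' - h4 rfl
      exact hv ⟨hlist.mem hj, h4⟩
  · intro w
    rw [hQ'', nbr]
  · rw [← hsum]
    exact card_le_sum_of_neighbors fun w hw => (hQ'' w).1 hw

end WorkDepth

/-! ### Deletions -/

namespace WorkDepth

/-- Load the parameters and compute the height of the trees. -/
def setup : Cmd :=
  .seq (.assign 2 (.read 3 0)) (.seq (.assign 3 (.read 3 2)) (.seq (.assign 10 (.read 3 1))
    (.seq (.assign 6 (.read 3 3)) (.seq (.assign 4 1)
      (.while (.op .lt (.reg 4) (.reg 2 + 2))
        (.seq (.assign 4 (.reg 4 * 2)) (.assign 5 (.reg 5 + 1))))))))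

/-- The doubling stops at the first power of two that is at least `n + 2`. This leaves room for the
auxiliary vertex `n` and, as `L ≤ n`, for one row beyond level `L` among the trees of each vertex.
-/
theorem setup_runs {b B n s L e : ℕ} (hm : Machine b B (Nat.clog 2 (n + 2))) {M : Mem}
    (hM : ∀ p, M p < b) (h0 : M (3, 0) = n) (h1 : M (3, 1) = s) (h2 : M (3, 2) = L)
    (h3 : M (3, 3) = e) :
    ∃ σ, Runs B setup (fun _ => 0) M σ M (4000 * (Nat.clog 2 (n + 2) + 1))
        (4000 * (Nat.clog 2 (n + 2) + 1)) ∧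
      Env b (Nat.clog 2 (n + 2)) n L e 0 σ M ∧ σ 10 = s := by
  set k := Nat.clog 2 (n + 2) with hk
  have hb := hm.two_le
  have hB := hm.pow_le
  have hlt := hm.lt
  have hKb := hm.K_lt
  have b0 : Below b (fun _ => 0) M := ⟨fun _ => by omega, hM⟩
  have r1 : Runs B (.assign 2 (.read 3 0)) (fun _ => 0) M _ M 401 401 :=
    Runs.assign hb hB b0 2 (v := n) (by decide) (by simp [h0])
  have b1 := b0.update (x := 2) (v := n) (h0 ▸ hM _)
  have r2 : Runs B (.assign 3 (.read 3 2)) _ M _ M 401 401 :=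
    Runs.assign hb hB b1 3 (v := L) (by decide) (by simp [h2])
  have b2 := b1.update (x := 3) (v := L) (h2 ▸ hM _)
  have r3 : Runs B (.assign 10 (.read 3 1)) _ M _ M 401 401 :=
    Runs.assign hb hB b2 10 (v := s) (by decide) (by simp [h1])
  have b3 := b2.update (x := 10) (v := s) (h1 ▸ hM _)
  have r4 : Runs B (.assign 6 (.read 3 3)) _ M _ M 401 401 :=
    Runs.assign hb hB b3 6 (v := e) (by decide) (by simp [h3])
  have b4 := b3.update (x := 6) (v := e) (h3 ▸ hM _)
  have r5 : Runs B (.assign 4 1) _ M _ M 401 401 :=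
    Runs.assign hb hB b4 4 (v := 1) (by decide) (by simp)
  have b5 := b4.update (x := 4) (v := 1) (by omega)
  generalize hσ : (Function.update (Function.update (Function.update (Function.update
    (Function.update (fun _ => 0) 2 n) 3 L) 10 s) 6 e) 4 1 : Regs) = σ at r5 b5
  obtain ⟨t, ht, σ', M', w', ⟨rfl, c2, c3, c4, c5, c6, c7, c10, cb, cw⟩, hz, hr⟩ :=
    Runs.while_rule (w := 0) (t := 0) (T := k) (d := 802)
      (c := .seq (.assign 4 (.reg 4 * 2)) (.assign 5 (.reg 5 + 1)))
      hb hB (e := .op .lt (.reg 4) (.reg 2 + 2)) (by decide)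
      (fun t σ' M' w' => M' = M ∧ σ' 2 = n ∧ σ' 3 = L ∧ σ' 4 = 2 ^ t ∧ σ' 5 = t ∧ σ' 6 = e ∧
        σ' 7 = 0 ∧ σ' 10 = s ∧ Below b σ' M' ∧ w' ≤ t * 1203)
      (fun t σ' M' w' hh => hh.2.2.2.2.2.2.2.2.1)
      (by
        rintro σ' M' w' ⟨-, c2, -, c4, -⟩
        have : n + 2 ≤ 2 ^ k := Nat.le_pow_clog (by omega) _
        simp only [Expr.val_lt, Expr.val_reg, c4, c2, Expr.val_add, Expr.val_ofNat]
        rw [if_neg (by omega)])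
      (by
        rintro t ht σ' M' w' ⟨rfl, c2, c3, c4, c5, c6, c7, c10, cb, cw⟩ -
        have e1 : 2 ^ (t + 1) ≤ 2 ^ k := Nat.pow_le_pow_right (by omega) ht
        have q1 : Runs B (.assign 4 (.reg 4 * 2)) σ' M' _ M' 401 401 :=
          Runs.assign hb hB cb 4 (v := 2 ^ (t + 1)) (by decide) (by simp [c4, pow_succ])
        have cb1 := cb.update (x := 4) (v := 2 ^ (t + 1)) (by omega)
        have q2 : Runs B (.assign 5 (.reg 5 + 1)) _ M' _ M' 401 401 :=
          Runs.assign hb hB cb1 5 (v := t + 1) (by decide) (by simp [c5])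
        refine ⟨_, _, _, q1.seq q2, rfl, by simpa using c2, by simpa using c3, by simp, by simp,
          by simpa using c6, by simpa using c7, by simpa using c10, cb1.update (by omega), ?_⟩
        rw [add_mul]; omega)
      (by omega) (σ := σ) (M := M)
      ⟨rfl, by simp [← hσ], by simp [← hσ], by simp [← hσ], by simp [← hσ], by simp [← hσ],
        by simp [← hσ], by simp [← hσ], b5, by omega⟩
  have htk : t = k := by
    simp only [Expr.val_lt, Expr.val_reg, c4, c2, Expr.val_add, Expr.val_ofNat] at hz
    by_contra hne
    have : 2 ^ t < n + 2 := by
      by_contra hge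
      have := Nat.clog_le_of_le_pow (b := 2) (x := n + 2) (y := t) (by omega)
      omega
    rw [if_pos this] at hz
    omega
  subst htk
  refine ⟨σ', (r1.seq (r2.seq (r3.seq (r4.seq (r5.seq hr))))).mono ?_ ?_,
    ⟨cb, c2, c3, c4, c5, c6, c7⟩, c10⟩
  · omega
  · omega

/-- The number of levels by which a vertex has moved away from the source, for the amortization. -/
def height (L d : ℕ) : ℕ := if d = 0 then L + 2 else d

/-- The potential of the levels `D` of the vertices less than `n` with the degrees `dg`. -/
def potential (n L : ℕ) (dg D : ℕ → ℕ) : ℕ := ∑ v ∈ Finset.range n, dg v * height L (D v)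

theorem potential_le {n L : ℕ} {dg D : ℕ → ℕ} (h : ∀ v < n, D v ≤ L + 1) :
    potential n L dg D ≤ (∑ v ∈ Finset.range n, dg v) * (L + 2) := by
  rw [Finset.sum_mul]
  refine Finset.sum_le_sum fun v hv => Nat.mul_le_mul_left _ ?_
  have := h v (Finset.mem_range.1 hv)
  unfold height; split_ifs <;> omega

-- The work of a phase is expressed by the change of the potential: `f` counts the treated
-- neighbours and `g'` exceeds `g` by exactly that number. The auxiliary vertex is not part of the
-- potential and stands apart.
open Classical in
theorem sum_queue {n : ℕ} {Q : Finset ℕ} {f g g' : ℕ → ℕ} (hQ : ∀ v ∈ Q, v ≤ n)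
    (h : ∀ v < n, g' v = g v + if v ∈ Q then f v else 0) :
    ∑ v ∈ Q, f v + ∑ v ∈ Finset.range n, g v =
      (if n ∈ Q then f n else 0) + ∑ v ∈ Finset.range n, g' v := by
  have e1 : ∑ v ∈ Q, f v = ∑ v ∈ Finset.range (n + 1), if v ∈ Q then f v else 0 := by
    rw [← Finset.sum_filter]
    refine Finset.sum_congr (Finset.ext fun v => ?_) fun _ _ => rfl
    simp only [Finset.mem_filter, Finset.mem_range]
    exact ⟨fun hv => ⟨by have := hQ v hv; omega, hv⟩, fun hv => hv.2⟩
  have e2 : ∑ v ∈ Finset.range n, g' v =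
      ∑ v ∈ Finset.range n, g v + ∑ v ∈ Finset.range n, if v ∈ Q then f v else 0 := by
    rw [← Finset.sum_add_distrib]
    exact Finset.sum_congr rfl fun v hv => h v (Finset.mem_range.1 hv)
  rw [e1, e2, Finset.sum_range_succ]
  ring

theorem OutNeighbor.congr {k : ℕ} {M M' : Mem} (h7 : ∀ x, M' (7, x) = M (7, x))
    (h9 : ∀ x, M' (9, x) = M (9, x)) : OutNeighbor k M' = OutNeighbor k M := by
  funext u w
  simp only [OutNeighbor, outDegree, h7, h9]

open Classical in
/-- The loop of a deletion. -/
theorem deleteLoop_runs {b B k n s L e : ℕ} (hm : Machine b B k) {σ : Regs} {M : Mem}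
    (h : Env b k n L e 0 σ M) (hQ : Queue k e M {n}) (hs : s < n) (hn : n + 1 < 2 ^ k) (hL : L ≤ n)
    (he : e + L + 2 < b) {E : ℕ → ℕ → Prop} {Z : ℕ → Prop}
    (hE : ∀ u v, E u v → u < n ∧ v < n) (hT : InTrees k L E M)
    (hEA : ∀ u v, E u v → OutNeighbor k M u v) (hZ : ∀ v, Z v → OutNeighbor k M n v)
    (hnn : OutNeighbor k M n n) (hnb : ∀ u ≤ n, ∀ v, OutNeighbor k M u v → v ≤ n)
    (hP : Pending n s L E (OutNeighbor k M) Z 0 (fun v => M (4, v)) (fun v => M (5, v)) {n}) :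
    ∃ σ' M' w, Runs B (.while (.op .lt (.reg 7) (.reg 3 + 1)) deletePhase) σ M σ' M' (w + 401)
        ((L + 1) * (50401 * (k + 1)) + 401) ∧
      w + 50401 * (k + 1) * (2 * potential n L (outDegree k M) (fun v => M (4, v))) ≤
        50401 * (k + 1) * (2 + (L + 1) * (2 * outDegree k M n + 1) +
          2 * potential n L (outDegree k M) (fun v => M' (4, v))) ∧
      Env b k n L (e + L + 1) (L + 1) σ' M' ∧ InTrees k L E M' ∧
      (∀ a x, a ∈ [0, 1, 2, 3, 7, 9] → M' (a, x) = M (a, x)) ∧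
      (∀ i, (e + L + 2) * (2 ^ k * 2 ^ k) ≤ i → M' (10, i) = 0) ∧
      Certified n s L E (fun v => M' (4, v)) (fun v => M' (5, v)) := by
  set A := 50401 * (k + 1) with hA
  have hlt := hm.lt
  have hKb := hm.K_lt
  have hk2 := hm.two_le_k
  obtain ⟨t, ht, σ', M', w, ⟨Q, h1, h2, h3, h4, h5, h6⟩, hz, hr⟩ :=
    Runs.while_rule (w := 0) (t := 0) (T := L + 1) (d := 50000 * (k + 1))
      (c := deletePhase) hm.two_le hm.pow_le (e := .op .lt (.reg 7) (.reg 3 + 1)) (by decide)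
      -- The work so far and a charge `A` for each queued vertex are paid by `2 * outDegree k M n +
      -- 1` per round and by twice the gain of potential, each times `A`. The factor `2` is needed
      -- because a neighbour is paid for once when it is treated and once as a member of the next
      -- queue.
      (fun t σ' M' w => ∃ Q, Env b k n L (e + t) t σ' M' ∧ Queue k (e + t) M' Q ∧
        InTrees k L E M' ∧ (∀ a x, a ∈ [0, 1, 2, 3, 7, 9] → M' (a, x) = M (a, x)) ∧
        Pending n s L E (OutNeighbor k M) Z t (fun v => M' (4, v)) (fun v => M' (5, v)) Q ∧
        w + A * (Q.card + 2 * potential n L (outDegree k M) (fun v => M (4, v))) ≤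
          A * (2 + t * (2 * outDegree k M n + 1) +
            2 * potential n L (outDegree k M) (fun v => M' (4, v))))
      (fun t σ' M' w hh => by obtain ⟨Q, hh, -⟩ := hh; exact hh.below)
      (by
        rintro σ' M' w ⟨Q, hh, -⟩
        simp [hh.r7, hh.r3])
      (by
        rintro t ht σ' M' w ⟨Q, h1, h2, h3, h4, h5, h6⟩ -
        have o : OutNeighbor k M' = OutNeighbor k M :=
          OutNeighbor.congr (fun x => h4 7 x (by simp)) fun x => h4 9 x (by simp)
        have od : outDegree k M' = outDegree k M := by
          funext u; exact h4 7 _ (by simp)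
        -- No edge enters `n`, so its trees are empty, it never finds a parent and it rises in every
        -- round.
        have hRn : M' (6, addr (2 ^ k) (n * 2 ^ k + (t - 1)) 0 k) = 0 := by
          rcases h3.root hk2 (w := n) (d := t - 1) (by omega) (by omega)
            (fun u hu => by have := (hE u n hu).2; omega) with h7 | ⟨u, -, h7, -⟩
          · exact h7.1
          · have := (hE u n h7).2; omega
        obtain ⟨σ₁, M₁, Q₁, r, g1, g2, g3, g4, g5, g6, g7, g8⟩ := deletePhase_runs hm h1 h2 h5.mem_le
          hn hL (by omega) (by omega) h3 (by rw [o]; exact hEA) (by rw [o]; exact hnb)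
          (by
            intro v hv h4v
            have : OutNeighbor k M v v := by
              by_cases hvn : v = n
              · rw [hvn]; exact hnn
              · have := h5.mem_le v hv
                refine h5.self v (by omega) ?_
                have : t ≠ 0 := fun h0 => hvn (h5.mem_zero h0 v hv)
                show 2 ≤ M' (4, v)
                omega
            obtain ⟨j, hj, -⟩ := this
            rw [od]; omega)
          rfl
        have step := h5.step (by omega) hs hE hEA hZ hnn (fun u v hu => hnb u hu v)
          (R := fun v => M' (6, addr (2 ^ k) (v * 2 ^ k + (t - 1)) 0 k)) hRn
          (by
            intro v hv hvn hDv
            have : t ≠ 0 := fun h0 => by have := h5.mem_zero h0 v hv; omega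
            have := h3.root hk2 (w := v) (d := t - 1) (by omega) (by omega)
              (fun u hu => by have := (hE u v hu).1; omega)
            rwa [show t - 1 + 1 = t by omega] at this)
          g5 g6 (by rw [← o]; exact g7)
        refine ⟨σ₁, M₁, _, r, Q₁, g1, g2, g3, fun a x ha => by rw [g4 a x ha, h4 a x ha], step, ?_⟩
        have hsum := sum_queue (n := n) (Q := Q)
          (f := riseDegree k t M' (fun v => M' (6, addr (2 ^ k) (v * 2 ^ k + (t - 1)) 0 k)))
          (g := fun v => outDegree k M v * height L (M' (4, v)))
          (g' := fun v => outDegree k M v * height L (M₁ (4, v))) h5.mem_le (fun v hv => by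
            rw [g5]
            simp only [riseDegree, od]
            by_cases hvQ : v ∈ Q
            · by_cases hc : M' (4, v) = t + 1 ∧
                M' (6, addr (2 ^ k) (v * 2 ^ k + (t - 1)) 0 k) = 0
              · have hr : Rises t (fun v => M' (4, v))
                    (fun v => M' (6, addr (2 ^ k) (v * 2 ^ k + (t - 1)) 0 k)) Q v := ⟨hvQ, hc⟩
                rw [if_pos hr, if_pos hvQ, if_pos hc, hc.1, ← Nat.mul_succ]
                congr 1
                -- Leaving the tree from level `L` also gains exactly `1`, because `height` counts
                -- the stored value `0` as `L + 2`.
                by_cases htL : t < L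
                · simp only [if_pos htL, height, Nat.add_eq_zero_iff]
                  simp
                · simp only [if_neg htL, height]
                  rw [if_pos trivial, if_neg (by omega)]
                  omega
              · rw [if_neg fun hh => hc hh.2, if_pos hvQ, if_neg hc, add_zero]
            · rw [if_neg fun hh => hvQ hh.1, if_neg hvQ, add_zero])
        have hfn : riseDegree k t M' (fun v => M' (6, addr (2 ^ k) (v * 2 ^ k + (t - 1)) 0 k)) n =
            outDegree k M n := by
          have haux : M' (4, n) = if t ≤ L then t + 1 else 0 := h5.aux
          rw [riseDegree, if_pos ⟨by rw [haux, if_pos (by omega)], hRn⟩, od]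
        rw [if_pos h5.aux_mem, hfn] at hsum
        change _ + potential n L (outDegree k M) (fun v => M' (4, v)) =
          _ + potential n L (outDegree k M) (fun v => M₁ (4, v)) at hsum
        generalize potential n L (outDegree k M) (fun v => M₁ (4, v)) = Φ' at hsum ⊢
        generalize potential n L (outDegree k M) (fun v => M' (4, v)) = Φ at hsum h6
        generalize potential n L (outDegree k M) (fun v => M (4, v)) = Φ₀ at h6 ⊢
        generalize ∑ v ∈ Q, riseDegree k t M' (fun v => M' (6, addr (2 ^ k) (v * 2 ^ k + (t - 1)) 0 k)) v
          = S at hsum g8 ⊢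
        generalize outDegree k M n = z at hsum h6 ⊢
        have e1 : 50000 * ((k + 1) * (1 + Q.card + S)) + 401 ≤ A * (1 + Q.card + S) := by
          have : 1 ≤ (k + 1) * (1 + Q.card + S) := Nat.mul_pos (by omega) (by omega)
          have e : A * (1 + Q.card + S) = 50401 * ((k + 1) * (1 + Q.card + S)) := by
            rw [hA]; ring
          omega
        have e2 : A * (1 + Q.card + S) + A * (Q₁.card + 2 * Φ₀) ≤
            A * (Q.card + 2 * Φ₀) + A * (1 + 2 * S) := by
          rw [← mul_add, ← mul_add]; exact Nat.mul_le_mul_left _ (by omega)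
        have e3 : A * (2 + t * (2 * z + 1) + 2 * Φ) + A * (1 + 2 * S) =
            A * (2 + (t + 1) * (2 * z + 1) + 2 * Φ') := by
          rw [← mul_add, add_mul t]; congr 1; omega
        omega)
      (by omega) (σ := σ) (M := M)
      ⟨{n}, h, hQ, hT, fun _ _ _ => rfl, hP, by
        rw [zero_add]; refine Nat.mul_le_mul_left _ ?_; simp⟩
  have htL : t = L + 1 := by
    simp only [Expr.val_lt, Expr.val_reg, h1.r7, h1.r3, Expr.val_add, Expr.val_ofNat] at hz
    by_contra hne
    rw [if_pos (by omega)] at hz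
    omega
  subst htL
  refine ⟨σ', M', w, hr.mono le_rfl ?_, ?_, h1, h3, h4, h2.fresh, h5.certified⟩
  · rw [Nat.sub_zero]
    exact Nat.add_le_add_right (Nat.mul_le_mul_left _ (by omega)) _
  · rw [zero_add] at h6
    refine le_trans ?_ h6
    exact Nat.add_le_add_left (Nat.mul_le_mul_left _ (by omega)) _

end WorkDepth

/-! ### The procedure for deletions -/

namespace WorkDepth

/-- The source of the edge of a thread in the input. -/
def source : Expr := .read 1 (.reg 0)

/-- The target of the edge of a thread in the input. -/
def target : Expr := .read 2 (.reg 0)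

/-- Remove the edges of the input from the trees of in-neighbours. -/
def removeEdges : Cmd :=
  .seq (pfor (.read 0 0) 1 1 6 (addrE (target * .reg 4 + (.read 4 source - 1)) source 0) 0)
    (treeUp ⟨.read 0 0, 1, target * .reg 4 + (.read 4 source - 1), source⟩ 6 0)

theorem extent_one (c : ℕ) : extent c (fun _ => 1) = 1 + 2 * c := by
  simp only [extent, Finset.sum_const, Finset.card_range, smul_eq_mul, mul_one]; omega

/-- The leaf to be cleared lies in the tree for the current level of the source. If the source has
the stored level `0`, truncated subtraction leads to the tree of level `0`, where its leaf is empty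
anyway, so no case distinction is needed. Clearing an edge that is already absent is equally
harmless. -/
theorem removeEdges_runs {b B k n L e i len : ℕ} (hm : Machine b B k) {σ : Regs} {M : Mem}
    (h : Env b k n L e i σ M) {E : ℕ → ℕ → Prop} (hT : InTrees k L E M) (hlen : M (0, 0) = len)
    {bu bv : ℕ → ℕ} (hu : ∀ j < len, M (1, j) = bu j) (hv : ∀ j < len, M (2, j) = bv j)
    (hn : n < 2 ^ k) (hun : ∀ j < len, bu j < n) (hL : L + 1 < 2 ^ k)
    (hD : ∀ v < n, M (4, v) ≤ L + 1) :
    ∃ σ' M', Runs B removeEdges σ M σ' M' (8000 * ((k + 1) * (1 + 2 * len))) (8000 * (k + 1)) ∧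
      Env b k n L e i σ' M' ∧ (∀ p, p.1 ≠ 6 → M' p = M p) ∧
      InTrees k L (fun u v => E u v ∧ ¬ ∃ j < len, bu j = u ∧ bv j = v) M' := by
  have hb := hm.two_le
  have hlt := hm.lt
  have hKb := hm.K_lt
  have s4 : ∀ j i, thread σ j i 4 = 2 ^ k := fun j i => by
    rw [thread_of_two_le _ _ _ (by omega), h.r4]
  have lenb : len ≤ b := by rw [← hlen]; exact (h.below.mem _).le
  have den : Frame.Den b ⟨.read 0 0, 1, target * .reg 4 + (.read 4 source - 1), source⟩ σ M
      ⟨len, fun _ => 1, fun j _ => bv j * 2 ^ k + (M (4, bu j) - 1), fun j _ => bu j⟩ :=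
    ⟨by simp [hlen], lenb, by simp, by intros; simp only; omega,
      fun j hj i _ => by simp [target, source, hu j hj, hv j hj, s4],
      fun j hj i _ => by simp [source, hu j hj]⟩
  obtain ⟨M₁, r₁, hb₁, hM₁, w₁, v₁⟩ := pfor_store (a := 6) hb hm.pow_le h.below
    (len := .read 0 0) (deg := 1) (cond := 1)
    (idx := addrE (target * .reg 4 + (.read 4 source - 1)) source 0) (val := 0) (by decide)
    (cv := fun _ _ => True)
    (iv := fun j _ => addr (2 ^ k) (bv j * 2 ^ k + (M (4, bu j) - 1)) (bu j) 0)
    (vv := fun _ _ => 0)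
    den.len den.len_le den.deg den.deg_le (by simp)
    (fun j hj i _ _ => by simp [target, source, hu j hj, hv j hj, s4])
    (by simp) (by simp) (by decide) (by simp) (by intros; omega)
  have uK : ∀ j < len, bu j < 2 ^ k := fun j hj => (hun j hj).trans hn
  obtain ⟨M₂, r₂, hb₂, hM₂, w₂, -, c₂⟩ := treeUp_runs hm
    (F := ⟨.read 0 0, 1, target * .reg 4 + (.read 4 source - 1), source⟩) (by decide) (a := 6)
    (f := 0) (by omega) (by decide) hb₁ h.r4 h.r5
    (den.congr (fun _ _ => rfl) fun a ha i => hM₁ _ (by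
      rintro rfl; revert ha; decide))
    (by rintro r x ⟨j, hj, i', hi', -, rfl⟩; exact uK j hj)
  have hM : ∀ p, p.1 ≠ 6 → M₂ p = M p := fun p hp => by rw [hM₂ p hp, hM₁ p hp]
  have h4 : ∀ u, M₂ (4, u) = M (4, u) := fun u => hM _ (by simp)
  have inj : ∀ j < len, ∀ w, ∀ d < 2 ^ k, ∀ u < 2 ^ k,
      addr (2 ^ k) (w * 2 ^ k + d) u 0 =
        addr (2 ^ k) (bv j * 2 ^ k + (M (4, bu j) - 1)) (bu j) 0 →
      bv j = w ∧ d = M (4, bu j) - 1 ∧ bu j = u := by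
    intro j hj w d hd u hu he
    obtain ⟨e1, e2, -⟩ := addr_inj hu (by omega) (uK j hj) (by omega) he
    obtain ⟨e3, e4⟩ := mul_add_inj hd (by have := hD _ (hun j hj); omega) e1
    exact ⟨e3.symm, e4, e2.symm⟩
  refine ⟨_, M₂, (r₁.seq r₂).mono ?_ ?_, (h.atHeight hm).mem hb₂, hM, ⟨?_, ?_, ?_⟩⟩
  · have : extent len (fun _ => 1) ≤ (k + 1) * extent len (fun _ => 1) :=
      Nat.le_mul_of_pos_left _ (by omega)
    show 2006 * extent len (fun _ => 1) + 4000 * ((k + 1) * extent len (fun _ => 1)) ≤ _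
    rw [← extent_one]
    omega
  · omega
  · exact c₂ _ (hT.consistent.of_leaves hm.two_le_k fun i hi => v₁ i fun j hj i' hi' _ =>
      hi _ _ (uK j hj) ⟨j, hj, i', hi', rfl, rfl⟩)
  · rintro w hw d hd u hu ⟨hE, hne⟩ h1
    rw [h4] at h1
    rw [w₂ _ u hu, v₁, hT.marked w hw d hd u hu hE h1]
    intro j hj i' _ _ he
    obtain ⟨e1, -, e2⟩ := inj j hj w d (by omega) u hu he
    exact hne ⟨j, hj, e2, e1⟩
  · intro w hw d hd u hu hne
    rw [h4] at hne
    rw [w₂ _ u hu]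
    by_cases hx : ∃ j < len, bv j = w ∧ d = M (4, bu j) - 1 ∧ bu j = u
    · obtain ⟨j, hj, rfl, rfl, rfl⟩ := hx
      exact w₁ j hj 0 Nat.one_pos trivial
    · rw [v₁, hT.unmarked w hw d hd u hu]
      · rintro ⟨hE, h1⟩
        refine hne ⟨⟨hE, ?_⟩, h1⟩
        rintro ⟨j, hj, rfl, rfl⟩
        exact hx ⟨j, hj, rfl, by omega, rfl⟩
      · intro j hj i' _ _ he
        exact hx ⟨j, hj, inj j hj w d (by omega) u hu he⟩

/-- Make the auxiliary vertex `n` a vertex of level `0` with itself and the targets of the edges of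
the input as out-neighbours, and the only element of the queue. -/
def addVertex : Cmd :=
  .seq (pfor (.read 0 0) 1 1 9 (.reg 2 * .reg 4 * .reg 4 + .reg 0) target)
    (.seq (.store 9 (.reg 2 * .reg 4 * .reg 4 + .read 0 0) (.reg 2))
      (.seq (.store 7 (addrE (.reg 2) 0 (.reg 5)) (.read 0 0 + 1))
        (.seq (.store 4 (.reg 2) 1)
          (.seq (.store 12 (.reg 6 * .reg 4 * .reg 4) (.reg 2))
            (.store 10 (addrE (.reg 6) 0 (.reg 5)) 1)))))

/-- Row `n` of array `9` comes after the rows of all vertices. So the targets can be listed with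
repetitions and even beyond the length of a row, without damage to other lists; a new batch
overwrites the old list. -/
theorem addVertex_runs {b B k n L e i len : ℕ} (hm : Machine b B k) {σ : Regs} {M : Mem}
    (h : Env b k n L e i σ M) (hlen : M (0, 0) = len) (lenb : len + 1 < b)
    {bv : ℕ → ℕ} (hv : ∀ j < len, M (2, j) = bv j)
    (hfresh : ∀ i, e * (2 ^ k * 2 ^ k) ≤ i → M (10, i) = 0) :
    ∃ M', Runs B addVertex σ M σ M' (2006 * (1 + 2 * len) + 4015) 6021 ∧
      Env b k n L e i σ M' ∧ (∀ a x, a ∈ [0, 1, 2, 3, 5, 6] → M' (a, x) = M (a, x)) ∧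
      Queue k e M' {n} ∧ (∀ x, M' (4, x) = if x = n then 1 else M (4, x)) ∧
      (∀ u, outDegree k M' u = if u = n then len + 1 else outDegree k M u) ∧
      (∀ x < n * (2 ^ k * 2 ^ k), M' (9, x) = M (9, x)) ∧
      (∀ j < len, M' (9, n * (2 ^ k * 2 ^ k) + j) = bv j) ∧
      M' (9, n * (2 ^ k * 2 ^ k) + len) = n := by
  have hb := hm.two_le
  have hB := hm.pow_le
  have hlt := hm.lt
  have hnb : n < b := by rw [← h.r2]; exact h.below.regs _
  have s4 : ∀ j i, thread σ j i 4 = 2 ^ k := fun j i => by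
    rw [thread_of_two_le _ _ _ (by omega), h.r4]
  have s2 : ∀ j i, thread σ j i 2 = n := fun j i => by
    rw [thread_of_two_le _ _ _ (by omega), h.r2]
  obtain ⟨M₁, r₁, b₁, hM₁, w₁, v₁⟩ := pfor_store (a := 9) hb hm.pow_le h.below
    (len := .read 0 0) (deg := 1) (cond := 1)
    (idx := .reg 2 * .reg 4 * .reg 4 + .reg 0) (val := target) (by decide)
    (ln := len) (dg := fun _ => 1) (cv := fun _ _ => True)
    (iv := fun j _ => n * (2 ^ k * 2 ^ k) + j)
    (vv := fun j _ => bv j)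
    (by simp [hlen]) (by omega) (by simp) (by intros; omega) (by simp)
    (fun j hj i _ _ => by simp [s2, s4, mul_assoc])
    (fun j hj i _ _ => by simp [target, hv j hj])
    (by intro j _ i _ j' _ i' _ _ _ he; obtain rfl : j = j' := Nat.add_left_cancel he
        rfl)
    (by decide) (.inl (by decide)) (fun j hj _ _ _ => by rw [← hv j hj]; exact h.below.mem _)
  have l₁ : M₁ (0, 0) = len := by rw [hM₁ _ (by simp), hlen]
  have r₂ : Runs B (.store 9 (.reg 2 * .reg 4 * .reg 4 + .read 0 0) (.reg 2)) σ M₁ σ _ 803 803 :=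
    Runs.store hb hB b₁ 9 (iv := n * (2 ^ k * 2 ^ k) + len) (v := n) (by decide)
      (by decide) (by simp [h.r2, h.r4, l₁, mul_assoc]) (by simp [h.r2])
  have b₂ := b₁.store (p := (9, n * (2 ^ k * 2 ^ k) + len)) hnb
  generalize hM₂ : Function.update M₁ (9, n * (2 ^ k * 2 ^ k) + len) n = M₂ at r₂ b₂
  have l₂ : M₂ (0, 0) = len := by rw [← hM₂]; simp [Function.update, l₁]
  have r₃ : Runs B (.store 7 (addrE (.reg 2) 0 (.reg 5)) (.read 0 0 + 1)) σ M₂ σ _ 803 803 :=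
    Runs.store hb hB b₂ 7 (iv := addr (2 ^ k) n 0 k) (v := len + 1) (by decide)
      (by decide) (by simp [h.r2, h.r4, h.r5]) (by simp [l₂])
  have b₃ := b₂.store (p := (7, addr (2 ^ k) n 0 k)) lenb
  generalize hM₃ : Function.update M₂ (7, addr (2 ^ k) n 0 k) (len + 1) = M₃ at r₃ b₃
  have r₄ : Runs B (.store 4 (.reg 2) 1) σ M₃ σ _ 803 803 :=
    Runs.store hb hB b₃ 4 (iv := n) (v := 1) (by decide) (by decide) (by simp [h.r2]) (by simp)
  have b₄ := b₃.store (p := (4, n)) (v := 1) (by omega)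
  generalize hM₄ : Function.update M₃ (4, n) 1 = M₄ at r₄ b₄
  have r₅ : Runs B (.store 12 (.reg 6 * .reg 4 * .reg 4) (.reg 2)) σ M₄ σ _ 803 803 :=
    Runs.store hb hB b₄ 12 (iv := e * (2 ^ k * 2 ^ k)) (v := n) (by decide)
      (by decide) (by simp [h.r6, h.r4, mul_assoc]) (by simp [h.r2])
  have b₅ := b₄.store (p := (12, e * (2 ^ k * 2 ^ k))) hnb
  generalize hM₅ : Function.update M₄ (12, e * (2 ^ k * 2 ^ k)) n = M₅ at r₅ b₅
  have r₆ : Runs B (.store 10 (addrE (.reg 6) 0 (.reg 5)) 1) σ M₅ σ _ 803 803 :=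
    Runs.store hb hB b₅ 10 (iv := addr (2 ^ k) e 0 k) (v := 1) (by decide)
      (by decide) (by simp [h.r6, h.r4, h.r5]) (by simp)
  have b₆ := b₅.store (p := (10, addr (2 ^ k) e 0 k)) (v := 1) (by omega)
  generalize hM₆ : Function.update M₅ (10, addr (2 ^ k) e 0 k) 1 = M₆ at r₆ b₆
  have hM' : ∀ a x, M₆ (a, x) =
      if a = 10 ∧ x = addr (2 ^ k) e 0 k then 1 else
      if a = 12 ∧ x = e * (2 ^ k * 2 ^ k) then n else
      if a = 4 ∧ x = n then 1 else
      if a = 7 ∧ x = addr (2 ^ k) n 0 k then len + 1 else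
      if a = 9 ∧ x = n * (2 ^ k * 2 ^ k) + len then n else M₁ (a, x) := by
    intro a x
    simp only [← hM₆, ← hM₅, ← hM₄, ← hM₃, ← hM₂, Function.update_apply, Prod.mk.injEq]
  refine ⟨M₆, (r₁.seq (r₂.seq (r₃.seq (r₄.seq (r₅.seq r₆))))).mono ?_ ?_, h.mem b₆.mem, ?_,
    ⟨⟨?_, ?_⟩, ?_⟩, ?_, ?_, ?_, ?_, ?_⟩
  · rw [extent_one]
  · omega
  · intro a x ha
    simp only [List.mem_cons, List.not_mem_nil, or_false] at ha
    rw [hM', if_neg (by omega), if_neg (by omega), if_neg (by omega), if_neg (by omega),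
      if_neg (by omega), hM₁ _ (by simp only; omega)]
  · rw [hM']; simp [hM']
  · rw [hM']; simp
  · intro i hi
    have ha : addr (2 ^ k) e 0 k < (e + 1) * (2 ^ k * 2 ^ k) := by
      unfold addr; rw [add_zero, mul_assoc, add_mul]; nlinarith
    rw [hM', if_neg (by rintro ⟨-, rfl⟩; exact absurd hi (not_le.2 ha)), if_neg (by omega),
      if_neg (by omega), if_neg (by omega), if_neg (by omega), hM₁ _ (by simp),
      hfresh i (le_trans (Nat.mul_le_mul_right _ (by omega)) hi)]
  · intro x
    rw [hM']; simp [hM₁ (4, x) (by simp)]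
  · intro u
    simp only [outDegree]
    rw [hM']
    have : addr (2 ^ k) u 0 k = addr (2 ^ k) n 0 k ↔ u = n :=
      ⟨fun he => (addr_inj (by omega) hlt (by omega) hlt he).1, fun he => by rw [he]⟩
    simp [this, hM₁ (7, _) (by simp)]
  · intro x hx
    rw [hM', if_neg (by omega), if_neg (by omega), if_neg (by omega), if_neg (by omega),
      if_neg (by omega), v₁]
    intro j hj i _ _; omega
  · intro j hj
    rw [hM', if_neg (by omega), if_neg (by omega), if_neg (by omega), if_neg (by omega),
      if_neg (by omega)]
    exact w₁ j hj 0 (by omega) trivial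
  · rw [hM']; simp

/-- The memory between two batches, when `e` epochs are over and the graph `E₀` of the
initialization, with the out-degrees `dg` in the stored lists, has become `E`. -/
structure State (b k n s L e : ℕ) (dg : ℕ → ℕ) (E₀ E : ℕ → ℕ → Prop) (M : Mem) : Prop where
  lt : ∀ p, M p < b
  n_eq : M (3, 0) = n
  s_eq : M (3, 1) = s
  L_eq : M (3, 2) = L
  e_eq : M (3, 3) = e
  certified : Certified n s L E (fun v => M (4, v)) (fun v => M (5, v))
  trees : InTrees k L E M
  subset : ∀ u v, E u v → E₀ u v
  out : ∀ u v, E₀ u v → OutNeighbor k M u v ∧ OutNeighbor k M v v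
  range : ∀ u < n, ∀ v, OutNeighbor k M u v → v < n
  degree : ∀ u < n, outDegree k M u = dg u
  fresh : ∀ i, e * (2 ^ k * 2 ^ k) ≤ i → M (10, i) = 0

/-- The procedure that processes a batch of deletions. -/
def delete : Cmd :=
  .seq setup (.seq removeEdges (.seq addVertex
    (.seq (.while (.op .lt (.reg 7) (.reg 3 + 1)) deletePhase) (.store 3 3 (.reg 6 + 1)))))

/-- Removing edges keeps the edge condition. A vertex whose parent edge is removed is a target of
the batch and has a stored level of at least `2`, so the state is `Pending` at level `0`. The loop
uses the queue rows `e` to `e + L + 1`, hence the next batch starts at `e + L + 2`. -/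
theorem delete_runs {b B n s L e len : ℕ} (hm : Machine b B (Nat.clog 2 (n + 2))) {M : Mem}
    {dg : ℕ → ℕ} {E₀ E : ℕ → ℕ → Prop} (hE₀ : ∀ u v, E₀ u v → u < n ∧ v < n)
    (hS : State b (Nat.clog 2 (n + 2)) n s L e dg E₀ E M) (hs : s < n) (hL : L ≤ n)
    (hdg : ∀ u < n, dg u ≤ 2 ^ Nat.clog 2 (n + 2) * 2 ^ Nat.clog 2 (n + 2))
    (he : e + L + 2 < b) (lenb : len + 1 < b) (hlen : M (0, 0) = len)
    {bu bv : ℕ → ℕ} (hu : ∀ j < len, M (1, j) = bu j) (hv : ∀ j < len, M (2, j) = bv j)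
    (hbatch : ∀ j < len, E₀ (bu j) (bv j)) :
    ∃ σ' M' w, Runs B delete (fun _ => 0) M σ' M' w
        (70000 * ((L + 1) * (Nat.clog 2 (n + 2) + 1))) ∧
      State b (Nat.clog 2 (n + 2)) n s L (e + L + 2) dg E₀
        (fun u v => E u v ∧ ¬ ∃ j < len, bu j = u ∧ bv j = v) M' ∧
      w + 50401 * (Nat.clog 2 (n + 2) + 1) * (2 * potential n L dg (fun v => M (4, v))) ≤
        50401 * (Nat.clog 2 (n + 2) + 1) * (6 * ((L + 1) * (len + 1)) +
          2 * potential n L dg (fun v => M' (4, v))) := by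
  set k := Nat.clog 2 (n + 2) with hk
  have hnK : n + 2 ≤ 2 ^ k := Nat.le_pow_clog (by omega) _
  have hlt := hm.lt
  have hc := hS.certified
  obtain ⟨σ₁, r₁, h₁, -⟩ := setup_runs hm hS.lt hS.n_eq hS.s_eq hS.L_eq hS.e_eq
  rw [← hk] at r₁ h₁
  obtain ⟨σ₂, M₂, r₂, h₂, hM₂, t₂⟩ := removeEdges_runs hm h₁ hS.trees hlen hu hv (by omega)
    (fun j hj => (hE₀ _ _ (hbatch j hj)).1) (by omega) hc.le
  set E' : ℕ → ℕ → Prop := fun u v => E u v ∧ ¬ ∃ j < len, bu j = u ∧ bv j = v with hE'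
  have hE'n : ∀ u v, E' u v → u < n ∧ v < n := fun u v h => hE₀ u v (hS.subset u v h.1)
  obtain ⟨M₃, r₃, h₃, hM₃, q₃, lev, deg, nb₁, nb₂, nb₃⟩ := addVertex_runs (len := len) (bv := bv)
    hm h₂ (by rw [hM₂ _ (by simp), hlen]) lenb (fun j hj => by rw [hM₂ _ (by simp), hv j hj])
    (fun i hi => by rw [hM₂ _ (by simp), hS.fresh i hi])
  have lev' : ∀ v < n, M₃ (4, v) = M (4, v) := fun v hv => by
    rw [lev, if_neg hv.ne, hM₂ _ (by simp)]
  have deg' : ∀ u < n, outDegree k M₃ u = dg u := fun u hu => by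
    rw [deg, if_neg hu.ne, ← hS.degree u hu, outDegree, hM₂ _ (by simp), outDegree]
  have degn : outDegree k M₃ n = len + 1 := by rw [deg, if_pos rfl]
  have nbr : ∀ u < n, ∀ v, OutNeighbor k M₃ u v ↔ OutNeighbor k M u v := by
    intro u hu v
    simp only [OutNeighbor, deg' u hu, hS.degree u hu]
    have : ∀ j < dg u, M₃ (9, u * (2 ^ k * 2 ^ k) + j) = M (9, u * (2 ^ k * 2 ^ k) + j) := by
      intro j hj
      rw [nb₁, hM₂ _ (by simp)]
      have h1 := hdg u hu
      have h2 : (u + 1) * (2 ^ k * 2 ^ k) ≤ n * (2 ^ k * 2 ^ k) := Nat.mul_le_mul_right _ hu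
      rw [add_mul] at h2
      omega
    exact ⟨fun ⟨j, hj, h⟩ => ⟨j, hj, this j hj ▸ h⟩, fun ⟨j, hj, h⟩ => ⟨j, hj, (this j hj).symm ▸ h⟩⟩
  have nbn : ∀ v, OutNeighbor k M₃ n v ↔ v = n ∨ ∃ j < len, bv j = v := by
    intro v
    simp only [OutNeighbor, degn]
    constructor
    · rintro ⟨j, hj, h⟩
      rcases Nat.lt_succ_iff_lt_or_eq.1 hj with hj | rfl
      · exact .inr ⟨j, hj, by rw [← h, nb₂ j hj]⟩
      · exact .inl (by rw [← h, nb₃])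
    · rintro (rfl | ⟨j, hj, h⟩)
      · exact ⟨len, by omega, nb₃⟩
      · exact ⟨j, by omega, by rw [nb₂ j hj, h]⟩
  have t₃ : InTrees k L E' M₃ := by
    refine ⟨fun r y t ht hy hq => ?_, fun w hw d hd u hu hE h4 => ?_, fun w hw d hd u hu h4 => ?_⟩
    · simp only [hM₃ 6 _ (by simp)]
      exact t₂.consistent r y t ht hy hq
    · rw [lev' u (hE'n u w hE).1] at h4
      rw [hM₃ 6 _ (by simp)]
      exact t₂.marked w hw d hd u hu hE (by rw [hM₂ _ (by simp), h4])
    · rw [hM₃ 6 _ (by simp)]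
      refine t₂.unmarked w hw d hd u hu fun hh => h4 ⟨hh.1, ?_⟩
      rw [lev' u (hE'n u w hh.1).1, ← hM₂ _ (by simp), hh.2]
  have out : ∀ u v, E₀ u v → OutNeighbor k M₃ u v ∧ OutNeighbor k M₃ v v := fun u v h => by
    rw [nbr u (hE₀ u v h).1, nbr v (hE₀ u v h).2]; exact hS.out u v h
  have par : ∀ v < n, M₃ (5, v) = M (5, v) := fun v _ => by
    rw [hM₃ 5 _ (by simp), hM₂ _ (by simp)]
  have pend : Pending n s L E' (OutNeighbor k M₃) (fun v => ∃ j < len, bv j = v) 0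
      (fun v => M₃ (4, v)) (fun v => M₃ (5, v)) {n} := by
    have parent : ∀ v < n, 2 ≤ M (4, v) →
        ∃ u, M (5, v) = u + 1 ∧ E u v ∧ M (4, u) + 1 = M (4, v) := hc.parent
    refine ⟨(lev' s hs).trans hc.root, fun v hv h => hc.eq_root v hv ((lev' v hv).symm.trans h),
      fun v hv => (lev' v hv).trans_le (hc.le v hv),
      fun v hv h => (par v hv).trans (hc.orphan v hv ((lev' v hv).symm.trans_le h)),
      fun u v h => ?_, fun v hv h => ?_, fun v hv h => ?_, ?_, by simp, by simp, by simp⟩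
    · have := hE'n u v h
      simp only [lev' u this.1, lev' v this.2]
      exact hc.edge u v h.1
    · simp only [lev' v hv, par v hv] at h ⊢
      obtain ⟨u, e1, e2, e3⟩ := parent v hv h
      by_cases hd : ∃ j < len, bu j = u ∧ bv j = v
      · obtain ⟨j, hj, -, e4⟩ := hd
        exact .inr (.inr ⟨by omega, j, hj, e4⟩)
      · refine .inl ⟨u, e1, ⟨e2, hd⟩, ?_⟩
        rw [lev' u (hE₀ u v (hS.subset u v e2)).1, e3]
    · simp only [lev' v hv] at h
      obtain ⟨u, -, e2, -⟩ := parent v hv h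
      exact (out u v (hS.subset u v e2)).2
    · simp [lev n]
  obtain ⟨σ₄, M₄, w, r₄, hw, h₄, t₄, hM₄, fresh, cert⟩ := deleteLoop_runs hm h₃ q₃ hs (by omega) hL
    he hE'n t₃ (fun u v h => (out u v (hS.subset u v h.1)).1)
    (fun v ⟨j, hj, h⟩ => (nbn v).2 (.inr ⟨j, hj, h⟩)) ((nbn n).2 (.inl rfl))
    (by
      intro u hu v h
      rcases hu.lt_or_eq with hu | rfl
      · exact (hS.range u hu v ((nbr u hu v).1 h)).le
      · rcases (nbn v).1 h with rfl | ⟨j, hj, rfl⟩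
        · exact le_rfl
        · exact (hE₀ _ _ (hbatch j hj)).2.le)
    pend
  have r₅ : Runs B (.store 3 3 (.reg 6 + 1)) σ₄ M₄ σ₄ _ 803 803 :=
    Runs.store hm.two_le hm.pow_le h₄.below 3 (iv := 3) (v := e + L + 2) (by decide) (by decide)
      (by simp) (by simp [h₄.r6])
  have b₅ := h₄.below.store (p := (3, 3)) he
  have hM₅ : ∀ a x, a ≠ 3 ∨ x ≠ 3 → Function.update M₄ (3, 3) (e + L + 2) (a, x) = M₄ (a, x) := by
    intro a x hax
    rw [Function.update_apply, if_neg]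
    rintro ⟨⟩
    simp at hax
  generalize hM₅' : Function.update M₄ (3, 3) (e + L + 2) = M₅ at r₅ b₅ hM₅
  have o : OutNeighbor k M₅ = OutNeighbor k M₃ :=
    OutNeighbor.congr (fun x => by rw [hM₅ _ _ (by simp), hM₄ 7 x (by simp)])
      fun x => by rw [hM₅ _ _ (by simp), hM₄ 9 x (by simp)]
  have od : outDegree k M₅ = outDegree k M₃ := by
    funext u; simp only [outDegree]; rw [hM₅ _ _ (by simp), hM₄ 7 _ (by simp)]
  have p3 : ∀ x, x ≠ 3 → M₅ (3, x) = M (3, x) := fun x hx => by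
    rw [hM₅ _ _ (.inr hx), hM₄ 3 x (by simp), hM₃ 3 x (by simp), hM₂ _ (by simp)]
  have pot : ∀ D D' : ℕ → ℕ, (∀ v < n, D v = D' v) →
      potential n L (outDegree k M₃) D = potential n L dg D' := fun D D' hD =>
    Finset.sum_congr rfl fun v hv => by
      rw [deg' v (Finset.mem_range.1 hv), hD v (Finset.mem_range.1 hv)]
  refine ⟨σ₄, M₅, _, (r₁.seq (r₂.seq (r₃.seq (r₄.seq r₅)))).mono le_rfl ?_, ?_, ?_⟩
  · have : k + 1 ≤ (L + 1) * (k + 1) := Nat.le_mul_of_pos_left _ (by omega)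
    have e : (L + 1) * (50401 * (k + 1)) = 50401 * ((L + 1) * (k + 1)) := by ring
    omega
  · refine ⟨b₅.mem, (p3 0 (by omega)).trans hS.n_eq, (p3 1 (by omega)).trans hS.s_eq,
      (p3 2 (by omega)).trans hS.L_eq, by simp [← hM₅'], ?_, ?_, fun u v h => hS.subset u v h.1, ?_,
      ?_, ?_, ?_⟩
    · simpa only [hM₅ 4 _ (.inl (by omega)), hM₅ 5 _ (.inl (by omega))] using cert
    · refine ⟨fun r y t ht hy hq => ?_, fun w hw d hd u hu hE h4 => ?_, fun w hw d hd u hu h4 => ?_⟩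
      · simp only [hM₅ 6 _ (.inl (by omega))]
        exact t₄.consistent r y t ht hy hq
      · rw [hM₅ _ _ (by simp)] at h4 ⊢
        exact t₄.marked w hw d hd u hu hE h4
      · rw [hM₅ _ _ (by simp)] at h4 ⊢
        exact t₄.unmarked w hw d hd u hu h4
    · rw [o]; exact out
    · intro u hu v h
      rw [o, nbr u hu] at h
      exact hS.range u hu v h
    · intro u hu; rw [od]; exact deg' u hu
    · intro i hi; rw [hM₅ _ _ (by simp)]; exact fresh i hi
  · rw [pot _ (fun v => M (4, v)) lev', pot _ (fun v => M₅ (4, v)) fun v _ => (hM₅ _ _ (by simp)).symm,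
      degn] at hw
    set A := 50401 * (k + 1) with hA
    generalize potential n L dg (fun v => M₅ (4, v)) = Φ' at hw ⊢
    generalize potential n L dg (fun v => M (4, v)) = Φ at hw ⊢
    have e1 : 4000 * (k + 1) + (8000 * ((k + 1) * (1 + 2 * len)) +
        (2006 * (1 + 2 * len) + 4015 + (401 + 803))) ≤ A * (len + 1) := by
      have e : (k + 1) * (1 + 2 * len) ≤ 2 * ((k + 1) * (len + 1)) := by
        rw [mul_left_comm]; exact Nat.mul_le_mul_left _ (by omega)
      have e' : k + 1 ≤ (k + 1) * (len + 1) := Nat.le_mul_of_pos_right _ (by omega)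
      have e'' : len + 1 ≤ (k + 1) * (len + 1) := Nat.le_mul_of_pos_left _ (by omega)
      rw [hA, mul_assoc]; omega
    have e2 : A * (2 + (L + 1) * (2 * (len + 1) + 1) + 2 * Φ') + A * (len + 1) ≤
        A * (6 * ((L + 1) * (len + 1)) + 2 * Φ') := by
      rw [← mul_add]; refine Nat.mul_le_mul_left _ ?_
      have : len + 1 ≤ (L + 1) * (len + 1) := Nat.le_mul_of_pos_left _ (by omega)
      have : (L + 1) * (2 * (len + 1) + 1) = 2 * ((L + 1) * (len + 1)) + (L + 1) := by ring
      have : L + 1 ≤ (L + 1) * (len + 1) := Nat.le_mul_of_pos_right _ (by omega)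
      omega
    linarith

end WorkDepth

/-! ### The initialization -/

namespace WorkDepth

/-- Level `i` of a breadth-first search: the vertices of the queue without a level get the level
`i`, and their out-neighbours enter the next queue. -/
def searchPhase : Cmd :=
  .seq loadQueue
    (.seq (pfor (.reg 11) 1 1 13 (.reg 0)
        (.op .eq (.read 4 vertex) 0 * .read 7 (addrE vertex 0 (.reg 5))))
      (.seq (pfor (.reg 11) (.read 13 (.reg 0)) 1 4 vertex (.reg 7 + 1)) advance))

-- As in a deletion phase, a new vertex is recognized by a positive number of neighbours, which is
-- why every queued vertex must have one.
open Classical in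
theorem searchPhase_runs {b B k n L e i : ℕ} (hm : Machine b B k) {σ : Regs} {M : Mem}
    (h : Env b k n L e i σ M) {Q : Finset ℕ} (hQ : Queue k e M Q) (hi : i + 1 < b)
    (he : e + 1 < b) (hQ0 : ∀ v ∈ Q, outDegree k M v ≠ 0)
    (hnb : ∀ u ∈ Q, ∀ v, OutNeighbor k M u v → v < 2 ^ k) :
    ∃ σ' M' Q', Runs B searchPhase σ M σ' M'
        (25000 * ((k + 1) * (1 + Q.card + ∑ v ∈ Q, if M (4, v) = 0 then outDegree k M v else 0)))
        (25000 * (k + 1)) ∧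
      Env b k n L (e + 1) (i + 1) σ' M' ∧ Queue k (e + 1) M' Q' ∧
      (∀ a x, a ∈ [0, 1, 2, 3, 5, 6, 7, 9] → M' (a, x) = M (a, x)) ∧
      (∀ v, M' (4, v) = if v ∈ Q ∧ M (4, v) = 0 then i + 1 else M (4, v)) ∧
      (∀ w, w ∈ Q' ↔ ∃ u, (u ∈ Q ∧ M (4, u) = 0) ∧ OutNeighbor k M u w) ∧
      Q'.card ≤ ∑ v ∈ Q, if M (4, v) = 0 then outDegree k M v else 0 := by
  have hlt := hm.lt
  have hb := hm.two_le
  set c := M (10, addr (2 ^ k) e 0 k) with hc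
  set X : ℕ → ℕ := fun j => M (12, e * (2 ^ k * 2 ^ k) + j) with hX
  have hlist : Lists X c Q := hQ.lists
  set rd : ℕ → ℕ := fun j => if M (4, X j) = 0 then outDegree k M (X j) else 0 with hrd
  have hsum : ∑ j ∈ Finset.range c, rd j =
      ∑ v ∈ Q, if M (4, v) = 0 then outDegree k M v else 0 :=
    hlist.sum fun v => if M (4, v) = 0 then outDegree k M v else 0
  have hcb : c < b := h.below.mem _
  set nb : ℕ → ℕ → ℕ := fun j i => M (9, X j * (2 ^ k * 2 ^ k) + i) with hnbdef
  obtain ⟨M₁, r₁, h₁, hM₁, w₁⟩ := loadQueue_runs hm h hc.symm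
  set σ₁ := Function.update σ 11 c with hσ₁
  have s11 : σ₁ 11 = c := by simp [σ₁]
  have s4 : ∀ j i, thread σ₁ j i 4 = 2 ^ k := fun j i => by
    rw [thread_of_two_le _ _ _ (by omega), h₁.r4]
  have s5 : ∀ j i, thread σ₁ j i 5 = k := fun j i => by
    rw [thread_of_two_le _ _ _ (by omega), h₁.r5]
  obtain ⟨M₂, r₂, hb₂, hM₂, w₂, -⟩ := pfor_store (a := 13) hb hm.pow_le h₁.below
    (len := .reg 11) (deg := 1) (cond := 1) (idx := .reg 0)
    (val := .op .eq (.read 4 vertex) 0 * .read 7 (addrE vertex 0 (.reg 5))) (by decide)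
    (ln := c) (dg := fun _ => 1) (cv := fun _ _ => True) (iv := fun j _ => j)
    (vv := fun j _ => rd j) s11 hcb.le (by simp) (by intros; omega) (by simp) (by simp)
    (fun j hj i' _ _ => by
      simp only [Expr.val_mul, Expr.val_eq, Expr.val_read, vertex, thread_zero, w₁ j hj, addrE_val,
        Expr.val_reg, Expr.val_ofNat, s4, s5, hM₁ (4, _) (by simp), hM₁ (7, _) (by simp), rd,
        outDegree, X]
      split_ifs <;> simp)
    (by rintro j - i - j' - i' - - - rfl; rfl) (by decide) (.inl (by decide))
    (fun j _ _ _ _ => by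
      simp only [rd]
      split_ifs
      · exact h.below.mem _
      · omega)
  have h₂ : Env b k n L e i σ₁ M₂ := h₁.mem hb₂.mem
  have l₂ : Loaded k σ₁ M₂ c X rd nb :=
    ⟨s11, fun j hj => by rw [hM₂ _ (by simp), w₁ j hj],
      fun j hj => w₂ j hj 0 (by omega) trivial,
      fun j hj i' _ => by rw [hM₂ _ (by simp), hM₁ _ (by simp)]⟩
  obtain ⟨M₃, r₃, h₃, hM₃, w₃, v₃⟩ := setLevels_runs hm h₂ l₂ (val := .reg 7 + 1) (d := i + 1)
    (by decide) (fun j i' => by simp [thread_of_two_le, h₂.r7]) hi (by decide)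
  have l₃ : Loaded k σ₁ M₃ c X rd nb := l₂.congr rfl fun a x ha => hM₃ _ (by
    rcases ha with rfl | rfl | rfl <;> simp)
  have rd_ne : ∀ j < c, rd j ≠ 0 ↔ M (4, X j) = 0 := by
    intro j hj
    simp only [rd]
    split_ifs with h1
    · exact ⟨fun _ => h1, fun _ => hQ0 _ (hlist.mem hj)⟩
    · exact ⟨fun h0 => absurd rfl h0, fun hr => absurd hr h1⟩
  have nbr : ∀ w, (∃ j < c, ∃ i' < rd j, nb j i' = w) ↔
      ∃ u, (u ∈ Q ∧ M (4, u) = 0) ∧ OutNeighbor k M u w := by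
    intro w
    constructor
    · rintro ⟨j, hj, i', hi', rfl⟩
      have hr := (rd_ne j hj).1 (by omega)
      exact ⟨X j, ⟨hlist.mem hj, hr⟩, i', by simpa only [rd, if_pos hr] using hi', rfl⟩
    · rintro ⟨u, hu, i', hi', rfl⟩
      obtain ⟨j, hj, rfl⟩ := hlist.exists hu.1
      exact ⟨j, hj, i', by simpa only [rd, if_pos hu.2] using hi', rfl⟩
  obtain ⟨σ₄, M₄, r₄, h₄, hM₄, Q', hQ', hQ''⟩ := advance_runs hm h₃ l₃ he hi
    (fun j hj i' hi' => by
      obtain ⟨u, hu, hw⟩ := (nbr _).1 ⟨j, hj, i', hi', rfl⟩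
      exact hnb u hu.1 _ hw)
    (fun x hx => by rw [hM₃ _ (by simp), hM₂ _ (by simp), hM₁ _ (by simp), hQ.fresh x hx])
  refine ⟨σ₄, M₄, Q', (r₁.seq (r₂.seq (r₃.seq r₄))).mono ?_ ?_, h₄, hQ', ?_, ?_, ?_, ?_⟩
  · have e1 : extent c rd =
        1 + Q.card + ∑ v ∈ Q, if M (4, v) = 0 then outDegree k M v else 0 := by
      unfold extent; rw [hsum, hlist.2]
    have e2 : extent c (fun _ => 1) ≤ 2 * extent c rd := by
      rw [extent_one]; unfold extent; omega
    have e3 : 1 + c + c ≤ 2 * extent c rd := by unfold extent; omega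
    have e4 : extent c rd ≤ (k + 1) * extent c rd := Nat.le_mul_of_pos_left _ (by omega)
    have e5 : 1 ≤ extent c rd := by unfold extent; omega
    rw [← e1]; omega
  · omega
  · intro a x ha
    simp only [List.mem_cons, List.not_mem_nil, or_false] at ha
    rw [hM₄, hM₃, hM₂, hM₁] <;> (simp only; omega)
  · intro v
    rw [hM₄ _ (by simp) (by simp) (by simp)]
    by_cases hv : v ∈ Q ∧ M (4, v) = 0
    · rw [if_pos hv]
      obtain ⟨j, hj, rfl⟩ := hlist.exists hv.1
      exact w₃ j hj ((rd_ne j hj).2 hv.2)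
    · rw [if_neg hv, v₃, hM₂ _ (by simp), hM₁ _ (by simp)]
      rintro j hj h0 rfl
      exact hv ⟨hlist.mem hj, (rd_ne j hj).1 h0⟩
  · intro w
    rw [hQ'', nbr]
  · rw [← hsum]
    exact card_le_sum_of_neighbors fun w hw => (hQ'' w).1 hw

open Classical in
/-- Breadth-first search up to depth `L`. -/
theorem searchLoop_runs {b B k n s L e m : ℕ} (hm : Machine b B k) {σ : Regs} {M : Mem}
    (h : Env b k n L e 0 σ M) (hQ : Queue k e M {s}) (hs : s < n) (hn : n < 2 ^ k) (hL : L ≤ n)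
    (he : e + L + 2 < b) {E : ℕ → ℕ → Prop} (hE : ∀ u v, E u v → u < n ∧ v < n)
    (hEA : ∀ u v, E u v → OutNeighbor k M u v ∧ OutNeighbor k M v v) (hss : OutNeighbor k M s s)
    (hAE : ∀ u v, u < n → OutNeighbor k M u v → v < n ∧ (E u v ∨ v = u))
    (hD : ∀ v, M (4, v) = 0) (hsum : ∑ v ∈ Finset.range n, outDegree k M v ≤ m) :
    ∃ t σ' M', t ≤ L + 1 ∧ Runs B (.while (.op .lt (.reg 7) (.reg 3 + 1) *
        .read 10 (addrE (.reg 6) 0 (.reg 5))) searchPhase) σ M σ' M'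
        (25401 * ((k + 1) * (3 * m + 3))) (26000 * ((L + 2) * (k + 1))) ∧
      Env b k n L (e + t) t σ' M' ∧
      (∀ a x, a ∈ [0, 1, 2, 3, 5, 6, 7, 9] → M' (a, x) = M (a, x)) ∧
      (∀ i, (e + t + 1) * (2 ^ k * 2 ^ k) ≤ i → M' (10, i) = 0) ∧
      M' (4, s) = 1 ∧ (∀ v < n, M' (4, v) = 1 → v = s) ∧ (∀ v < n, M' (4, v) ≤ L + 1) ∧
      (∀ v < n, 2 ≤ M' (4, v) → ∃ u, E u v ∧ M' (4, u) + 1 = M' (4, v)) ∧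
      ∀ u v, E u v → M' (4, u) ≠ 0 → M' (4, u) ≤ L → M' (4, v) ≠ 0 ∧ M' (4, v) ≤ M' (4, u) + 1 := by
  set A := 25401 * (k + 1) with hA
  have hlt := hm.lt
  have hKb := hm.K_lt
  have hk2 := hm.two_le_k
  -- The total degree of the vertices that already have a level; it never exceeds `m` and pays for
  -- the search.
  set ψ : (ℕ → ℕ) → ℕ := fun D => ∑ v ∈ Finset.range n, if D v = 0 then 0 else outDegree k M v
    with hψ
  have hψm : ∀ D, ψ D ≤ m := fun D => le_trans (Finset.sum_le_sum fun v _ => by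
    split_ifs <;> omega) hsum
  obtain ⟨t, ht, σ', M', w, ⟨Q, h1, h2, h4, h5, h6⟩, hz, hr⟩ :=
    Runs.while_rule (w := 0) (t := 0) (T := L + 1) (d := 25000 * (k + 1))
      (c := searchPhase) hm.two_le hm.pow_le (e := .op .lt (.reg 7) (.reg 3 + 1) *
        .read 10 (addrE (.reg 6) 0 (.reg 5))) (by decide)
      -- Let a phase add `S` to `ψ`. Up to the factor `A` it costs `1 + Q.card + S` and creates a
      -- queue of at most `S` vertices. The test for an empty queue gives `1 ≤ Q.card`, so the
      -- credit `2 * Q.card` pays for `1 + Q.card`, and `3 * S` pays for the rest and for the new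
      -- credit. Without this test, idle rounds could cost `L log n`, which `m log n` need not
      -- bound.
      (fun t σ' M' w => ∃ Q, Env b k n L (e + t) t σ' M' ∧ Queue k (e + t) M' Q ∧
        (∀ a x, a ∈ [0, 1, 2, 3, 5, 6, 7, 9] → M' (a, x) = M (a, x)) ∧
        Searching n s E t (fun v => M' (4, v)) Q ∧
        w + A * (2 * Q.card) ≤ A * (2 + 3 * ψ fun v => M' (4, v)))
      (fun t σ' M' w hh => by obtain ⟨Q, hh, -⟩ := hh; exact hh.below)
      (by
        rintro σ' M' w ⟨Q, hh, -⟩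
        simp [hh.r7, hh.r3])
      (by
        rintro t ht σ' M' w ⟨Q, h1, h2, h4, h5, h6⟩ hz
        have o : OutNeighbor k M' = OutNeighbor k M :=
          OutNeighbor.congr (fun x => h4 7 x (by simp)) fun x => h4 9 x (by simp)
        have od : outDegree k M' = outDegree k M := by
          funext u; exact h4 7 _ (by simp)
        have hc : 1 ≤ Q.card := by
          rw [← h2.lists.2]
          simp only [Expr.val_mul, Expr.val_read, addrE_val, Expr.val_reg, Expr.val_ofNat, h1.r4,
            h1.r5, h1.r6] at hz
          exact Nat.one_le_iff_ne_zero.2 (right_ne_zero_of_mul hz)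
        obtain ⟨σ₁, M₁, Q₁, r, g1, g2, g4, g5, g7, g8⟩ := searchPhase_runs hm h1 h2 (by omega)
          (by omega)
          (by
            intro v hv
            -- Every vertex that the search reaches is the source or the target of an edge, and
            -- these are stored as their own out-neighbours.
            have : OutNeighbor k M v v := by
              obtain ⟨hvn, h7 | ⟨-, rfl⟩ | ⟨-, u, hu, -⟩⟩ := h5.mem v hv
              · by_cases h8 : M' (4, v) = 1
                · rw [h5.eq_root v hvn h8]; exact hss
                · obtain ⟨u, hu, -⟩ := h5.parent v hvn (by
                    have : M' (4, v) ≠ 0 := h7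
                    show 2 ≤ M' (4, v)
                    omega)
                  exact (hEA u v hu).2
              · exact hss
              · exact (hEA u v hu).2
            obtain ⟨j, hj, -⟩ := this
            rw [od]; omega)
          (by
            intro u hu v huv
            rw [o] at huv
            have := (hAE u v (h5.mem u hu).1 huv).1
            omega)
        have step := h5.step hs hE (fun u v huv => (hEA u v huv).1) hAE g5 (by rw [← o]; exact g7)
        refine ⟨σ₁, M₁, _, r, Q₁, g1, g2, fun a x ha => by rw [g4 a x ha, h4 a x ha], step, ?_⟩
        have hψ' := sum_queue (n := n) (Q := Q)
          (f := fun v => if M' (4, v) = 0 then outDegree k M' v else 0)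
          (g := fun v => if M' (4, v) = 0 then 0 else outDegree k M v)
          (g' := fun v => if M₁ (4, v) = 0 then 0 else outDegree k M v)
          (fun v hv => (h5.mem v hv).1.le) (fun v hv => by
            rw [g5, od]
            by_cases hvQ : v ∈ Q <;> by_cases hc : M' (4, v) = 0 <;> simp [hvQ, hc])
        rw [if_neg fun hh => absurd (h5.mem n hh).1 (lt_irrefl _), zero_add] at hψ'
        change _ + ψ (fun v => M' (4, v)) = ψ (fun v => M₁ (4, v)) at hψ'
        generalize ψ (fun v => M₁ (4, v)) = Φ' at hψ' ⊢
        generalize ψ (fun v => M' (4, v)) = Φ at hψ' h6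
        generalize (∑ v ∈ Q, if M' (4, v) = 0 then outDegree k M' v else 0) = S at hψ' g8 ⊢
        have e1 : 25000 * ((k + 1) * (1 + Q.card + S)) + 401 ≤ A * (1 + Q.card + S) := by
          have : 1 ≤ (k + 1) * (1 + Q.card + S) := Nat.mul_pos (by omega) (by omega)
          have e : A * (1 + Q.card + S) = 25401 * ((k + 1) * (1 + Q.card + S)) := by
            rw [hA]; ring
          omega
        have e2 : A * (1 + Q.card + S) + A * (2 * Q₁.card) ≤ A * (2 * Q.card) + A * (3 * S) := by
          rw [← mul_add, ← mul_add]; exact Nat.mul_le_mul_left _ (by omega)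
        have e3 : A * (2 + 3 * Φ) + A * (3 * S) = A * (2 + 3 * Φ') := by
          rw [← mul_add, ← hψ']; congr 1; omega
        omega)
      (by omega) (σ := σ) (M := M)
      ⟨{s}, h, hQ, fun _ _ _ => rfl, ⟨fun v _ => (hD v).le, .inl ⟨rfl, by simp⟩,
        fun v _ h1 => by simp [hD] at h1, fun v _ h1 => by simp [hD] at h1,
        fun u v _ h1 => by simp [hD] at h1, fun v hv => by
          obtain rfl := Finset.mem_singleton.1 hv; exact ⟨hs, .inr (.inl ⟨rfl, rfl⟩)⟩⟩, by
        rw [zero_add]; refine Nat.mul_le_mul_left _ ?_; simp⟩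
  have hfin : t = L + 1 ∨ Q = ∅ := by
    simp only [Expr.val_mul, Expr.val_lt, Expr.val_reg, h1.r7, h1.r3, Expr.val_add, Expr.val_ofNat,
      Expr.val_read, addrE_val, h1.r4, h1.r5, h1.r6, mul_eq_zero] at hz
    rcases hz with hz | hz
    · left
      by_contra hne
      rw [if_pos (by omega)] at hz
      omega
    · right
      rw [← Finset.card_eq_zero, ← h2.lists.2, hz]
  refine ⟨t, σ', M', ht, hr.mono ?_ ?_, h1, h4, h2.fresh, ?_, h5.eq_root,
    fun v hv => (h5.le v hv).trans ht, h5.parent, h5.edge_of_finished hfin⟩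
  · have := hψm fun v => M' (4, v)
    have e1 : A * (2 + 3 * ψ fun v => M' (4, v)) + 401 ≤ A * (3 * m + 3) := by
      have : A * (2 + 3 * ψ fun v => M' (4, v)) ≤ A * (3 * m + 2) :=
        Nat.mul_le_mul_left _ (by omega)
      have : A * (3 * m + 3) = A * (3 * m + 2) + A := by ring
      omega
    have e2 : A * (3 * m + 3) = 25401 * ((k + 1) * (3 * m + 3)) := by rw [hA]; ring
    omega
  · rw [Nat.sub_zero]
    have e : (L + 1) * (25000 * (k + 1) + 401) ≤ (L + 1) * (25401 * (k + 1)) :=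
      Nat.mul_le_mul_left _ (by omega)
    nlinarith
  · rcases h5.root with ⟨rfl, hsQ⟩ | hs1
    · rcases hfin with hf | rfl
      · omega
      · simp at hsQ
    · exact hs1

/-- Enter the edges of the input into the trees of in-neighbours, which are empty. -/
def addEdges : Cmd :=
  .seq (pfor (.read 0 0) 1 (.read 4 source) 6
      (addrE (target * .reg 4 + (.read 4 source - 1)) source 0) (source + 1))
    (treeUp ⟨.read 0 0, 1, target * .reg 4 + (.read 4 source - 1), source⟩ 6 0)

/-- The search is over, so each edge goes directly to the tree for the final level of its source,
and edges out of unreached vertices are skipped. Trees of zeros are consistent, so only the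
ancestors of the new leaves have to be computed. -/
theorem addEdges_runs {b B k n L e i len : ℕ} (hm : Machine b B k) {σ : Regs} {M : Mem}
    (h : Env b k n L e i σ M) (h6 : ∀ x, M (6, x) = 0) (hlen : M (0, 0) = len)
    {bu bv : ℕ → ℕ} (hu : ∀ j < len, M (1, j) = bu j) (hv : ∀ j < len, M (2, j) = bv j)
    (hn : n < 2 ^ k) (hun : ∀ j < len, bu j < n) (hL : L + 1 < 2 ^ k)
    (hD : ∀ v < n, M (4, v) ≤ L + 1) :
    ∃ σ' M', Runs B addEdges σ M σ' M' (8000 * ((k + 1) * (1 + 2 * len))) (8000 * (k + 1)) ∧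
      Env b k n L e i σ' M' ∧ (∀ p, p.1 ≠ 6 → M' p = M p) ∧
      InTrees k L (fun u v => ∃ j < len, bu j = u ∧ bv j = v) M' := by
  have hb := hm.two_le
  have hlt := hm.lt
  have hKb := hm.K_lt
  have s4 : ∀ j i, thread σ j i 4 = 2 ^ k := fun j i => by
    rw [thread_of_two_le _ _ _ (by omega), h.r4]
  have lenb : len ≤ b := by rw [← hlen]; exact (h.below.mem _).le
  have den : Frame.Den b ⟨.read 0 0, 1, target * .reg 4 + (.read 4 source - 1), source⟩ σ M
      ⟨len, fun _ => 1, fun j _ => bv j * 2 ^ k + (M (4, bu j) - 1), fun j _ => bu j⟩ :=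
    ⟨by simp [hlen], lenb, by simp, by intros; simp only; omega,
      fun j hj i _ => by simp [target, source, hu j hj, hv j hj, s4],
      fun j hj i _ => by simp [source, hu j hj]⟩
  have uK : ∀ j < len, bu j < 2 ^ k := fun j hj => (hun j hj).trans hn
  have inj : ∀ j < len, ∀ w, ∀ d < 2 ^ k, ∀ u < 2 ^ k,
      addr (2 ^ k) (w * 2 ^ k + d) u 0 =
        addr (2 ^ k) (bv j * 2 ^ k + (M (4, bu j) - 1)) (bu j) 0 →
      bv j = w ∧ d = M (4, bu j) - 1 ∧ bu j = u := by
    intro j hj w d hd u hu he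
    obtain ⟨e1, e2, -⟩ := addr_inj hu (by omega) (uK j hj) (by omega) he
    obtain ⟨e3, e4⟩ := mul_add_inj hd (by have := hD _ (hun j hj); omega) e1
    exact ⟨e3.symm, e4, e2.symm⟩
  obtain ⟨M₁, r₁, hb₁, hM₁, w₁, v₁⟩ := pfor_store (a := 6) hb hm.pow_le h.below
    (len := .read 0 0) (deg := 1) (cond := .read 4 source)
    (idx := addrE (target * .reg 4 + (.read 4 source - 1)) source 0) (val := source + 1) (by decide)
    (cv := fun j _ => M (4, bu j) ≠ 0)
    (iv := fun j _ => addr (2 ^ k) (bv j * 2 ^ k + (M (4, bu j) - 1)) (bu j) 0)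
    (vv := fun j _ => bu j + 1)
    den.len den.len_le den.deg den.deg_le (fun j hj i _ => by simp [source, hu j hj])
    (fun j hj i _ _ => by simp [target, source, hu j hj, hv j hj, s4])
    (fun j hj i _ _ => by simp [source, hu j hj])
    (by
      intro j hj i _ j' hj' i' _ _ _ he
      rw [(inj j' hj' _ _ (by have := hD _ (hun j hj); omega) _ (uK j hj) he).2.2])
    (by decide) (.inl (by decide)) (by intro j hj _ _ _; have := uK j hj; omega)
  obtain ⟨M₂, r₂, hb₂, hM₂, w₂, -, c₂⟩ := treeUp_runs hm
    (F := ⟨.read 0 0, 1, target * .reg 4 + (.read 4 source - 1), source⟩) (by decide) (a := 6)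
    (f := 0) (by omega) (by decide) hb₁ h.r4 h.r5
    (den.congr (fun _ _ => rfl) fun a ha i => hM₁ _ (by
      rintro rfl; revert ha; decide))
    (by rintro r x ⟨j, hj, i', hi', -, rfl⟩; exact uK j hj)
  have hM : ∀ p, p.1 ≠ 6 → M₂ p = M p := fun p hp => by rw [hM₂ p hp, hM₁ p hp]
  have h4 : ∀ u, M₂ (4, u) = M (4, u) := fun u => hM _ (by simp)
  refine ⟨_, M₂, (r₁.seq r₂).mono ?_ ?_, (h.atHeight hm).mem hb₂, hM, ⟨?_, ?_, ?_⟩⟩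
  · have : extent len (fun _ => 1) ≤ (k + 1) * extent len (fun _ => 1) :=
      Nat.le_mul_of_pos_left _ (by omega)
    show 2006 * extent len (fun _ => 1) + 4000 * ((k + 1) * extent len (fun _ => 1)) ≤ _
    rw [← extent_one]
    omega
  · omega
  · have c₀ : Consistent k 6 0 M fun _ _ => False := fun r y t _ _ _ => by simp [h6, comb]
    exact c₂ _ (c₀.of_leaves hm.two_le_k fun i hi => v₁ i fun j hj i' hi' _ =>
      hi _ _ (uK j hj) ⟨j, hj, i', hi', rfl, rfl⟩)
  · rintro w hw d hd u hu ⟨j, hj, rfl, rfl⟩ h1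
    rw [h4] at h1
    rw [w₂ _ _ hu, show d = M (4, bu j) - 1 by omega]
    exact w₁ j hj 0 Nat.one_pos (by omega)
  · intro w hw d hd u hu hne
    rw [h4] at hne
    rw [w₂ _ u hu, v₁, h6]
    intro j hj i' _ h0 he
    obtain ⟨e1, e2, e3⟩ := inj j hj w d (by omega) u hu he
    refine hne ⟨⟨j, hj, e3, e1⟩, ?_⟩
    rw [← e3]
    omega

/-- Choose the parents of all vertices. -/
def setParents : Cmd :=
  pfor (.read 0 0) 1 (.op .lt 1 (.read 4 target)) 5 target
    (.read 6 (addrE (target * .reg 4 + (.read 4 target - 2)) 0 (.reg 5)))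

/-- There is one thread per edge instead of one per vertex: a vertex that needs a parent is the
target of an edge, and a loop over all vertices could exceed the work bound. Threads with a common
target copy the same root. The tree is that of level `D - 2`, because `D` is the level plus `1` and
a parent is one level lower. -/
theorem setParents_runs {b B k n L e i len s : ℕ} (hm : Machine b B k) {σ : Regs} {M : Mem}
    (h : Env b k n L e i σ M) (h5 : ∀ x, M (5, x) = 0) (hlen : M (0, 0) = len)
    {bu bv : ℕ → ℕ} (hv : ∀ j < len, M (2, j) = bv j) {E : ℕ → ℕ → Prop}
    (hE : ∀ u v, E u v ↔ ∃ j < len, bu j = u ∧ bv j = v) (hEn : ∀ u v, E u v → u < n ∧ v < n)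
    (hn : n < 2 ^ k) (hT : InTrees k L E M)
    (h1 : M (4, s) = 1) (h2 : ∀ v < n, M (4, v) = 1 → v = s) (h3 : ∀ v < n, M (4, v) ≤ L + 1)
    (h4 : ∀ v < n, 2 ≤ M (4, v) → ∃ u, E u v ∧ M (4, u) + 1 = M (4, v))
    (h6 : ∀ u v, E u v → M (4, u) ≠ 0 → M (4, u) ≤ L →
      M (4, v) ≠ 0 ∧ M (4, v) ≤ M (4, u) + 1) :
    ∃ M', Runs B setParents σ M σ M' (2006 * (1 + 2 * len)) 2006 ∧ Env b k n L e i σ M' ∧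
      (∀ p, p.1 ≠ 5 → M' p = M p) ∧
      Certified n s L E (fun v => M' (4, v)) (fun v => M' (5, v)) := by
  have hb := hm.two_le
  have hlt := hm.lt
  have s4 : ∀ j i, thread σ j i 4 = 2 ^ k := fun j i => by
    rw [thread_of_two_le _ _ _ (by omega), h.r4]
  have s5 : ∀ j i, thread σ j i 5 = k := fun j i => by
    rw [thread_of_two_le _ _ _ (by omega), h.r5]
  have lenb : len ≤ b := by rw [← hlen]; exact (h.below.mem _).le
  obtain ⟨M', r, hbl, hM, w, v⟩ := pfor_store (a := 5) hb hm.pow_le h.below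
    (len := .read 0 0) (deg := 1) (cond := .op .lt 1 (.read 4 target)) (idx := target)
    (val := .read 6 (addrE (target * .reg 4 + (.read 4 target - 2)) 0 (.reg 5))) (by decide)
    (ln := len) (dg := fun _ => 1)
    (cv := fun j _ => 2 ≤ M (4, bv j)) (iv := fun j _ => bv j)
    (vv := fun j _ => M (6, addr (2 ^ k) (bv j * 2 ^ k + (M (4, bv j) - 2)) 0 k))
    (by simp [hlen]) lenb (by simp) (by intros; omega)
    (fun j hj i _ => by
      simp only [target, Expr.val_lt, Expr.val_ofNat, Expr.val_read, Expr.val_reg, thread_zero,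
        hv j hj]
      split_ifs <;> simp <;> omega)
    (fun j hj i _ _ => by simp [target, hv j hj])
    (fun j hj i _ _ => by simp [target, hv j hj, s4, s5])
    (by intro j _ i _ j' _ i' _ _ _ he; simp only [he])
    (by decide) (.inl (by decide)) (fun _ _ _ _ _ => h.below.mem _)
  have lev : ∀ v, M' (4, v) = M (4, v) := fun v => hM _ (by simp)
  refine ⟨M', by rwa [extent_one] at r, h.mem hbl.mem, hM, ?_⟩
  constructor
  · simpa only [lev] using h1
  · simpa only [lev] using h2
  · simpa only [lev] using h3
  · simp only [lev]
    intro x hx hx2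
    obtain ⟨u, hu, hux⟩ := h4 x hx hx2
    obtain ⟨j, hj, rfl, rfl⟩ := (hE u x).1 hu
    have hle := h3 _ hx
    rcases hT.root hm.two_le_k (w := bv j) (d := M (4, bv j) - 2) (by omega) (by omega)
      (fun u hu => (hEn u _ hu).1.trans hn) with ⟨-, hno⟩ | ⟨u', e1, e2, e3⟩
    · exact absurd (by omega) (hno _ hu)
    · exact ⟨u', (w j hj 0 Nat.one_pos hx2).trans e1, e2, by omega⟩
  · simp only [lev]
    intro x hx hx1
    rw [v, h5]
    rintro j hj i' - hc rfl
    omega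
  · simpa only [lev] using h6

/-- List the out-neighbours of all vertices. Every target of an edge and the source of the tree also
count as out-neighbours of themselves. -/
def storeNeighbors : Cmd :=
  insert ⟨.read 0 0, 3, .op .eq (.reg 1) 0 * source + .op .eq (.reg 1) 1 * target +
      .op .eq (.reg 1) 2 * .reg 10,
    .op .eq (.reg 1) 0 * target + .op .eq (.reg 1) 1 * target + .op .eq (.reg 1) 2 * .reg 10⟩ 7 8 9

/-- Each edge `(u, v)` has three threads, which insert `v` for `u`, `v` for itself and `s` for
itself. Counting threads by rows bounds the total degree by `3 * len`. A single degree is at most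
the length of a row, so the lists do not overlap. -/
theorem storeNeighbors_runs {b B k n L e i len s : ℕ} (hm : Machine b B k) {σ : Regs} {M : Mem}
    (h : Env b k n L e i σ M) (h10 : σ 10 = s) (h7 : ∀ x, M (7, x) = 0) (hlen : M (0, 0) = len)
    {bu bv : ℕ → ℕ} (hu : ∀ j < len, M (1, j) = bu j) (hv : ∀ j < len, M (2, j) = bv j)
    (hun : ∀ j < len, bu j < n ∧ bv j < n) (hs : s < n) (hn : n < 2 ^ k) :
    ∃ σ' M', Runs B storeNeighbors σ M σ' M' (13000 * ((k + 1) * (1 + 4 * len))) (13000 * (k + 1)) ∧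
      Env b k n L e i σ' M' ∧ σ' 10 = s ∧
      (∀ p, p.1 ≠ 7 → p.1 ≠ 8 → p.1 ≠ 9 → M' p = M p) ∧
      (∀ u v, OutNeighbor k M' u v ↔ ∃ j < len, (bu j = u ∧ bv j = v) ∨ (bv j = u ∧ bv j = v) ∨
        (s = u ∧ s = v)) ∧
      (∀ u, outDegree k M' u ≤ 2 ^ k * 2 ^ k) ∧
      ∑ u ∈ Finset.range n, outDegree k M' u ≤ 3 * len := by
  have hb := hm.two_le
  have hlt := hm.lt
  have hKb := hm.K_lt
  have s10 : ∀ j i, thread σ j i 10 = s := fun j i => by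
    rw [thread_of_two_le _ _ _ (by omega), h10]
  have hk2 : 4 ≤ 2 ^ k := Nat.pow_le_pow_right (show 0 < 2 by omega) hm.two_le_k
  have lenb : len ≤ b := by rw [← hlen]; exact (h.below.mem _).le
  set rv : ℕ → ℕ → ℕ := fun j i => if i = 0 then bu j else if i = 1 then bv j else s with hrv
  set xv : ℕ → ℕ → ℕ := fun j i => if i = 0 then bv j else if i = 1 then bv j else s with hxv
  have den : Frame.Den b ⟨.read 0 0, 3, .op .eq (.reg 1) 0 * source + .op .eq (.reg 1) 1 * target +
      .op .eq (.reg 1) 2 * .reg 10, .op .eq (.reg 1) 0 * target + .op .eq (.reg 1) 1 * target +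
      .op .eq (.reg 1) 2 * .reg 10⟩ σ M ⟨len, fun _ => 3, rv, xv⟩ := by
    refine ⟨by simp [hlen], lenb, by simp, by intros; simp only; omega, fun j hj i hi => ?_,
      fun j hj i hi => ?_⟩
    all_goals
      have hi' : i < 3 := hi
      interval_cases i <;> simp [source, target, hu j hj, hv j hj, s10, rv, xv]
  have bnd : ∀ r x, Items.Has ⟨len, fun _ => 3, rv, xv⟩ r x → r < n ∧ x < n := by
    rintro r x ⟨j, hj, i, hi, rfl, rfl⟩
    have := hun j hj
    simp only [rv, xv]
    split_ifs <;> exact ⟨by omega, by omega⟩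
  obtain ⟨M', r, hM1, hM2, -, -, hM3⟩ := insert_runs hm (a := 7) (a' := 8) (c := 9)
    (by decide) (by decide) (by decide) (by decide) (by decide) (by decide) (by decide)
    h.below h.r4 h.r5 den (fun r x hx => (bnd r x hx).2.trans hn) (fun _ _ _ _ _ _ _ => h7 _)
  choose Q hQ1 hQ2 using fun r => hM3 r fun _ _ _ _ => h7 _
  have hdeg : ∀ u, outDegree k M' u = (Q u).card := fun u => (hQ2 u).2
  refine ⟨_, M', r.mono ?_ le_rfl, (h.atHeight hm).mem hM1, ?_, hM2, fun u v => ?_, fun u => ?_, ?_⟩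
  · simp only [extent, Finset.sum_const, Finset.card_range, smul_eq_mul]
    refine Nat.mul_le_mul_left _ (Nat.mul_le_mul_left _ ?_)
    omega
  · rw [atHeight_of_ne _ _ (by omega) (by omega), h10]
  · have : OutNeighbor k M' u v ↔ v ∈ Q u :=
      ⟨fun ⟨j, hj, e⟩ => e ▸ (hQ2 u).mem hj, fun hv => by
        obtain ⟨j, hj, e⟩ := (hQ2 u).exists hv
        exact ⟨j, hj, e⟩⟩
    rw [this, hQ1]
    constructor
    · rintro ⟨j, hj, i, hi, e1, e2⟩
      refine ⟨j, hj, ?_⟩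
      simp only [rv, xv] at e1 e2
      split_ifs at e1 e2
      exacts [.inl ⟨e1, e2⟩, .inr (.inl ⟨e1, e2⟩), .inr (.inr ⟨e1, e2⟩)]
    · rintro ⟨j, hj, h | h | h⟩
      exacts [⟨j, hj, 0, by simp, by simpa [rv] using h.1, by simpa [xv] using h.2⟩,
        ⟨j, hj, 1, by simp, by simpa [rv] using h.1, by simpa [xv] using h.2⟩,
        ⟨j, hj, 2, by simp, by simpa [rv] using h.1, by simpa [xv] using h.2⟩]
  · rw [hdeg]
    have : Q u ⊆ Finset.range (2 ^ k) := fun x hx =>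
      Finset.mem_range.2 ((bnd u x ((hQ1 u x).1 hx)).2.trans hn)
    have := Finset.card_le_card this
    rw [Finset.card_range] at this
    exact this.trans (Nat.le_mul_of_pos_left _ (by omega))
  · classical
    set T := Finset.range len ×ˢ Finset.range 3 with hT
    have hcard : T.card = 3 * len := by simp [T, mul_comm]
    have hmaps : ∀ p ∈ T, rv p.1 p.2 ∈ Finset.range n := by
      rintro ⟨j, i⟩ hp
      simp only [T, Finset.mem_product, Finset.mem_range] at hp
      exact Finset.mem_range.2 (bnd _ _ ⟨j, hp.1, i, hp.2, rfl, rfl⟩).1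
    rw [← hcard, Finset.card_eq_sum_card_fiberwise hmaps]
    refine Finset.sum_le_sum fun u _ => ?_
    rw [hdeg]
    have : Q u ⊆ (T.filter fun p => rv p.1 p.2 = u).image fun p => xv p.1 p.2 := by
      intro x hx
      obtain ⟨j, hj, i, hi, e1, e2⟩ := (hQ1 u x).1 hx
      refine Finset.mem_image.2 ⟨(j, i), Finset.mem_filter.2 ⟨?_, e1⟩, e2⟩
      simpa [T] using ⟨hj, hi⟩
    exact (Finset.card_le_card this).trans Finset.card_image_le

/-- Make the source of the tree the only element of the queue. -/
def enqueueSource : Cmd :=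
  .seq (.store 12 0 (.reg 10)) (.store 10 (addrE 0 0 (.reg 5)) 1)

theorem enqueueSource_runs {b B k n L i s : ℕ} (hm : Machine b B k) {σ : Regs} {M : Mem}
    (h : Env b k n L 0 i σ M) (h10 : σ 10 = s) (hM : ∀ x, M (10, x) = 0) :
    ∃ M', Runs B enqueueSource σ M σ M' 1606 1606 ∧ Env b k n L 0 i σ M' ∧
      (∀ p, p.1 ≠ 10 → p.1 ≠ 12 → M' p = M p) ∧ Queue k 0 M' {s} := by
  have hb := hm.two_le
  have hB := hm.pow_le
  have hlt := hm.lt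
  have hsb : s < b := by rw [← h10]; exact h.below.regs _
  have r₁ : Runs B (.store 12 0 (.reg 10)) σ M σ _ 803 803 :=
    Runs.store hb hB h.below 12 (iv := 0) (v := s) (by decide) (by decide) (by simp) (by simp [h10])
  have b₁ := h.below.store (p := (12, 0)) hsb
  generalize hM₁ : Function.update M (12, 0) s = M₁ at r₁ b₁
  have r₂ : Runs B (.store 10 (addrE 0 0 (.reg 5)) 1) σ M₁ σ _ 803 803 :=
    Runs.store hb hB b₁ 10 (iv := addr (2 ^ k) 0 0 k) (v := 1) (by decide) (by decide)
      (by simp [h.r4, h.r5]) (by simp)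
  have b₂ := b₁.store (p := (10, addr (2 ^ k) 0 0 k)) (v := 1) (by omega)
  generalize hM₂ : Function.update M₁ (10, addr (2 ^ k) 0 0 k) 1 = M₂ at r₂ b₂
  have hM' : ∀ a x, M₂ (a, x) = if a = 10 ∧ x = addr (2 ^ k) 0 0 k then 1 else
      if a = 12 ∧ x = 0 then s else M (a, x) := by
    intro a x
    simp only [← hM₂, ← hM₁, Function.update_apply, Prod.mk.injEq]
  refine ⟨M₂, r₁.seq r₂, h.mem b₂.mem, ?_, ⟨⟨?_, ?_⟩, ?_⟩⟩
  · rintro ⟨a, x⟩ h1 h2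
    simp only at h1 h2
    rw [hM', if_neg (by omega), if_neg (by omega)]
  · rw [hM']; simp [hM']
  · rw [hM']; simp
  · intro x hx
    have ha : addr (2 ^ k) 0 0 k < (0 + 1) * (2 ^ k * 2 ^ k) := by
      unfold addr; nlinarith
    rw [hM', if_neg (by rintro ⟨-, rfl⟩; exact absurd hx (not_le.2 ha)), if_neg (by omega), hM]

/-- The procedure that builds the first tree. -/
def init : Cmd :=
  .seq setup (.seq storeNeighbors (.seq enqueueSource
    (.seq (.while (.op .lt (.reg 7) (.reg 3 + 1) * .read 10 (addrE (.reg 6) 0 (.reg 5))) searchPhase)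
      (.seq addEdges (.seq setParents (.store 3 3 (.reg 6 + 1)))))))

/-- Memory is initially zero, hence all trees are empty, all levels are undefined and vertices that
no edge touches need no work. The degrees `dg` are fixed here once and for all; they are the weights
of the potential in all later batches. -/
theorem init_runs {b B n s L len : ℕ} (hm : Machine b B (Nat.clog 2 (n + 2))) {M : Mem}
    (hM : ∀ p, M p < b) (hn : M (3, 0) = n) (hs : M (3, 1) = s) (hL : M (3, 2) = L)
    (h3 : M (3, 3) = 0) (h0 : ∀ a x, 4 ≤ a → M (a, x) = 0) (hsn : s < n) (hLn : L ≤ n)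
    (hb : L + 2 < b) (hlen : M (0, 0) = len) (hpos : 0 < len)
    {bu bv : ℕ → ℕ} (hu : ∀ j < len, M (1, j) = bu j) (hv : ∀ j < len, M (2, j) = bv j)
    (hun : ∀ j < len, bu j < n ∧ bv j < n) {E : ℕ → ℕ → Prop}
    (hE : ∀ u v, E u v ↔ ∃ j < len, bu j = u ∧ bv j = v) :
    ∃ σ' M' e dg, Runs B init (fun _ => 0) M σ' M'
        (450000 * ((Nat.clog 2 (n + 2) + 1) * len))
        (100000 * ((L + 1) * (Nat.clog 2 (n + 2) + 1))) ∧ e ≤ L + 2 ∧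
      State b (Nat.clog 2 (n + 2)) n s L e dg E E M' ∧
      (∀ u < n, dg u ≤ 2 ^ Nat.clog 2 (n + 2) * 2 ^ Nat.clog 2 (n + 2)) ∧
      ∑ u ∈ Finset.range n, dg u ≤ 3 * len := by
  set k := Nat.clog 2 (n + 2) with hk
  have hnK : n + 2 ≤ 2 ^ k := Nat.le_pow_clog (by omega) _
  have hlt := hm.lt
  have hEn : ∀ u v, E u v → u < n ∧ v < n := by
    intro u v h
    obtain ⟨j, hj, rfl, rfl⟩ := (hE u v).1 h
    exact hun j hj
  obtain ⟨σ₁, r₁, h₁, t₁⟩ := setup_runs hm hM hn hs hL h3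
  rw [← hk] at r₁ h₁
  obtain ⟨σ₂, M₂, r₂, h₂, t₂, hM₂, nb, deg, sum⟩ := storeNeighbors_runs hm h₁ t₁
    (fun x => h0 _ _ (by omega)) hlen hu hv hun hsn (by omega)
  have m₂ : ∀ a x, a < 7 ∨ 9 < a → M₂ (a, x) = M (a, x) := fun a x ha =>
    hM₂ _ (by simp only; omega) (by simp only; omega) (by simp only; omega)
  obtain ⟨M₃, r₃, h₃, hM₃, q₃⟩ := enqueueSource_runs hm h₂ t₂ fun x => by
    rw [m₂ _ _ (by omega), h0 _ _ (by omega)]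
  have m₃ : ∀ a x, a < 10 → M₃ (a, x) = M₂ (a, x) := fun a x ha =>
    hM₃ _ (by simp only; omega) (by simp only; omega)
  have o₃ : OutNeighbor k M₃ = OutNeighbor k M₂ :=
    OutNeighbor.congr (fun x => m₃ _ _ (by omega)) fun x => m₃ _ _ (by omega)
  have od₃ : outDegree k M₃ = outDegree k M₂ := by funext u; exact m₃ _ _ (by omega)
  have out : ∀ u v, E u v → OutNeighbor k M₂ u v ∧ OutNeighbor k M₂ v v := by
    intro u v h
    obtain ⟨j, hj, e1, e2⟩ := (hE u v).1 h
    exact ⟨(nb u v).2 ⟨j, hj, .inl ⟨e1, e2⟩⟩, (nb v v).2 ⟨j, hj, .inr (.inl ⟨e2, e2⟩)⟩⟩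
  have range : ∀ u v, u < n → OutNeighbor k M₂ u v → v < n ∧ (E u v ∨ v = u) := by
    intro u v _ h
    obtain ⟨j, hj, ⟨e1, e2⟩ | ⟨e1, e2⟩ | ⟨e1, e2⟩⟩ := (nb u v).1 h
    · exact ⟨e2 ▸ (hun j hj).2, .inl ((hE u v).2 ⟨j, hj, e1, e2⟩)⟩
    · exact ⟨e2 ▸ (hun j hj).2, .inr (by omega)⟩
    · exact ⟨e2 ▸ hsn, .inr (by omega)⟩
  obtain ⟨t, σ₄, M₄, ht, r₄, h₄, hM₄, fresh, d1, d2, d3, d4, d5⟩ := searchLoop_runs (m := 3 * len) hm h₃ q₃ hsn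
    (by omega) hLn (by omega) hEn (by rw [o₃]; exact out)
    (by rw [o₃]; exact (nb s s).2 ⟨0, hpos, .inr (.inr ⟨rfl, rfl⟩)⟩) (by rw [o₃]; exact range)
    (fun v => by rw [m₃ _ _ (by omega), m₂ _ _ (by omega), h0 _ _ (by omega)])
    (by rw [od₃]; exact sum)
  have m₄ : ∀ a x, a ∈ [0, 1, 2, 3, 5, 6] → M₄ (a, x) = M (a, x) := by
    intro a x ha
    simp only [List.mem_cons, List.not_mem_nil, or_false] at ha
    rw [hM₄ a x (by simp only [List.mem_cons, List.not_mem_nil, or_false]; omega),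
      m₃ _ _ (by omega), m₂ _ _ (by omega)]
  obtain ⟨σ₅, M₅, r₅, h₅, hM₅, t₅⟩ := addEdges_runs hm h₄
    (fun x => by rw [m₄ _ _ (by simp), h0 _ _ (by omega)]) (by rw [m₄ _ _ (by simp), hlen])
    (fun j hj => by rw [m₄ _ _ (by simp), hu j hj]) (fun j hj => by rw [m₄ _ _ (by simp), hv j hj])
    (by omega) (fun j hj => (hun j hj).1) (by omega) d3
  rw [show (fun u v => ∃ j < len, bu j = u ∧ bv j = v) = E by
    funext u v; exact propext (hE u v).symm] at t₅
  have lev₅ : ∀ v, M₅ (4, v) = M₄ (4, v) := fun v => hM₅ _ (by simp)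
  obtain ⟨M₆, r₆, h₆, hM₆, c₆⟩ := setParents_runs (bu := bu) hm h₅
    (fun x => by rw [hM₅ _ (by simp), m₄ _ _ (by simp), h0 _ _ (by omega)])
    (by rw [hM₅ _ (by simp), m₄ _ _ (by simp), hlen])
    (fun j hj => by rw [hM₅ _ (by simp), m₄ _ _ (by simp), hv j hj])
    hE hEn (by omega) t₅ ((lev₅ s).trans d1) (by simpa only [lev₅] using d2)
    (by simpa only [lev₅] using d3) (by simpa only [lev₅] using d4) (by simpa only [lev₅] using d5)
  have r₇ : Runs B (.store 3 3 (.reg 6 + 1)) σ₅ M₆ σ₅ _ 803 803 :=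
    Runs.store hm.two_le hm.pow_le h₆.below 3 (iv := 3) (v := t + 1) (by decide) (by decide)
      (by simp) (by simp [h₆.r6])
  have b₇ := h₆.below.store (p := (3, 3)) (v := t + 1) (by omega)
  have hM₇ : ∀ a x, a ≠ 3 ∨ x ≠ 3 → Function.update M₆ (3, 3) (t + 1) (a, x) = M₆ (a, x) := by
    intro a x hax
    rw [Function.update_apply, if_neg]
    rintro ⟨⟩
    simp at hax
  generalize hM₇' : Function.update M₆ (3, 3) (t + 1) = M₇ at r₇ b₇ hM₇
  have p3 : ∀ x, x ≠ 3 → M₇ (3, x) = M (3, x) := fun x hx => by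
    rw [hM₇ _ _ (.inr hx), hM₆ _ (by simp), hM₅ _ (by simp), m₄ _ _ (by simp)]
  have p7 : ∀ a x, a = 7 ∨ a = 9 → M₇ (a, x) = M₂ (a, x) := fun a x ha => by
    rw [hM₇ _ _ (by omega), hM₆ _ (by simp only; omega), hM₅ _ (by simp only; omega),
      hM₄ a x (by rcases ha with rfl | rfl <;> simp), m₃ _ _ (by omega)]
  have o : OutNeighbor k M₇ = OutNeighbor k M₂ :=
    OutNeighbor.congr (fun x => p7 _ _ (by simp)) fun x => p7 _ _ (by simp)
  refine ⟨σ₅, M₇, t + 1, outDegree k M₂,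
    (r₁.seq (r₂.seq (r₃.seq (r₄.seq (r₅.seq (r₆.seq r₇)))))).mono ?_ ?_, by omega,
    ⟨b₇.mem, (p3 0 (by omega)).trans hn, (p3 1 (by omega)).trans hs,
      (p3 2 (by omega)).trans hL, by simp [← hM₇'], ?_, ?_, fun _ _ h => h, ?_, ?_, ?_, ?_⟩,
    fun u _ => deg u, sum⟩
  · have e1 : k + 1 ≤ (k + 1) * len := Nat.le_mul_of_pos_right _ hpos
    have e2 : len ≤ (k + 1) * len := Nat.le_mul_of_pos_left _ (by omega)
    have e3 : (k + 1) * (1 + 4 * len) ≤ 5 * ((k + 1) * len) := by nlinarith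
    have e4 : (k + 1) * (3 * (3 * len) + 3) ≤ 12 * ((k + 1) * len) := by nlinarith
    have e5 : (k + 1) * (1 + 2 * len) ≤ 3 * ((k + 1) * len) := by nlinarith
    generalize (k + 1) * (1 + 4 * len) = x at *
    generalize (k + 1) * (3 * (3 * len) + 3) = y at *
    generalize (k + 1) * (1 + 2 * len) = z at *
    generalize (k + 1) * len = q at *
    omega
  · have e1 : k + 1 ≤ (L + 1) * (k + 1) := Nat.le_mul_of_pos_left _ (by omega)
    have e2 : (L + 2) * (k + 1) ≤ 2 * ((L + 1) * (k + 1)) := by nlinarith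
    generalize (L + 2) * (k + 1) = x at *
    generalize (L + 1) * (k + 1) = q at *
    omega
  · simpa only [hM₇ 4 _ (.inl (by omega)), hM₇ 5 _ (.inl (by omega))] using c₆
  · refine ⟨fun r y t ht hy hq => ?_, fun w hw d hd u hu hE h4 => ?_, fun w hw d hd u hu h4 => ?_⟩
    · simp only [hM₇ 6 _ (.inl (by omega)), hM₆ (6, _) (by simp)]
      exact t₅.consistent r y t ht hy hq
    · rw [hM₇ _ _ (by simp), hM₆ _ (by simp)] at h4 ⊢
      exact t₅.marked w hw d hd u hu hE h4
    · rw [hM₇ _ _ (by simp), hM₆ _ (by simp)] at h4 ⊢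
      exact t₅.unmarked w hw d hd u hu h4
  · rw [o]; exact out
  · rw [o]; exact fun u hu v h => (range u v hu h).1
  · intro u _; exact p7 _ _ (by simp)
  · intro i hi
    rw [hM₇ _ _ (by simp), hM₆ _ (by simp), hM₅ _ (by simp)]
    exact fresh i (by rwa [zero_add])

end WorkDepth

/-! ### The data structure -/

namespace WorkDepth

/-- By minimality of `k`, `2 ^ k ≤ 2 * n + 2 ≤ 4 * n ≤ n ^ 3`. -/
theorem machine_of_two_le {n : ℕ} (hn : 2 ≤ n) :
    Machine (n ^ 8) (n ^ 3200) (Nat.clog 2 (n + 2)) ∧ 2 ^ (Nat.clog 2 (n + 2) + 1) ≤ n ^ 4 := by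
  set k := Nat.clog 2 (n + 2) with hk
  have h2 : 2 ≤ k := by
    have : Nat.clog 2 (2 ^ 2) ≤ k := Nat.clog_mono_right 2 (by omega)
    rwa [Nat.clog_pow 2 2 (by omega)] at this
  have h3 : 2 ^ k ≤ n ^ 3 := by
    have : 2 ^ (k - 1) < n + 2 := Nat.pow_pred_clog_lt_self (b := 2) (x := n + 2) (by omega) (by omega)
    have e : 2 ^ k = 2 * 2 ^ (k - 1) := by rw [← pow_succ', Nat.sub_add_cancel (by omega)]
    have : 2 * 2 * n ≤ n * n * n := by gcongr
    rw [e, pow_succ, pow_two]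
    omega
  refine ⟨⟨?_, ?_, h2, ?_⟩, ?_⟩
  · exact hn.trans (Nat.le_self_pow (by omega) n)
  · rw [← pow_mul]
  · calc 2 ^ k * 2 ^ k ≤ n ^ 3 * n ^ 3 := Nat.mul_le_mul h3 h3
      _ = n ^ 6 := by rw [← pow_add]
      _ ≤ n ^ 8 := Nat.pow_le_pow_right (by omega) (by omega)
  · rw [pow_succ, pow_succ n 3]; exact Nat.mul_le_mul h3 hn

/-- Take logarithms of `2 ^ (k + 1) ≤ n ^ 4`, with `4 / log 2 < 6`. -/
theorem clog_succ_le_log {n : ℕ} (hn : 2 ≤ n) :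
    ((Nat.clog 2 (n + 2) + 1 : ℕ) : ℝ) ≤ 6 * Real.log n := by
  have h : ((2 : ℝ) ^ (Nat.clog 2 (n + 2) + 1)) ≤ (n : ℝ) ^ 4 := by
    exact_mod_cast (machine_of_two_le hn).2
  have h' := Real.log_le_log (by positivity) h
  rw [Real.log_pow, Real.log_pow] at h'
  have := Real.log_two_gt_d9
  have h0 : (0 : ℝ) ≤ ((Nat.clog 2 (n + 2) + 1 : ℕ) : ℝ) := Nat.cast_nonneg _
  push_cast at h' h0 ⊢
  nlinarith

theorem half_le_log {n : ℕ} (hn : 2 ≤ n) : 1 / 2 ≤ Real.log n := by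
  have := Real.log_two_gt_d9
  have : Real.log 2 ≤ Real.log n := Real.log_le_log (by norm_num) (by exact_mod_cast hn)
  linarith

theorem le_two_mul_sq {x : ℝ} (hx : 1 / 2 ≤ x) : x ≤ 2 * x ^ 2 := by nlinarith

/-! ### The input arrays as sets of edges. -/

section
variable {n : ℕ} (l : List (Fin n × Fin n)) (M : Mem)

theorem loadEdges_of_le {a : ℕ} (ha : 3 ≤ a) (x : ℕ) : loadEdges l M (a, x) = M (a, x) := by
  unfold loadEdges
  rw [if_neg (by simp; omega), if_neg (by simp only; omega), if_neg (by simp only; omega)]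

theorem loadEdges_length : loadEdges l M (0, 0) = l.length := by simp [loadEdges]

theorem loadEdges_source (j : ℕ) :
    loadEdges l M (1, j) = (l.map fun e => (e.1 : ℕ)).getD j 0 := by simp [loadEdges]

theorem loadEdges_target (j : ℕ) :
    loadEdges l M (2, j) = (l.map fun e => (e.2 : ℕ)).getD j 0 := by simp [loadEdges]

theorem loadEdges_lt {b : ℕ} (hM : ∀ p, M p < b) (hn : n ≤ b) (hl : l.length < b) (p : Loc) :
    loadEdges l M p < b := by
  have h0 : 0 < b := (Nat.zero_le _).trans_lt (hM p)
  have key : ∀ f : Fin n × Fin n → Fin n, ∀ j, (l.map fun e => (f e : ℕ)).getD j 0 < b := by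
    intro f j
    rw [List.getD_eq_getElem?_getD, List.getElem?_map]
    cases l[j]? with
    | none => simpa using h0
    | some e => simpa using (f e).2.trans_le hn
  unfold loadEdges
  split_ifs
  · exact hl
  · exact key _ _
  · exact key _ _
  · exact hM p

theorem exists_edge_iff (u v : ℕ) : (∃ e ∈ l, (e.1 : ℕ) = u ∧ (e.2 : ℕ) = v) ↔
    ∃ j < l.length, (l.map fun e => (e.1 : ℕ)).getD j 0 = u ∧
      (l.map fun e => (e.2 : ℕ)).getD j 0 = v := by
  have key : ∀ j (hj : j < l.length), ∀ f : Fin n × Fin n → Fin n,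
      (l.map fun e => (f e : ℕ)).getD j 0 = f l[j] := by
    intro j hj f
    rw [List.getD_eq_getElem?_getD, List.getElem?_map, List.getElem?_eq_getElem hj]
    rfl
  constructor
  · rintro ⟨e, he, rfl, rfl⟩
    obtain ⟨j, hj, rfl⟩ := List.mem_iff_getElem.1 he
    exact ⟨j, hj, key j hj _, key j hj _⟩
  · rintro ⟨j, hj, h1, h2⟩
    exact ⟨l[j], List.getElem_mem hj, by rw [← h1, key j hj], by rw [← h2, key j hj]⟩

end

theorem State.loadEdges {b k n s L e : ℕ} {dg : ℕ → ℕ} {E₀ E : ℕ → ℕ → Prop} {M : Mem}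
    (h : State b k n s L e dg E₀ E M) (hn : n ≤ b) {l : List (Fin n × Fin n)} (hl : l.length < b) :
    State b k n s L e dg E₀ E (loadEdges l M) := by
  have hM : ∀ a x, 3 ≤ a → _root_.loadEdges l M (a, x) = M (a, x) := fun a x ha =>
    loadEdges_of_le l M ha x
  have ho : OutNeighbor k (_root_.loadEdges l M) = OutNeighbor k M :=
    OutNeighbor.congr (fun x => hM _ _ (by omega)) fun x => hM _ _ (by omega)
  constructor
  · exact loadEdges_lt l M h.lt hn hl
  · rw [hM _ _ (by omega), h.n_eq]
  · rw [hM _ _ (by omega), h.s_eq]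
  · rw [hM _ _ (by omega), h.L_eq]
  · rw [hM _ _ (by omega), h.e_eq]
  · simpa only [hM 4 _ (by omega), hM 5 _ (by omega)] using h.certified
  · refine ⟨fun r y t ht hy hq => ?_, fun w hw d hd u hu hE h4 => ?_, fun w hw d hd u hu h4 => ?_⟩
    · simp only [hM 6 _ (by omega)]
      exact h.trees.consistent r y t ht hy hq
    · rw [hM _ _ (by omega)] at h4 ⊢
      exact h.trees.marked w hw d hd u hu hE h4
    · rw [hM _ _ (by omega)] at h4 ⊢
      exact h.trees.unmarked w hw d hd u hu h4
  · exact h.subset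
  · rw [ho]; exact h.out
  · rw [ho]; exact h.range
  · intro u hu; rw [← h.degree u hu]; exact hM _ _ (by omega)
  · intro i hi; rw [hM _ _ (by omega), h.fresh i hi]

/-- The edges that are left after the first `i` batches. -/
def remaining {n k : ℕ} (edges : List (Fin n × Fin n)) (batch : Fin k → List (Fin n × Fin n))
    (i : ℕ) (u v : ℕ) : Prop :=
  ∃ e ∈ edges, (e.1 : ℕ) = u ∧ (e.2 : ℕ) = v ∧ ∀ j : Fin k, (j : ℕ) < i → e ∉ batch j

theorem remaining_coe {n k : ℕ} {edges : List (Fin n × Fin n)}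
    {batch : Fin k → List (Fin n × Fin n)} {i : ℕ} (e : Fin n × Fin n) :
    remaining edges batch i e.1 e.2 ↔ e ∈ edges ∧ ∀ j : Fin k, (j : ℕ) < i → e ∉ batch j := by
  constructor
  · rintro ⟨e', he, h1, h2, h3⟩
    obtain rfl : e' = e := Prod.ext (Fin.ext h1) (Fin.ext h2)
    exact ⟨he, h3⟩
  · exact fun h => ⟨e, h.1, rfl, rfl, h.2⟩

theorem remaining_succ {n k : ℕ} {edges : List (Fin n × Fin n)}
    {batch : Fin k → List (Fin n × Fin n)} (i : Fin k) :
    (fun u v => remaining edges batch i u v ∧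
      ¬ ∃ e ∈ batch i, ((e.1 : Fin n) : ℕ) = u ∧ ((e.2 : Fin n) : ℕ) = v) =
      remaining edges batch (i + 1) := by
  funext u v
  apply propext
  constructor
  · rintro ⟨⟨e, he, h1, h2, h3⟩, h4⟩
    refine ⟨e, he, h1, h2, fun j hj hmem => ?_⟩
    rcases Nat.lt_succ_iff_lt_or_eq.1 hj with hj | hj
    · exact h3 j hj hmem
    · obtain rfl := Fin.ext hj
      exact h4 ⟨e, hmem, h1, h2⟩
  · rintro ⟨e, he, rfl, rfl, h3⟩
    refine ⟨⟨e, he, rfl, rfl, fun j hj => h3 j (by omega)⟩, ?_⟩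
    rintro ⟨e', he', h1, h2⟩
    obtain rfl : e' = e := Prod.ext (Fin.ext h1) (Fin.ext h2)
    exact h3 i (by omega) he'

/-- The batches are disjoint and free of repetitions, so they are disjoint subsets of the edge set.
-/
theorem sum_length_le {α : Type*} {k : ℕ} {l : List α} {batch : Fin k → List α}
    (h1 : ∀ i, (batch i).Nodup) (h2 : ∀ i, batch i ⊆ l)
    (h3 : ∀ i j, i ≠ j → (batch i).Disjoint (batch j)) : ∑ i, (batch i).length ≤ l.length := by
  classical
  have e : ∑ i, (batch i).length = (Finset.univ.biUnion fun i => (batch i).toFinset).card := by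
    rw [Finset.card_biUnion]
    · exact Finset.sum_congr rfl fun i _ => (List.toFinset_card_of_nodup (h1 i)).symm
    · intro i _ j _ hij
      exact List.disjoint_toFinset_iff_disjoint.2 (h3 i j hij)
  rw [e]
  refine (Finset.card_le_card (t := l.toFinset) ?_).trans (List.toFinset_card_le l)
  intro x hx
  simp only [Finset.mem_biUnion, List.mem_toFinset] at hx ⊢
  obtain ⟨i, -, hi⟩ := hx
  exact h2 i hi

theorem length_le_sq {n : ℕ} {l : List (Fin n × Fin n)} (h : l.Nodup) : l.length ≤ n * n := by
  simpa using h.length_le_card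

/-- The sequence of the states of the memory and of the uses of the machine. -/
theorem exists_run {k : ℕ} {R : ℕ → Mem → Prop} {S : ℕ → Mem → Mem → Regs → Usage → Prop}
    {M₀ : Mem} (h0 : R 0 M₀)
    (h : ∀ i < k, ∀ M, R i M → ∃ M' σ u, S i M M' σ u ∧ R (i + 1) M') :
    ∃ (M : ℕ → Mem) (σ : Fin k → Regs) (u : Fin k → Usage), M 0 = M₀ ∧
      (∀ i ≤ k, R i (M i)) ∧ ∀ i : Fin k, S i (M i) (M (i + 1)) (σ i) (u i) := by
  classical
  have h' : ∀ i M, ∃ M', i < k → R i M → ∃ σ u, S i M M' σ u ∧ R (i + 1) M' := by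
    intro i M
    by_cases hi : i < k ∧ R i M
    · obtain ⟨M', σ, u, h⟩ := h i hi.1 M hi.2
      exact ⟨M', fun _ _ => ⟨σ, u, h⟩⟩
    · exact ⟨M, fun h1 h2 => absurd ⟨h1, h2⟩ hi⟩
  choose f hf using h'
  let M : ℕ → Mem := fun i => Nat.rec M₀ (fun i M => f i M) i
  have hM : ∀ i ≤ k, R i (M i) := by
    intro i
    induction i with
    | zero => exact fun _ => h0
    | succ i ih =>
      intro hi
      obtain ⟨σ, u, -, h⟩ := hf i (M i) hi (ih (by omega))
      exact h
  choose σ u hu using fun i : Fin k => hf i (M i) i.2 (hM i i.2.le)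
  exact ⟨M, σ, u, rfl, hM, fun i => (hu i).1⟩

/-- The potential stands on both sides to avoid subtraction of natural numbers. -/
theorem sum_telescope {k : ℕ} {w a : Fin k → ℕ} {f : ℕ → ℕ}
    (h : ∀ i : Fin k, w i + f i ≤ a i + f (i + 1)) : ∑ i, w i + f 0 ≤ ∑ i, a i + f k := by
  induction k with
  | zero => simp
  | succ k ih =>
    have h1 := ih (w := fun i => w i.castSucc) (a := fun i => a i.castSucc)
      fun i => by simpa using h i.castSucc
    have h2 := h (Fin.last k)
    rw [Fin.sum_univ_castSucc, Fin.sum_univ_castSucc]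
    simp only [Fin.val_last] at h2
    omega

end WorkDepth

theorem theorem2 :
    ∃ (init delete : Cmd) (c : ℕ) (C : ℝ),
      ∀ (n : ℕ) (_ : 2 ≤ n) (edges : List (Fin n × Fin n)) (_ : edges ≠ []) (_ : edges.Nodup)
        (s : Fin n) (L : ℕ) (_ : 1 ≤ L) (_ : L ≤ n),
      ∃ (M₀ : Mem) (σ₀ : Regs) (u₀ : Usage),
        Exec (n ^ c) init (fun _ => 0) (loadEdges edges (paramMem n s L)) σ₀ M₀ u₀ ∧
        HoldsTree M₀ {e | e ∈ edges} s L ∧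
        (u₀.work : ℝ) ≤ C * (edges.length * Real.log n) ∧
        (u₀.depth : ℝ) ≤ C * (L * Real.log n + Real.log n ^ 2) ∧
        ∀ (k : ℕ) (batch : Fin k → List (Fin n × Fin n)),
          (∀ i, batch i ≠ []) → (∀ i, (batch i).Nodup) → (∀ i, batch i ⊆ edges) →
          (∀ i j, i ≠ j → (batch i).Disjoint (batch j)) →
          ∃ (M : ℕ → Mem) (σ : Fin k → Regs) (u : Fin k → Usage),
            M 0 = M₀ ∧
            (∀ i : Fin k,
              Exec (n ^ c) delete (fun _ => 0) (loadEdges (batch i) (M i)) (σ i) (M (i + 1))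
                (u i) ∧
              HoldsTree (M (i + 1)) {e | e ∈ edges ∧ ∀ j ≤ i, e ∉ batch j} s L ∧
              ((u i).depth : ℝ) ≤ C * (L * Real.log n ^ 2)) ∧
            ((∑ i, (u i).work : ℕ) : ℝ) ≤ C * (edges.length * (L * Real.log n)) := by
  -- The exponent is `8 * 400`. The constant is dominated by the work of the deletions, `50401 * 6 *
  -- 54`.
  refine ⟨init, delete, 3200, 20000000, fun n hn edges hne hnd s L hL hLn => ?_⟩
  obtain ⟨hm, -⟩ := machine_of_two_le hn
  have hlog := clog_succ_le_log hn
  have hhalf := half_le_log hn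
  set k := Nat.clog 2 (n + 2) with hk
  set m := edges.length with hmdef
  have hm0 : 0 < m := List.length_pos_iff.2 hne
  have hmn : m ≤ n * n := length_le_sq hnd
  -- The number of an epoch must fit into a cell: there are at most `n * n` batches, each of which
  -- uses `L + 2` rows, and the initialization uses at most as many.
  have hbig : (n * n + 2) * (n + 2) < n ^ 8 := by
    have h4 : 2 * 2 ≤ n * n := Nat.mul_le_mul hn hn
    calc (n * n + 2) * (n + 2) ≤ (n * n + n * n) * (n + n) :=
          Nat.mul_le_mul (by omega) (by omega)
      _ = 4 * n ^ 3 := by ring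
      _ ≤ n * n * n ^ 3 := Nat.mul_le_mul_right _ h4
      _ = n ^ 5 := by ring
      _ < n ^ 8 := Nat.pow_lt_pow_right (by omega) (by omega)
  have hsmall : n * n + n + 4 ≤ (n * n + 2) * (n + 2) := by nlinarith
  have hnb : n ≤ n ^ 8 := Nat.le_self_pow (by omega) n
  have hLR : (1 : ℝ) ≤ L := by exact_mod_cast hL
  set E₀ : ℕ → ℕ → Prop := fun u v => ∃ e ∈ edges, (e.1 : ℕ) = u ∧ (e.2 : ℕ) = v with hE₀
  have hE₀n : ∀ u v, E₀ u v → u < n ∧ v < n := by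
    rintro u v ⟨e, -, rfl, rfl⟩
    exact ⟨e.1.2, e.2.2⟩
  have par : ∀ a x, 3 ≤ a → loadEdges edges (paramMem n s L) (a, x) = paramMem n s L (a, x) :=
    fun a x ha => loadEdges_of_le _ _ ha x
  obtain ⟨σ₀, M₀, e₀, dg, ⟨u₀, hu₀, hw₀, hd₀⟩, he₀, hS₀, hdg, hsum⟩ := init_runs (s := s) (L := L)
    (len := m) (E := E₀) hm
    (loadEdges_lt edges (paramMem n s L) (fun p => by
      have := s.2
      unfold paramMem; split_ifs <;> omega) hnb (by omega))
    (by rw [par _ _ (by omega)]; simp [paramMem]) (by rw [par _ _ (by omega)]; simp [paramMem])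
    (by rw [par _ _ (by omega)]; simp [paramMem]) (by rw [par _ _ (by omega)]; simp [paramMem])
    (fun a x ha => by
      rw [par _ _ (by omega)]
      unfold paramMem
      rw [if_neg, if_neg, if_neg] <;> (rw [Prod.mk.injEq]; omega))
    s.2 hLn (by omega) (loadEdges_length _ _) hm0 (fun j _ => loadEdges_source _ _ j)
    (fun j _ => loadEdges_target _ _ j)
    (fun j hj => hE₀n _ _ ((exists_edge_iff edges _ _).2 ⟨j, hj, rfl, rfl⟩))
    (fun u v => exists_edge_iff edges u v)
  rw [← hk] at hw₀ hd₀ hS₀ hdg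
  refine ⟨M₀, σ₀, u₀, hu₀, ?_, ?_, ?_, ?_⟩
  · have := hS₀.certified.holdsTree hE₀n
    convert this using 1
    ext e
    refine ⟨fun h => ⟨e, h, rfl, rfl⟩, ?_⟩
    rintro ⟨e', he, h1, h2⟩
    obtain rfl : e' = e := Prod.ext (Fin.ext h1) (Fin.ext h2)
    exact he
  · have h1 : (u₀.work : ℝ) ≤ 450000 * ((k + 1 : ℕ) * m) := by exact_mod_cast hw₀
    have h2 : ((k + 1 : ℕ) : ℝ) * m ≤ 6 * Real.log n * m := by gcongr
    have h3 : 0 ≤ (m : ℝ) * Real.log n := by positivity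
    linarith
  · have h1 : (u₀.depth : ℝ) ≤ 100000 * ((L + 1) * (k + 1 : ℕ)) := by exact_mod_cast hd₀
    have h2 : (L + 1 : ℝ) * (k + 1 : ℕ) ≤ (2 * L) * (6 * Real.log n) := by gcongr; linarith
    have h3 : 0 ≤ (L : ℝ) * Real.log n := by positivity
    have h4 : 0 ≤ Real.log n ^ 2 := by positivity
    linarith
  intro K batch hb1 hb2 hb3 hb4
  have hlen := sum_length_le hb2 hb3 hb4
  have hpos : ∀ i, 1 ≤ (batch i).length := fun i => List.length_pos_iff.2 (hb1 i)
  -- Batches are nonempty and disjoint, so the fixed cost of a batch can be charged to one of its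
  -- edges.
  have hK : K ≤ m := by
    refine le_trans ?_ hlen
    simpa using Finset.sum_le_sum fun i (_ : i ∈ Finset.univ) => hpos i
  have hEn : ∀ i u v, remaining edges batch i u v → u < n ∧ v < n := by
    rintro i u v ⟨e, -, rfl, rfl, -⟩
    exact ⟨e.1.2, e.2.2⟩
  set A := 50401 * (k + 1) with hA
  set Φ : Mem → ℕ := fun M => potential n L dg fun v => M (4, v) with hΦ
  obtain ⟨M, σ, u, hM0, hR, hrun⟩ := exists_run (k := K) (M₀ := M₀)
    (R := fun i M => ∃ e ≤ (i + 1) * (L + 2),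
      State (n ^ 8) k n s L e dg E₀ (remaining edges batch i) M)
    (S := fun i M M' σ u => ∀ hi : i < K,
      Exec (n ^ 3200) delete (fun _ => 0) (loadEdges (batch ⟨i, hi⟩) M) σ M' u ∧
      u.depth ≤ 70000 * ((L + 1) * (k + 1)) ∧
      u.work + A * (2 * Φ M) ≤ A * (6 * ((L + 1) * ((batch ⟨i, hi⟩).length + 1)) + 2 * Φ M'))
    ⟨e₀, by omega, by
      have : remaining edges batch 0 = E₀ := by
        funext u v; simp [remaining, hE₀]
      rw [this]; exact hS₀⟩
    (by
      rintro i hi M ⟨e, he, hS⟩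
      have hl : (batch ⟨i, hi⟩).length ≤ n * n := length_le_sq (hb2 _)
      have h1 : (i + 1) * (L + 2) ≤ (n * n) * (n + 2) := Nat.mul_le_mul (by omega) (by omega)
      have h2 : (n * n + 2) * (n + 2) = n * n * (n + 2) + 2 * (n + 2) := by ring
      have hS' := hS.loadEdges hnb (l := batch ⟨i, hi⟩) (by omega)
      obtain ⟨σ', M', w, ⟨u, hu, huw, hud⟩, hS'', hw⟩ := delete_runs hm hE₀n hS' s.2 hLn hdg
        (by omega) (by omega) (loadEdges_length _ _) (fun j _ => loadEdges_source _ _ j)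
        (fun j _ => loadEdges_target _ _ j) (fun j hj => by
          obtain ⟨e, he, h⟩ := (exists_edge_iff (batch ⟨i, hi⟩) _ _).2 ⟨j, hj, rfl, rfl⟩
          exact ⟨e, hb3 _ he, h⟩)
      simp only [← exists_edge_iff] at hS''
      rw [remaining_succ ⟨i, hi⟩] at hS''
      refine ⟨M', σ', u, fun _ => ⟨hu, hud, ?_⟩, e + L + 2, ?_, hS''⟩
      · have h3 : Φ (loadEdges (batch ⟨i, hi⟩) M) = Φ M := by
          simp only [hΦ, loadEdges_of_le _ _ (show 3 ≤ 4 by omega)]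
        change w + A * (2 * Φ (loadEdges (batch ⟨i, hi⟩) M)) ≤ _ at hw
        rw [h3] at hw
        exact (Nat.add_le_add_right huw _).trans hw
      · rw [add_mul (i + 1)]; omega)
  refine ⟨M, σ, u, hM0, fun i => ?_, ?_⟩
  · obtain ⟨h1, h2, -⟩ := hrun i i.2
    refine ⟨h1, ?_, ?_⟩
    · obtain ⟨e, -, hS⟩ := hR (i + 1) i.2
      have := hS.certified.holdsTree (hEn _)
      convert this using 1
      ext e
      rw [Set.mem_ofPred_eq, Set.mem_ofPred_eq, remaining_coe]
      simp only [Fin.le_def, Nat.lt_succ_iff]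
    · have h3 : ((u i).depth : ℝ) ≤ 70000 * ((L + 1) * (k + 1 : ℕ)) := by exact_mod_cast h2
      have h4 : (L + 1 : ℝ) * (k + 1 : ℕ) ≤ (2 * L) * (6 * Real.log n) := by gcongr; linarith
      -- The bound obtained has a single logarithm; it is weakened to the stated one by `1 / 2 ≤ log
      -- n`.
      have h5 : (L : ℝ) * Real.log n ≤ L * (2 * Real.log n ^ 2) := by
        gcongr; exact le_two_mul_sq hhalf
      have h6 : 0 ≤ (L : ℝ) * Real.log n ^ 2 := by positivity
      linarith
  · have h1 := sum_telescope (w := fun i => (u i).work) (f := fun i => A * (2 * Φ (M i)))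
      (a := fun i => A * (6 * ((L + 1) * ((batch i).length + 1)))) fun i => by
        rw [← mul_add]; exact (hrun i i.2).2.2
    -- Only the final potential matters: the total degree is at most `3 * m` and every height at
    -- most `L + 2`. The initial potential is dropped.
    have h2 : Φ (M K) ≤ 3 * m * (L + 2) := by
      obtain ⟨e, -, hS⟩ := hR K le_rfl
      exact (potential_le hS.certified.le).trans (Nat.mul_le_mul_right _ hsum)
    have h3 : ∑ i, A * (6 * ((L + 1) * ((batch i).length + 1))) ≤ A * (6 * ((L + 1) * (2 * m))) := by
      rw [← Finset.mul_sum, ← Finset.mul_sum, ← Finset.mul_sum, Finset.sum_add_distrib]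
      refine Nat.mul_le_mul_left _ (Nat.mul_le_mul_left _ (Nat.mul_le_mul_left _ ?_))
      simp only [Finset.sum_const, Finset.card_univ, Fintype.card_fin, smul_eq_mul, mul_one]
      omega
    have h4 : A * (2 * Φ (M K)) ≤ A * (2 * (3 * m * (L + 2))) :=
      Nat.mul_le_mul_left _ (Nat.mul_le_mul_left _ h2)
    have h5 : ∑ i, (u i).work ≤ 50401 * (k + 1) * (m * (54 * L)) := by
      have : A * (6 * ((L + 1) * (2 * m))) + A * (2 * (3 * m * (L + 2))) ≤ A * (m * (54 * L)) := by
        rw [← mul_add]; refine Nat.mul_le_mul_left _ ?_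
        calc 6 * ((L + 1) * (2 * m)) + 2 * (3 * m * (L + 2)) = m * (18 * L + 24) := by ring
          _ ≤ m * (54 * L) := Nat.mul_le_mul_left _ (by omega)
      rw [← hA]; omega
    have h6 : ((∑ i, (u i).work : ℕ) : ℝ) ≤ 50401 * (k + 1 : ℕ) * (m * (54 * L)) := by
      exact_mod_cast h5
    have h7 : (50401 : ℝ) * (k + 1 : ℕ) * (m * (54 * L)) ≤
        50401 * (6 * Real.log n) * (m * (54 * L)) := by gcongr
    have h8 : 0 ≤ (m : ℝ) * (L * Real.log n) := by positivity
    linarith
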